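/- For a permutation $\pi\in S_n$, let $p(\pi)$ denote its number of peaks, i.e. the number of positions $1<i<n$ with $\pi(i-1)<\pi(i)>\pi(i+1)$. Theorem. For each $s>0$ there exists a constant $C=C(s)>0$, depending only on $s$, such that the following is true. Let $n\ge 1$, let $\lambda=1^{n_1}2^{n_2}\cdots$ be a partition of $n$ (with $n_i$ parts of size $i$), let $\mathcal{C}_\lambda\subseteq S_n$ be the conjugacy class of all permutations of cycle type $\lambda$ (so that $n_1$ is the number of fixed points), and let $\pi$ be chosen uniformly at random from $\mathcal{C}_\lambda$. Put $\alpha_1=n_1/n$. Then \[ \mathbb{E}\left[e^{-s\,p(\pi)/\sqrt{n}}\right] =\exp\left\{-\frac{1-\alpha_1^3}{3}\,s\sqrt{n}+\left(\frac{1}{45}+\frac{\alpha_1^3}{18}-\frac{3\alpha_1^5}{10}+\frac{2\alpha_1^6}{9}\right)s^2+E_{\lambda,s}\right\}, \] where $|E_{\lambda,s}|\le C\,n^{-1/4}$. -/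

import Mathlib

/-!
For a permutation `π` of `n` points let `Ω π B` be the number of sequences over `B` letters that
are compatible with `π` as enriched `P`-partitions. By Stembridge's identity `∑ a, Ω π (2 a) t ^ a`
equals `((1 + t) / (1 - t)) ^ (n + 1) (4 t / (1 + t) ^ 2) ^ (p π + 1) / 2`, so that choosing
`t = exp (-θ)` with `4 t / (1 + t) ^ 2 = exp (-s / √n)` turns the mean over a conjugacy class into
the Laplace transform of the number of peaks. The mean of `Ω π (2 a)` over the class is controlled
cycle by cycle: conjugating, it counts assignments of letters to the points together with an order
reproduced by the permutation, which is nearly forced by the letters on the nontrivial cycles. It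
is therefore close to `(2 a) ^ (n - n₁)` times the count for the identity on the `n₁` fixed points,
up to a factor independent of `a`, and for the identity a three-term recursion gives the expansion
`exp (c (x / a) ^ 2 - d (x / a) ^ 4)` of the deviation from a pure power, where `x = n / θ`. Near
the peak `a = x` of the sum that factor agrees with `exp (c - d) (x / a) ^ J` for an integer
`J ≈ 2 c`, which leaves the sum `∑ a, a ^ (n - J) exp (-θ a) ≈ (n - J)! / θ ^ (n - J + 1)`.
Expanding the logarithm of the outcome in `1 / √n` gives the theorem.
-/

/-- The number of peaks of a permutation `π` of `{0, …, n - 1}`: the number of positions `i` that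
have both a predecessor `j = i - 1` and a successor `k = i + 1`, with `π j < π i > π k`. -/
def peaks {n : ℕ} (π : Equiv.Perm (Fin n)) : ℕ :=
  (Finset.univ.filter fun i : Fin n =>
    ∃ j k : Fin n, (j : ℕ) + 1 = i ∧ (i : ℕ) + 1 = k ∧ π j < π i ∧ π k < π i).card

/-- The conjugacy class of all permutations of cycle type `lam`; `Equiv.Perm.partition` records
all the cycle lengths, with a part `1` for every fixed point. -/
def cycleClass {n : ℕ} (lam : n.Partition) : Finset (Equiv.Perm (Fin n)) :=
  Finset.univ.filter fun π => π.partition.parts = lam.parts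

/-- The expectation of `f π` for `π` uniform on the (nonempty) finite set `A`. -/
noncomputable def uniformExp {α : Type*} (A : Finset α) (f : α → ℝ) : ℝ :=
  (∑ π ∈ A, f π) / (A.card : ℝ)

/-- The density `n₁ / n` of fixed points, `n₁` being the number of parts of `lam` equal to `1`. -/
noncomputable def fixedDensity {n : ℕ} (lam : n.Partition) : ℝ :=
  (lam.parts.count 1 : ℝ) / (n : ℝ)

section LetterChains

/-- The admissible pairs of consecutive letters `l, l'` at the positions `k, k + 1` of an enriched
`P`-partition: letters weakly increase, and a letter may be repeated only at an ascent if it is odd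
and only at a non-ascent if it is even (the odd and even letters are Stembridge's unmarked and
marked letters). -/
def LetterStep (asc : ℕ → Prop) (k l l' : ℕ) : Prop :=
  l < l' ∨ l = l' ∧ (Odd l ↔ asc k)

/-- The sequences of `k + 1` letters all of whose consecutive pairs are admissible. -/
def LetterChain (asc : ℕ → Prop) {k B : ℕ} (f : Fin (k + 1) → Fin B) : Prop :=
  ∀ i : Fin k, LetterStep asc i (f i.castSucc) (f i.succ)

open Classical in
/-- The number of letter chains of length `k + 1` with last letter `l`, by its recursion in `k`. -/
noncomputable def chainCount (asc : ℕ → Prop) : ℕ → ℕ → ℕ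
  | 0, _ => 1
  | k + 1, l => ∑ j ∈ Finset.range l, chainCount asc k j +
      if Odd l ↔ asc k then chainCount asc k l else 0

theorem letterChain_snoc {asc : ℕ → Prop} {k B : ℕ} (f : Fin (k + 1) → Fin B) (l : Fin B) :
    LetterChain asc (Fin.snoc f l : Fin (k + 2) → Fin B) ↔
      LetterChain asc f ∧ LetterStep asc k (f (Fin.last k)) l := by
  simp only [LetterChain, Fin.forall_fin_succ', Fin.succ_last, Fin.snoc_last, Fin.snoc_castSucc,
    Fin.val_castSucc, Fin.val_last, Fin.succ_castSucc]

open Classical in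
theorem sum_ite_letterStep (asc : ℕ → Prop) {B : ℕ} (k : ℕ) (x : ℕ → ℕ) (l' : Fin B) :
    (∑ l : Fin B, if LetterStep asc k l l' then x l else 0) =
      ∑ j ∈ Finset.range l', x j + if Odd (l' : ℕ) ↔ asc k then x l' else 0 := by
  rw [← Finset.sum_range fun l => if LetterStep asc k l l' then x l else 0]
  have hsub : Finset.range (l' + 1) ⊆ Finset.range B := Finset.range_subset_range.2 l'.2
  rw [← Finset.sum_subset hsub fun l _ hl => if_neg ?_, Finset.sum_range_succ]
  · congr 1
    · exact Finset.sum_congr rfl fun j hj => if_pos (Or.inl (Finset.mem_range.1 hj))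
    · simp [LetterStep]
  · simp only [Finset.mem_range, LetterStep] at hl ⊢
    omega

open Classical in
theorem sum_ite_letterChain (asc : ℕ → Prop) (B k : ℕ) (φ : Fin B → ℕ) :
    (∑ f : Fin (k + 1) → Fin B, if LetterChain asc f then φ (f (Fin.last k)) else 0) =
      ∑ l : Fin B, chainCount asc k l * φ l := by
  induction k generalizing φ with
  | zero =>
    simp only [LetterChain, IsEmpty.forall_iff, if_true, chainCount, one_mul]
    exact Fintype.sum_equiv (Equiv.funUnique (Fin 1) (Fin B)) _ _ fun _ => rfl
  | succ k ih =>
    calc _ = ∑ f : Fin (k + 1) → Fin B, if LetterChain asc f then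
          (∑ l' : Fin B, if LetterStep asc k (f (Fin.last k)) l' then φ l' else 0) else 0 := by
          rw [← (Fin.snocEquiv fun _ : Fin (k + 2) => Fin B).sum_comp, Fintype.sum_prod_type_right]
          refine Finset.sum_congr rfl fun f _ => ?_
          by_cases hf : LetterChain asc f <;>
            simp [Fin.snocEquiv, letterChain_snoc, hf]
      _ = ∑ l : Fin B, chainCount asc k l *
          ∑ l' : Fin B, (if LetterStep asc k l l' then φ l' else 0) :=
          ih fun l => ∑ l' : Fin B, if LetterStep asc k l l' then φ l' else 0
      _ = ∑ l' : Fin B,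
          (∑ l : Fin B, if LetterStep asc k l l' then chainCount asc k l else 0) * φ l' := by
          simp only [Finset.mul_sum, Finset.sum_mul, mul_ite, ite_mul, mul_zero, zero_mul]
          exact Finset.sum_comm
      _ = ∑ l' : Fin B, chainCount asc (k + 1) l' * φ l' := by
          simp only [sum_ite_letterStep, chainCount]

open Classical in
theorem card_letterChain (asc : ℕ → Prop) (B k : ℕ) :
    Fintype.card {f : Fin (k + 1) → Fin B // LetterChain asc f} =
      ∑ l ∈ Finset.range B, chainCount asc k l := by
  have h := sum_ite_letterChain asc B k fun _ => 1
  simp only [mul_one] at h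
  rw [Fintype.card_subtype, Finset.card_filter, h, Finset.sum_range]

end LetterChains

section GeneratingFunction

theorem hasSum_sum_range_mul_pow {x : ℕ → ℝ} (hx : ∀ c, 0 ≤ x c) {t X : ℝ} (ht0 : 0 < t)
    (ht1 : t < 1) (h : HasSum (fun c => x c * t ^ c) X) :
    HasSum (fun c => (∑ j ∈ Finset.range c, x j) * t ^ c) (t / (1 - t) * X) := by
  have hgeom := hasSum_geometric_of_lt_one ht0.le ht1
  have hnorm : Summable fun c => ‖x c * t ^ c‖ := by
    simpa only [Real.norm_of_nonneg (mul_nonneg (hx _) (pow_nonneg ht0.le _))] using h.summable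
  have hgnorm : Summable fun c => ‖t ^ c‖ := by
    simpa only [Real.norm_of_nonneg (pow_nonneg ht0.le _)] using hgeom.summable
  have hprod := (hasSum_sum_range_mul_of_summable_norm hnorm hgnorm).mul_left t
  rw [h.tsum_eq, hgeom.tsum_eq] at hprod
  rw [← hasSum_nat_add_iff' 1, show t / (1 - t) * X = t * (X * (1 - t)⁻¹) by ring]
  simp only [Finset.range_one, Finset.sum_singleton, Finset.range_zero, Finset.sum_empty, zero_mul,
    sub_zero]
  refine hprod.congr_fun fun c => ?_
  rw [Finset.sum_mul, Finset.mul_sum]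
  refine Finset.sum_congr rfl fun j hj => ?_
  rw [show c + 1 = 1 + j + (c - j) by have := Finset.mem_range.1 hj; omega]
  ring

theorem sum_range_two_mul {M : Type*} [AddCommMonoid M] (F : ℕ → M) (c : ℕ) :
    ∑ j ∈ Finset.range (2 * c), F j = ∑ j ∈ Finset.range c, (F (2 * j) + F (2 * j + 1)) := by
  induction c with
  | zero => simp
  | succ c ih =>
    rw [Nat.mul_succ, Finset.sum_range_succ, Finset.sum_range_succ, ih, Finset.sum_range_succ,
      add_assoc]

open Classical in
/-- The number of `j` with `j + 1 < k` at which an ascent is followed by a descent. -/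
noncomputable def turnCount (asc : ℕ → Prop) (k : ℕ) : ℕ :=
  ((Finset.range (k - 1)).filter fun j => asc j ∧ ¬ asc (j + 1)).card

open Classical in
theorem turnCount_add_two (asc : ℕ → Prop) (k : ℕ) :
    turnCount asc (k + 2) = turnCount asc (k + 1) + if asc k ∧ ¬ asc (k + 1) then 1 else 0 := by
  simp only [turnCount, Nat.add_sub_cancel, Nat.add_succ_sub_one, Finset.range_add_one,
    Finset.filter_insert]
  split_ifs <;> simp

open Classical in
/-- The generating functions, at `t`, of the numbers of letter chains of length `k + 1` ending in
the letters `2c` (first component) and `2c + 1` (second component). -/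
noncomputable def chainGF (asc : ℕ → Prop) (t : ℝ) : ℕ → ℝ × ℝ
  | 0 => ((1 - t)⁻¹, (1 - t)⁻¹)
  | k + 1 =>
    let U := (chainGF asc t k).1
    let V := (chainGF asc t k).2
    if asc k then (t / (1 - t) * (U + V), t / (1 - t) * (U + V) + U + V)
    else (t / (1 - t) * (U + V) + U, t / (1 - t) * (U + V) + U)

variable {t : ℝ} (asc : ℕ → Prop)

theorem hasSum_sum_range_two_mul_mul_pow (ht0 : 0 < t) (ht1 : t < 1) {x : ℕ → ℕ} {U V : ℝ}
    (hU : HasSum (fun c => (x (2 * c) : ℝ) * t ^ c) U)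
    (hV : HasSum (fun c => (x (2 * c + 1) : ℝ) * t ^ c) V) :
    HasSum (fun c => ((∑ j ∈ Finset.range (2 * c), x j : ℕ) : ℝ) * t ^ c)
      (t / (1 - t) * (U + V)) := by
  have h := hasSum_sum_range_mul_pow (x := fun c => (x (2 * c) : ℝ) + x (2 * c + 1))
    (fun c => by positivity) ht0 ht1 (by simpa only [add_mul] using hU.add hV)
  simpa only [sum_range_two_mul, Nat.cast_sum, Nat.cast_add] using h

theorem hasSum_chainGF (ht0 : 0 < t) (ht1 : t < 1) (k : ℕ) :
    HasSum (fun c => (chainCount asc k (2 * c) : ℝ) * t ^ c) (chainGF asc t k).1 ∧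
      HasSum (fun c => (chainCount asc k (2 * c + 1) : ℝ) * t ^ c) (chainGF asc t k).2 := by
  induction k with
  | zero => simpa [chainCount, chainGF] using hasSum_geometric_of_lt_one ht0.le ht1
  | succ k ih =>
    obtain ⟨hU, hV⟩ := ih
    have hP := hasSum_sum_range_two_mul_mul_pow ht0 ht1 hU hV
    by_cases hk : asc k
    · have hodd := (hP.add hU).add hV
      simp only [← add_mul] at hodd
      simpa [chainCount, chainGF, hk, Finset.sum_range_succ,
        Nat.not_odd_iff_even.2 (even_two_mul _)]
        using And.intro hP hodd
    · have heven := hP.add hU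
      simp only [← add_mul] at heven
      simpa [chainCount, chainGF, hk, Finset.sum_range_succ] using heven

theorem chainGF_fst_succ (ht1 : t < 1) (k : ℕ) [Decidable (asc k)] :
    (chainGF asc t (k + 1)).1 =
      (if asc k then t else 1) * (chainGF asc t (k + 1)).2 := by
  have h1t : 1 - t ≠ 0 := by linarith
  by_cases hk : asc k
  · simp only [chainGF, hk, if_true]
    field_simp
    ring
  · simp only [chainGF, hk, if_false, one_mul]

theorem chainGF_add (ht0 : 0 < t) (ht1 : t < 1) (k : ℕ) :
    (chainGF asc t k).1 + (chainGF asc t k).2 =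
      2 / (1 - t) * ((1 + t) / (1 - t)) ^ k * (4 * t / (1 + t) ^ 2) ^ turnCount asc k := by
  classical
  have h1t : 1 - t ≠ 0 := by linarith
  have h1t' : 1 + t ≠ 0 := by linarith
  induction k using Nat.twoStepInduction with
  | zero =>
    simp only [chainGF, turnCount, zero_tsub, Finset.range_zero, Finset.filter_empty,
      Finset.card_empty, pow_zero]
    ring
  | one =>
    simp only [chainGF, turnCount, tsub_self, Finset.range_zero, Finset.filter_empty,
      Finset.card_empty, pow_zero]
    split_ifs <;> field_simp <;> ring
  | more k _ ih =>
    have hrel := chainGF_fst_succ asc ht1 k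
    have hstep : (chainGF asc t (k + 2)).1 + (chainGF asc t (k + 2)).2 =
        (1 + t) / (1 - t) * (if asc k ∧ ¬ asc (k + 1) then 4 * t / (1 + t) ^ 2 else 1) *
          ((chainGF asc t (k + 1)).1 + (chainGF asc t (k + 1)).2) := by
      rw [chainGF]
      by_cases hk : asc k <;> by_cases hk' : asc (k + 1) <;>
        simp only [hk, hk', hrel, if_true, if_false, not_true_eq_false, not_false_eq_true, and_true,
          and_false] <;>
        field_simp <;> ring
    rw [hstep, ih, turnCount_add_two]
    split_ifs <;> ring

theorem hasSum_sum_chainCount (ht0 : 0 < t) (ht1 : t < 1) (k : ℕ) :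
    HasSum (fun a => ((∑ l ∈ Finset.range (2 * a), chainCount asc k l : ℕ) : ℝ) * t ^ a)
      (2 * t / (1 - t) ^ 2 * ((1 + t) / (1 - t)) ^ k *
        (4 * t / (1 + t) ^ 2) ^ turnCount asc k) := by
  obtain ⟨hU, hV⟩ := hasSum_chainGF asc ht0 ht1 k
  have h := hasSum_sum_range_two_mul_mul_pow ht0 ht1 hU hV
  rw [chainGF_add asc ht0 ht1] at h
  convert h using 1
  field_simp

end GeneratingFunction

section EnrichedSequences

variable {α : Type*} {σ : Equiv.Perm α} {g : α → ℕ} {r : α → α → Prop}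

/-- The relation obtained by comparing letters first and breaking ties between equal letters by the
relation `r` on the images under `σ`: in the direction of `r` for odd letters and in the opposite
direction for even letters. -/
def SignedLex (σ : Equiv.Perm α) (g : α → ℕ) (r : α → α → Prop) (x y : α) : Prop :=
  g x < g y ∨ g x = g y ∧ (Odd (g x) ∧ r (σ x) (σ y) ∨ ¬ Odd (g x) ∧ r (σ y) (σ x))

instance SignedLex.isStrictTotalOrder [IsStrictTotalOrder α r] :
    IsStrictTotalOrder α (SignedLex σ g r) where
  irrefl x := by simp [SignedLex, irrefl_of r]
  trans x y z hxy hyz := by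
    have h₁ : r (σ x) (σ y) → r (σ y) (σ z) → r (σ x) (σ z) := trans_of r
    have h₂ : r (σ z) (σ y) → r (σ y) (σ x) → r (σ z) (σ x) := trans_of r
    grind [SignedLex]
  trichotomous x y hxy hyx := by
    have hr := trichotomous_of r (σ x) (σ y)
    rw [σ.injective.eq_iff] at hr
    grind [SignedLex]

/-- The letter sequences compatible with `π` in the sense of enriched `P`-partitions. -/
def Enriched {n B : ℕ} (π : Equiv.Perm (Fin n)) (f : Fin n → Fin B) : Prop :=
  ∀ i j, i < j → SignedLex π (fun i => (f i : ℕ)) (· < ·) i j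

/-- The number of compatible letter sequences with `B` letters; as a function of `B` this is the
order polynomial of enriched `P`-partitions. -/
noncomputable def enrichedCount {n : ℕ} (π : Equiv.Perm (Fin n)) (B : ℕ) : ℕ :=
  Nat.card {f : Fin n → Fin B // Enriched π f}

/-- The predicate on positions `i` that `π (i + 1)` exists and exceeds `π i`. -/
def AscentAt {n : ℕ} (π : Equiv.Perm (Fin n)) (i : ℕ) : Prop :=
  ∃ h : i + 1 < n, π ⟨i, by omega⟩ < π ⟨i + 1, h⟩

theorem not_ascentAt_iff {n : ℕ} (π : Equiv.Perm (Fin n)) {i : ℕ} (h : i + 1 < n) :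
    ¬ AscentAt π i ↔ π ⟨i + 1, h⟩ < π ⟨i, by omega⟩ := by
  have hne : π ⟨i + 1, h⟩ ≠ π ⟨i, by omega⟩ := fun he => by simpa using π.injective he
  simp only [AscentAt, h, exists_true_left, not_lt, hne.le_iff_lt]

theorem enriched_iff_letterChain {k B : ℕ} (π : Equiv.Perm (Fin (k + 1)))
    (f : Fin (k + 1) → Fin B) : Enriched π f ↔ LetterChain (AscentAt π) f := by
  refine (Fin.liftFun_iff_succ (SignedLex π (fun i => (f i : ℕ)) (· < ·)) (f := id)).trans
    (forall_congr' fun i => ?_)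
  have hasc : π i.castSucc < π i.succ ↔ AscentAt π i := ⟨fun h => ⟨by omega, h⟩, fun ⟨_, h⟩ => h⟩
  have hdesc : π i.succ < π i.castSucc ↔ ¬ AscentAt π i := (not_ascentAt_iff π (by omega)).symm
  simp only [SignedLex, LetterStep, id, hasc, hdesc]
  tauto

theorem enrichedCount_succ {k : ℕ} (π : Equiv.Perm (Fin (k + 1))) (B : ℕ) :
    enrichedCount π B = ∑ l ∈ Finset.range B, chainCount (AscentAt π) k l := by
  classical
  rw [enrichedCount, Nat.card_congr (Equiv.subtypeEquivRight (enriched_iff_letterChain π)),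
    Nat.card_eq_fintype_card, ← card_letterChain]

theorem enrichedCount_mono {n : ℕ} (hn : 0 < n) (π : Equiv.Perm (Fin n)) :
    Monotone (enrichedCount π) := by
  obtain ⟨k, rfl⟩ := Nat.exists_eq_succ_of_ne_zero hn.ne'
  intro a b h
  rw [enrichedCount_succ, enrichedCount_succ]
  exact Finset.sum_le_sum_of_subset (Finset.range_mono h)

theorem turnCount_ascentAt {k : ℕ} (π : Equiv.Perm (Fin (k + 1))) :
    turnCount (AscentAt π) k = peaks π := by
  classical
  refine Finset.card_bij (fun j hj => ⟨j + 1, by simp at hj; omega⟩) ?_ ?_ ?_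
  · intro j hj
    simp only [Finset.mem_filter, Finset.mem_range] at hj
    obtain ⟨hjk, ⟨hj₁, hasc⟩, hdesc⟩ := hj
    simp only [Finset.mem_filter, Finset.mem_univ, true_and]
    exact ⟨⟨j, by omega⟩, ⟨j + 2, by omega⟩, rfl, rfl, hasc,
      (not_ascentAt_iff π (by omega)).1 hdesc⟩
  · intro a _ b _ h
    simpa using h
  · rintro ⟨i, hi⟩ h
    simp only [Finset.mem_filter, Finset.mem_univ, true_and] at h
    obtain ⟨⟨j, _⟩, ⟨l, hl⟩, hj, hl', hasc, hdesc⟩ := h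
    obtain rfl : j + 1 = i := hj
    obtain rfl : j + 1 + 1 = l := hl'
    refine ⟨j, ?_, rfl⟩
    simp only [Finset.mem_filter, Finset.mem_range]
    exact ⟨by omega, ⟨by omega, hasc⟩, (not_ascentAt_iff π (by omega)).2 hdesc⟩

theorem hasSum_enrichedCount {n : ℕ} (hn : 0 < n) (π : Equiv.Perm (Fin n)) {t : ℝ} (ht0 : 0 < t)
    (ht1 : t < 1) :
    HasSum (fun a => (enrichedCount π (2 * a) : ℝ) * t ^ a)
      (4 * t / (1 + t) ^ 2 / 2 * ((1 + t) / (1 - t)) ^ (n + 1) *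
        (4 * t / (1 + t) ^ 2) ^ peaks π) := by
  obtain ⟨k, rfl⟩ := Nat.exists_eq_succ_of_ne_zero hn.ne'
  have h := hasSum_sum_chainCount (AscentAt π) ht0 ht1 k
  rw [turnCount_ascentAt] at h
  simp only [Nat.succ_eq_add_one, enrichedCount_succ]
  convert h using 2
  have h1t : 1 - t ≠ 0 := by linarith
  have h1t' : 1 + t ≠ 0 := by linarith
  rw [pow_succ _ (k + 1), pow_succ _ k]
  field_simp
  ring

end EnrichedSequences

/-- A strict total order `r` that reproduces itself under `SignedLex σ g`. -/
structure SignedOrder {α : Type*} (σ : Equiv.Perm α) (g : α → ℕ) (r : α → α → Prop) : Prop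
    extends IsStrictTotalOrder α r where
  lex : ∀ x y, r x y ↔ SignedLex σ g r x y

/-- Two points are tied if their forward orbits under `σ` read off the same word of letters. -/
def Tied {α : Type*} (σ : Equiv.Perm α) (g : α → ℕ) (x y : α) : Prop :=
  ∀ j : ℕ, g ((σ ^ j) x) = g ((σ ^ j) y)

theorem eq_self_of_strictMonoOn {α : Type*} [LinearOrder α] [Finite α] {f : α → α} {S : Set α}
    (hS : Set.MapsTo f S S) (hf : StrictMonoOn f S) {x : α} (hx : x ∈ S) : f x = x := by
  have hmono : StrictMono (hS.restrict f S S) := fun y z h => hf y.2 z.2 h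
  exact le_antisymm (hmono.le_id ⟨x, hx⟩) (hmono.id_le ⟨x, hx⟩)

theorem Tied.pow_apply {α : Type*} {σ : Equiv.Perm α} {g : α → ℕ} {x y : α} {m : ℕ}
    (hx : Tied σ g x ((σ ^ m) x)) (hy : Tied σ g x y) : Tied σ g x ((σ ^ m) y) := by
  intro j
  rw [hx j, ← Equiv.Perm.mul_apply, ← Equiv.Perm.mul_apply, ← pow_add]
  exact hy (j + m)

namespace SignedOrder

variable {α : Type*} {σ : Equiv.Perm α} {g : α → ℕ} {r r₁ r₂ : α → α → Prop}

theorem not_iff (h : SignedOrder σ g r) {x y : α} (hxy : x ≠ y) : ¬ r x y ↔ r y x := by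
  have := h.toIsStrictTotalOrder
  exact ⟨fun h' => (trichotomous_of r x y).elim (fun h => absurd h h') fun h => h.resolve_left hxy,
    fun h' h'' => asymm_of r h' h''⟩

theorem iff_of_ne (h : SignedOrder σ g r) {x y : α} (hg : g x ≠ g y) : r x y ↔ g x < g y := by
  simp only [h.lex x y, SignedLex, hg, false_and, or_false]

theorem iff_of_odd (h : SignedOrder σ g r) {x y : α} (hg : g x = g y) (ho : Odd (g x)) :
    r x y ↔ r (σ x) (σ y) := by
  simp only [h.lex x y, SignedLex, ← hg, ho, lt_irrefl, true_and, not_true_eq_false,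
    false_and, or_false, false_or]

theorem iff_of_not_odd (h : SignedOrder σ g r) {x y : α} (hg : g x = g y) (ho : ¬ Odd (g x)) :
    r x y ↔ r (σ y) (σ x) := by
  simp only [h.lex x y, SignedLex, ← hg, ho, lt_irrefl, true_and, not_false_eq_true,
    false_and, false_or]

theorem agree_comm (h₁ : SignedOrder σ g r₁) (h₂ : SignedOrder σ g r₂) {x y : α} (hxy : x ≠ y) :
    (r₁ x y ↔ r₂ x y) ↔ (r₁ y x ↔ r₂ y x) := by
  rw [← h₁.not_iff hxy, ← h₂.not_iff hxy, not_iff_not]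

theorem agree_step (h₁ : SignedOrder σ g r₁) (h₂ : SignedOrder σ g r₂) {x y : α} (hxy : x ≠ y)
    (hg : g x = g y) : (r₁ x y ↔ r₂ x y) ↔ (r₁ (σ x) (σ y) ↔ r₂ (σ x) (σ y)) := by
  by_cases ho : Odd (g x)
  · rw [h₁.iff_of_odd hg ho, h₂.iff_of_odd hg ho]
  · rw [h₁.iff_of_not_odd hg ho, h₂.iff_of_not_odd hg ho,
      agree_comm h₁ h₂ fun h => hxy (σ.injective h.symm)]

theorem agree_pow (h₁ : SignedOrder σ g r₁) (h₂ : SignedOrder σ g r₂) {x y : α} (hxy : x ≠ y)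
    (j : ℕ) (hg : ∀ i < j, g ((σ ^ i) x) = g ((σ ^ i) y)) :
    (r₁ x y ↔ r₂ x y) ↔ (r₁ ((σ ^ j) x) ((σ ^ j) y) ↔ r₂ ((σ ^ j) x) ((σ ^ j) y)) := by
  induction j with
  | zero => simp
  | succ j ih =>
    rw [ih fun i hi => hg i (hi.trans j.lt_succ_self),
      agree_step h₁ h₂ (fun h => hxy ((σ ^ j).injective h)) (hg j j.lt_succ_self), pow_succ']
    rfl

theorem agree_of_not_tied (h₁ : SignedOrder σ g r₁) (h₂ : SignedOrder σ g r₂) {x y : α}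
    (hxy : ¬ Tied σ g x y) : r₁ x y ↔ r₂ x y := by
  classical
  have hne : x ≠ y := by
    rintro rfl
    exact hxy fun _ => rfl
  simp only [Tied, not_forall] at hxy
  rw [agree_pow h₁ h₂ hne (Nat.find hxy) fun i hi => not_not.1 (Nat.find_min hxy hi),
    h₁.iff_of_ne (Nat.find_spec hxy), h₂.iff_of_ne (Nat.find_spec hxy)]

theorem pow_preserves_or_reverses (h : SignedOrder σ g r) (x : α) (j : ℕ) :
    (∀ y z, Tied σ g x y → Tied σ g x z → (r y z ↔ r ((σ ^ j) y) ((σ ^ j) z))) ∨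
    (∀ y z, Tied σ g x y → Tied σ g x z → (r y z ↔ r ((σ ^ j) z) ((σ ^ j) y))) := by
  induction j with
  | zero => exact Or.inl fun y z _ _ => Iff.rfl
  | succ j ih =>
    simp only [pow_succ', Equiv.Perm.mul_apply]
    by_cases ho : Odd (g ((σ ^ j) x))
    · refine ih.imp (fun ih y z hy hz => ?_) fun ih y z hy hz => ?_
      · rw [ih y z hy hz, h.iff_of_odd ((hy j).symm.trans (hz j)) (hy j ▸ ho)]
      · rw [ih y z hy hz, h.iff_of_odd ((hz j).symm.trans (hy j)) (hz j ▸ ho)]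
    · refine ih.symm.imp (fun ih y z hy hz => ?_) fun ih y z hy hz => ?_
      · rw [ih y z hy hz, h.iff_of_not_odd ((hz j).symm.trans (hy j)) (hz j ▸ ho)]
      · rw [ih y z hy hz, h.iff_of_not_odd ((hy j).symm.trans (hz j)) (hy j ▸ ho)]

theorem pow_fixes_of_preserves [Finite α] (h : SignedOrder σ g r) {x : α} {m : ℕ}
    (ht : Tied σ g x ((σ ^ m) x))
    (hp : ∀ y z, Tied σ g x y → Tied σ g x z → (r y z ↔ r ((σ ^ m) y) ((σ ^ m) z))) :
    (σ ^ m) x = x := by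
  classical
  have := h.toIsStrictTotalOrder
  let _ := linearOrderOfSTO r
  exact eq_self_of_strictMonoOn (S := {y | Tied σ g x y}) (fun _ hy => ht.pow_apply hy)
    (fun y hy z hz hyz => (hp y z hy hz).1 hyz) fun _ => rfl

/-- A tie of `x` with `σ ^ m x` need not force `σ ^ m` to fix `x`, because `σ ^ m` may reverse the
order on the points tied to `x`; its square preserves that order. -/
theorem pow_two_mul_fixes [Finite α] (h : SignedOrder σ g r) {x : α} {m : ℕ}
    (ht : Tied σ g x ((σ ^ m) x)) : (σ ^ (2 * m)) x = x := by
  have hsq : ∀ y, (σ ^ (2 * m)) y = (σ ^ m) ((σ ^ m) y) := fun y => by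
    rw [two_mul, pow_add, Equiv.Perm.mul_apply]
  refine h.pow_fixes_of_preserves (by rw [hsq]; exact ht.pow_apply ht) fun y z hy hz => ?_
  rw [hsq, hsq]
  rcases h.pow_preserves_or_reverses x m with hp | hp
  · rw [hp y z hy hz, hp _ _ (ht.pow_apply hy) (ht.pow_apply hz)]
  · rw [hp y z hy hz, hp _ _ (ht.pow_apply hz) (ht.pow_apply hy)]

end SignedOrder

section Configurations

variable {α β : Type*} {σ : Equiv.Perm α} {τ : Equiv.Perm β} {B : ℕ}

open Classical in
/-- The pairs of a letter assignment and an order which is signed for it. -/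
noncomputable def signedConfigs [Fintype α] (σ : Equiv.Perm α) (B : ℕ) :
    Finset ((α → Fin B) × (α → α → Prop)) :=
  Finset.univ.filter fun c => SignedOrder σ (fun x => (c.1 x : ℕ)) c.2

theorem mem_signedConfigs [Fintype α] {c : (α → Fin B) × (α → α → Prop)} :
    c ∈ signedConfigs σ B ↔ SignedOrder σ (fun x => (c.1 x : ℕ)) c.2 := by
  simp only [signedConfigs, Finset.mem_filter, Finset.mem_univ, true_and]

theorem SignedOrder.comap {g : α → ℕ} {r : α → α → Prop} (h : SignedOrder σ g r) (e : β ↪ α)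
    (he : ∀ x, e (τ x) = σ (e x)) :
    SignedOrder τ (fun x => g (e x)) fun x y => r (e x) (e y) where
  toIsStrictTotalOrder :=
    have := h.toIsStrictTotalOrder
    (RelEmbedding.preimage e r).isStrictTotalOrder
  lex x y := by rw [h.lex, SignedLex, SignedLex, he, he]

/-- The pullback of a letter assignment and a relation along a map. -/
def comapConfig (e : β → α) (c : (α → Fin B) × (α → α → Prop)) :
    (β → Fin B) × (β → β → Prop) :=
  (fun x => c.1 (e x), fun x y => c.2 (e x) (e y))

theorem card_signedConfigs_le_of_equiv [Fintype α] [Fintype β] (e : α ≃ β)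
    (he : ∀ x, e (σ x) = τ (e x)) (B : ℕ) :
    (signedConfigs σ B).card ≤ (signedConfigs τ B).card := by
  have he' : ∀ y, e.symm (τ y) = σ (e.symm y) := fun y => by
    rw [Equiv.symm_apply_eq, he, Equiv.apply_symm_apply]
  have hinv : Function.LeftInverse (comapConfig (B := B) e) (comapConfig e.symm) := fun c => by
    simp only [comapConfig, Equiv.symm_apply_apply]
  exact Finset.card_le_card_of_injOn (comapConfig e.symm)
    (fun c hc => mem_signedConfigs.2 ((mem_signedConfigs.1 hc).comap e.symm.toEmbedding he'))
    hinv.injective.injOn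

end Configurations

section OffCycle

variable {α : Type*} (σ : Equiv.Perm α) (x₀ : α)

/-- The permutation induced by `σ` on the complement of the cycle of `x₀`. -/
def offCyclePerm : Equiv.Perm {x // ¬ σ.SameCycle x₀ x} :=
  σ.subtypePerm fun x => by rw [Equiv.Perm.sameCycle_apply_right]

theorem offCyclePerm_pow_apply (j : ℕ) (x : {x // ¬ σ.SameCycle x₀ x}) :
    ((offCyclePerm σ x₀ ^ j) x : α) = (σ ^ j) x := by
  rw [offCyclePerm, Equiv.Perm.subtypePerm_pow]
  rfl

variable {σ x₀}

theorem exists_pow_apply_eq_of_sameCycle [Finite α] {x : α} (hx : σ.SameCycle x₀ x) :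
    ∃ j < Function.minimalPeriod σ x₀, (σ ^ j) x₀ = x := by
  obtain ⟨k, -, -, rfl⟩ := hx.exists_pow_eq''
  refine ⟨k % Function.minimalPeriod σ x₀, Nat.mod_lt _ ?_, ?_⟩
  · exact Function.minimalPeriod_pos_of_mem_periodicPts
      (Function.Injective.mem_periodicPts σ.injective x₀)
  · rw [← Equiv.Perm.iterate_eq_pow, ← Equiv.Perm.iterate_eq_pow,
      Function.iterate_mod_minimalPeriod_eq]

theorem minimalPeriod_dvd_of_pow_apply {m : ℕ} (h : (σ ^ m) x₀ = x₀) :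
    Function.minimalPeriod σ x₀ ∣ m :=
  Function.IsPeriodicPt.minimalPeriod_dvd <| by
    rwa [Function.IsPeriodicPt, Function.IsFixedPt, Equiv.Perm.iterate_eq_pow]

theorem card_sameCycle_eq_minimalPeriod [Finite α] :
    Nat.card {x // σ.SameCycle x₀ x} = Function.minimalPeriod σ x₀ := by
  rw [← Nat.card_fin (Function.minimalPeriod σ x₀)]
  refine (Nat.card_eq_of_bijective (fun j : Fin (Function.minimalPeriod σ x₀) =>
    (⟨(σ ^ (j : ℕ)) x₀, ⟨j, by simp⟩⟩ : {x // σ.SameCycle x₀ x})) ⟨fun j l h => ?_, ?_⟩).symm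
  · refine Fin.ext (Function.iterate_injOn_Iio_minimalPeriod j.2 l.2 ?_)
    simpa only [Equiv.Perm.iterate_eq_pow] using congrArg Subtype.val h
  · rintro ⟨x, hx⟩
    obtain ⟨j, hj, rfl⟩ := exists_pow_apply_eq_of_sameCycle hx
    exact ⟨⟨j, hj⟩, rfl⟩

theorem card_not_sameCycle_add_minimalPeriod [Finite α] :
    Nat.card {x // ¬ σ.SameCycle x₀ x} + Function.minimalPeriod σ x₀ = Nat.card α := by
  classical
  rw [← card_sameCycle_eq_minimalPeriod, add_comm, ← Nat.card_sum,
    Nat.card_congr (Equiv.sumCompl (σ.SameCycle x₀))]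

theorem card_fixed_offCyclePerm (hx₀ : σ x₀ ≠ x₀) :
    Nat.card {x // offCyclePerm σ x₀ x = x} = Nat.card {x // σ x = x} := by
  have hoff : ∀ x, σ x = x → ¬ σ.SameCycle x₀ x := fun x hx h =>
    hx₀ (h.apply_eq_self_iff.2 hx)
  exact Nat.card_congr
    { toFun x := ⟨x.1, congrArg Subtype.val x.2⟩
      invFun x := ⟨⟨x.1, hoff x x.2⟩, Subtype.ext x.2⟩ }

end OffCycle

section CycleRemoval

/-- The word `v` has even length and period half its length. -/
def HalfPeriodic {i : ℕ} {γ : Type*} (v : Fin i → γ) : Prop :=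
  Even i ∧ ∀ (j : ℕ) (h : j + i / 2 < i), v ⟨j, by omega⟩ = v ⟨j + i / 2, h⟩

open Classical in
theorem card_halfPeriodic_le (i : ℕ) (γ : Type*) [Fintype γ] :
    (Finset.univ.filter fun v : Fin i → γ => HalfPeriodic v).card ≤ Fintype.card γ ^ (i / 2) := by
  have hc : Fintype.card γ ^ (i / 2) = (Finset.univ : Finset (Fin (i / 2) → γ)).card := by simp
  rw [hc]
  refine Finset.card_le_card_of_injOn (fun v j => v ⟨j, by omega⟩) (fun _ _ => by simp) ?_
  intro v hv v' hv' h
  obtain ⟨⟨k, hk⟩, hv⟩ := (Finset.mem_filter.1 hv).2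
  obtain ⟨-, hv'⟩ := (Finset.mem_filter.1 hv').2
  have hhalf : ∀ j (hj : j < i / 2), v ⟨j, by omega⟩ = v' ⟨j, by omega⟩ := fun j hj =>
    congrFun h ⟨j, hj⟩
  funext ⟨j, hj⟩
  by_cases hj2 : j < i / 2
  · exact hhalf j hj2
  · obtain ⟨l, rfl⟩ : ∃ l, j = l + i / 2 := ⟨j - i / 2, by omega⟩
    rw [← hv l hj, ← hv' l hj, hhalf l (by omega)]

/-- The letters read off from `x` and its first `i - 1` images under `σ`. -/
def orbitWord {α γ : Type*} (σ : Equiv.Perm α) (f : α → γ) (i : ℕ) (x : α) : Fin i → γ :=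
  fun j => f ((σ ^ (j : ℕ)) x)

open Classical in
theorem rel_iff_rel_of_card_filter_eq {α : Type*} {r r' : α → α → Prop} [IsStrictTotalOrder α r]
    [IsStrictTotalOrder α r'] {S : Finset α} {x : α} (hx : x ∉ S)
    (hS : ∀ y ∈ S, ∀ z ∈ S, r y z ↔ r' y z)
    (hcard : (S.filter (r · x)).card = (S.filter (r' · x)).card) {y : α} (hy : y ∈ S) :
    r y x ↔ r' y x := by
  suffices hEq : S.filter (r · x) = S.filter (r' · x) by
    simpa only [Finset.mem_filter, hy, true_and] using Finset.ext_iff.1 hEq y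
  -- both sets are initial segments of `S` for the same order, hence comparable
  by_cases hsub : S.filter (r · x) ⊆ S.filter (r' · x)
  · exact Finset.eq_of_subset_of_card_le hsub hcard.ge
  · refine (Finset.eq_of_subset_of_card_le (fun w hw => ?_) hcard.le).symm
    obtain ⟨z, hz, hz'⟩ := Finset.not_subset.1 hsub
    simp only [Finset.mem_filter, not_and] at hw hz hz' ⊢
    have hxz : r' x z := ((trichotomous_of r' z x).resolve_left (hz' hz.1)).resolve_left
      (ne_of_mem_of_not_mem hz.1 hx)
    exact ⟨hw.1, trans_of r ((hS w hw.1 z hz.1).2 (trans_of r' hw.2 hxz)) hz.2⟩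

namespace SignedOrder

variable {α : Type*} [Finite α] {σ : Equiv.Perm α} {g : α → ℕ} {r r₁ r₂ : α → α → Prop} {x₀ : α}

theorem minimalPeriod_eq_two_mul_of_tied (h : SignedOrder σ g r) {j : ℕ} (hj0 : j ≠ 0)
    (hj : j < Function.minimalPeriod σ x₀) (ht : Tied σ g x₀ ((σ ^ j) x₀)) :
    Function.minimalPeriod σ x₀ = 2 * j := by
  obtain ⟨k, hk⟩ := minimalPeriod_dvd_of_pow_apply (h.pow_two_mul_fixes ht)
  have hk2 : k < 2 := by
    by_contra hk2
    have := Nat.mul_le_mul_left (Function.minimalPeriod σ x₀) (not_lt.1 hk2)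
    omega
  interval_cases k <;> omega

theorem ext_of_agree_at (h₁ : SignedOrder σ g r₁) (h₂ : SignedOrder σ g r₂)
    (hoff : ∀ x y, ¬ σ.SameCycle x₀ x → ¬ σ.SameCycle x₀ y → (r₁ x y ↔ r₂ x y))
    (hat : ∀ y, x₀ ≠ y → Tied σ g x₀ y → (r₁ x₀ y ↔ r₂ x₀ y)) : r₁ = r₂ := by
  have hon : ∀ x y, σ.SameCycle x₀ x → x ≠ y → (r₁ x y ↔ r₂ x y) := by
    intro x y hx hne
    by_cases ht : Tied σ g x y
    · obtain ⟨m, -, -, hm⟩ := hx.symm.exists_pow_eq''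
      rw [h₁.agree_pow h₂ hne m fun l _ => ht l, hm]
      refine hat _ (fun h => hne ((σ ^ m).injective (hm.trans h))) fun l => ?_
      rw [← hm, ← Equiv.Perm.mul_apply, ← Equiv.Perm.mul_apply, ← pow_add, ht]
    · exact h₁.agree_of_not_tied h₂ ht
  funext x y
  refine propext ?_
  by_cases hxy : x = y
  · subst hxy
    exact iff_of_false (h₁.irrefl x) (h₂.irrefl x)
  by_cases hx : σ.SameCycle x₀ x
  · exact hon x y hx hxy
  by_cases hy : σ.SameCycle x₀ y
  · exact (h₁.agree_comm h₂ hxy).2 (hon y x hy (Ne.symm hxy))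
  · exact hoff x y hx hy

end SignedOrder

open Classical in
theorem SignedOrder.ext_of_card_eq {α : Type*} [Fintype α] {σ : Equiv.Perm α} {g : α → ℕ}
    {r₁ r₂ : α → α → Prop} {x₀ : α} (h₁ : SignedOrder σ g r₁) (h₂ : SignedOrder σ g r₂)
    (hoff : ∀ x y, ¬ σ.SameCycle x₀ x → ¬ σ.SameCycle x₀ y → (r₁ x y ↔ r₂ x y))
    (hcard : (Finset.univ.filter fun y : α =>
        (¬ σ.SameCycle x₀ y ∧ Tied σ g x₀ y) ∧ r₁ y x₀).card =
      (Finset.univ.filter fun y : α =>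
        (¬ σ.SameCycle x₀ y ∧ Tied σ g x₀ y) ∧ r₂ y x₀).card)
    (hbit : HalfPeriodic (orbitWord σ g (Function.minimalPeriod σ x₀) x₀) →
      (r₁ x₀ ((σ ^ (Function.minimalPeriod σ x₀ / 2)) x₀) ↔
        r₂ x₀ ((σ ^ (Function.minimalPeriod σ x₀ / 2)) x₀))) : r₁ = r₂ := by
  have := h₁.toIsStrictTotalOrder
  have := h₂.toIsStrictTotalOrder
  refine h₁.ext_of_agree_at h₂ hoff fun y hne ht => ?_
  by_cases hy : σ.SameCycle x₀ y
  · obtain ⟨j, hj, rfl⟩ := exists_pow_apply_eq_of_sameCycle hy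
    have hj0 : j ≠ 0 := by
      rintro rfl
      simp at hne
    have hhalf := h₁.minimalPeriod_eq_two_mul_of_tied hj0 hj ht
    have hj2 : Function.minimalPeriod σ x₀ / 2 = j := by omega
    rw [hj2] at hbit
    refine hbit ⟨⟨j, by omega⟩, fun l hl => ?_⟩
    simp only [orbitWord, hj2, pow_add, Equiv.Perm.mul_apply, ht l]
  · rw [h₁.agree_comm h₂ hne]
    refine rel_iff_rel_of_card_filter_eq
      (S := Finset.univ.filter fun y => ¬ σ.SameCycle x₀ y ∧ Tied σ g x₀ y) ?_ ?_ ?_ ?_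
    · simp [Equiv.Perm.SameCycle.refl σ x₀]
    · intro y hy z hz
      exact hoff y z (Finset.mem_filter.1 hy).2.1 (Finset.mem_filter.1 hz).2.1
    · simpa only [Finset.filter_filter] using hcard
    · simp [hy, ht]

variable {α : Type*} [Fintype α] {σ : Equiv.Perm α} {B : ℕ} {x₀ : α}

open Classical in
/-- The part of a letter assignment with a relation that is lost on restricting to the complement of
the cycle of `x₀` and recording the word read along that cycle: the rank of `x₀` among the points
off the cycle tied to it and, for a half-periodic word, the comparison of `x₀` with its antipode. -/
noncomputable def configCode (σ : Equiv.Perm α) (x₀ : α) (c : (α → Fin B) × (α → α → Prop)) :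
    ℕ × Prop :=
  ((Finset.univ.filter fun y : α => (¬ σ.SameCycle x₀ y ∧
      Tied σ (fun x => (c.1 x : ℕ)) x₀ y) ∧ c.2 y x₀).card,
    HalfPeriodic (orbitWord σ c.1 (Function.minimalPeriod σ x₀) x₀) ∧
      c.2 x₀ ((σ ^ (Function.minimalPeriod σ x₀ / 2)) x₀))

theorem eq_of_configCode_eq {c c' : (α → Fin B) × (α → α → Prop)} (hc : c ∈ signedConfigs σ B)
    (hc' : c' ∈ signedConfigs σ B)
    (hoff : comapConfig (Subtype.val : {x // ¬ σ.SameCycle x₀ x} → α) c =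
      comapConfig Subtype.val c')
    (hword : orbitWord σ c.1 (Function.minimalPeriod σ x₀) x₀ =
      orbitWord σ c'.1 (Function.minimalPeriod σ x₀) x₀)
    (hcode : configCode σ x₀ c = configCode σ x₀ c') : c = c' := by
  obtain ⟨f, r⟩ := c
  obtain ⟨f', r'⟩ := c'
  obtain ⟨hoffLetter, hoffRel⟩ := Prod.mk.inj hoff
  obtain rfl : f = f' := by
    funext x
    by_cases hx : σ.SameCycle x₀ x
    · obtain ⟨j, hj, rfl⟩ := exists_pow_apply_eq_of_sameCycle hx
      exact congrFun hword ⟨j, hj⟩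
    · exact congrFun hoffLetter ⟨x, hx⟩
  obtain ⟨hcard, hbit⟩ := Prod.mk.inj hcode
  refine Prod.ext rfl ((mem_signedConfigs.1 hc).ext_of_card_eq (mem_signedConfigs.1 hc')
    (fun x y hx hy => iff_of_eq (congrFun₂ hoffRel ⟨x, hx⟩ ⟨y, hy⟩)) hcard fun hp => ?_)
  have hp' : HalfPeriodic (orbitWord σ f (Function.minimalPeriod σ x₀) x₀) :=
    ⟨hp.1, fun j hj => Fin.ext (hp.2 j hj)⟩
  simpa only [hp', true_and, eq_iff_iff] using hbit

open Classical in
theorem configCode_fst_le (c : (α → Fin B) × (α → α → Prop)) :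
    (configCode σ x₀ c).1 ≤ (Finset.univ.filter fun y : {x // ¬ σ.SameCycle x₀ x} =>
      orbitWord (offCyclePerm σ x₀) (comapConfig Subtype.val c).1 (Function.minimalPeriod σ x₀) y =
        orbitWord σ c.1 (Function.minimalPeriod σ x₀) x₀).card := by
  rw [← Finset.card_map (Function.Embedding.subtype _) (s := Finset.filter _ _)]
  refine Finset.card_le_card fun y hy => ?_
  obtain ⟨⟨hy, hty⟩, -⟩ := (Finset.mem_filter.1 hy).2
  refine Finset.mem_map.2 ⟨⟨y, hy⟩, Finset.mem_filter.2 ⟨Finset.mem_univ _, ?_⟩, rfl⟩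
  funext j
  simp only [orbitWord, comapConfig, offCyclePerm_pow_apply]
  exact Fin.ext (hty j).symm

open Classical in
theorem card_signedConfigs_fiber_le
    (c₀ : ({x // ¬ σ.SameCycle x₀ x} → Fin B) ×
      ({x // ¬ σ.SameCycle x₀ x} → {x // ¬ σ.SameCycle x₀ x} → Prop))
    (v : Fin (Function.minimalPeriod σ x₀) → Fin B) :
    ((signedConfigs σ B).filter fun c => comapConfig Subtype.val c = c₀ ∧
      orbitWord σ c.1 (Function.minimalPeriod σ x₀) x₀ = v).card ≤
    ((Finset.univ.filter fun y => orbitWord (offCyclePerm σ x₀) c₀.1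
      (Function.minimalPeriod σ x₀) y = v).card + 1) * (if HalfPeriodic v then 2 else 1) := by
  set T := Finset.univ.filter fun y => orbitWord (offCyclePerm σ x₀) c₀.1
    (Function.minimalPeriod σ x₀) y = v
  have hcodes : (T.card + 1) * (if HalfPeriodic v then 2 else 1) =
      (Finset.range (T.card + 1) ×ˢ
        (if HalfPeriodic v then (Finset.univ : Finset Prop) else {False})).card := by
    rw [Finset.card_product, Finset.card_range]
    split_ifs <;> simp
  rw [hcodes]
  refine Finset.card_le_card_of_injOn (configCode σ x₀) (fun c hc => ?_) fun c hc c' hc' => ?_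
  · obtain ⟨-, rfl, rfl⟩ := Finset.mem_filter.1 hc
    refine Finset.mem_product.2
      ⟨Finset.mem_range.2 (Nat.lt_succ_of_le (configCode_fst_le c)), ?_⟩
    split_ifs with h
    · exact Finset.mem_univ _
    · simp [configCode, h]
  · obtain ⟨hmem, hoff, hword⟩ := Finset.mem_filter.1 hc
    obtain ⟨hmem', hoff', hword'⟩ := Finset.mem_filter.1 hc'
    exact eq_of_configCode_eq hmem hmem' (hoff.trans hoff'.symm) (hword.trans hword'.symm)

variable (σ B x₀)

theorem sum_card_orbitWord_eq (f : α → Fin B) (i : ℕ) :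
    ∑ v, (Finset.univ.filter fun y => orbitWord σ f i y = v).card = Fintype.card α :=
  (Finset.card_eq_sum_card_fiberwise fun _ _ => Finset.mem_coe.2 (Finset.mem_univ _)).symm

open Classical in
theorem card_signedConfigs_le_offCyclePerm_mul :
    (signedConfigs σ B).card ≤ (signedConfigs (offCyclePerm σ x₀) B).card *
      (B ^ Function.minimalPeriod σ x₀ + B ^ (Function.minimalPeriod σ x₀ / 2) +
        2 * Fintype.card {x // ¬ σ.SameCycle x₀ x}) := by
  set i := Function.minimalPeriod σ x₀
  have hmaps : ∀ c ∈ signedConfigs σ B,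
      comapConfig Subtype.val c ∈ signedConfigs (offCyclePerm σ x₀) B := fun c hc =>
    mem_signedConfigs.2 ((mem_signedConfigs.1 hc).comap (Function.Embedding.subtype _)
      fun _ => rfl)
  rw [Finset.card_eq_sum_card_fiberwise hmaps, ← smul_eq_mul, ← Finset.sum_const]
  refine Finset.sum_le_sum fun c₀ _ => ?_
  rw [Finset.card_eq_sum_card_fiberwise (t := Finset.univ) (f := fun c => orbitWord σ c.1 i x₀)
    fun _ _ => Finset.mem_coe.2 (Finset.mem_univ _)]
  simp only [Finset.filter_filter]
  set fiberCard : (Fin i → Fin B) → ℕ := fun v =>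
    (Finset.univ.filter fun y => orbitWord (offCyclePerm σ x₀) c₀.1 i y = v).card
  have hsum : ∑ v, fiberCard v = Fintype.card {x // ¬ σ.SameCycle x₀ x} :=
    sum_card_orbitWord_eq (offCyclePerm σ x₀) B c₀.1 i
  calc _ ≤ ∑ v, (fiberCard v + 1) * (if HalfPeriodic v then 2 else 1) :=
        Finset.sum_le_sum fun v _ => card_signedConfigs_fiber_le c₀ v
    _ ≤ ∑ v, (2 * fiberCard v + 1 + if HalfPeriodic v then 1 else 0) := by
        refine Finset.sum_le_sum fun v _ => ?_
        split_ifs <;> omega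
    _ = 2 * Fintype.card {x // ¬ σ.SameCycle x₀ x} + B ^ i +
        (Finset.univ.filter fun v : Fin i → Fin B => HalfPeriodic v).card := by
        rw [Finset.sum_add_distrib, Finset.sum_add_distrib, ← Finset.mul_sum, hsum,
          Finset.card_filter]
        simp
    _ ≤ _ := by
        have := card_halfPeriodic_le i (Fin B)
        rw [Fintype.card_fin] at this
        omega

end CycleRemoval

section Conjugates

theorem strictMono_perm_eq_one {n : ℕ} {τ : Equiv.Perm (Fin n)} (hτ : StrictMono τ) : τ = 1 := by
  have h := Subsingleton.elim (hτ.orderIsoOfSurjective _ τ.surjective) (OrderIso.refl (Fin n))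
  exact Equiv.ext fun x => congrArg (fun e : Fin n ≃o Fin n => e x) h

theorem eq_of_lt_iff_lt {α : Type*} {n : ℕ} {e e' : α ≃ Fin n}
    (h : ∀ x y, e x < e y ↔ e' x < e' y) : e = e' := by
  have hmono : StrictMono (e.symm.trans e' : Equiv.Perm (Fin n)) := fun i j hij => by
    simpa [← h] using hij
  refine Equiv.ext fun x => ?_
  simpa using (Equiv.congr_fun (strictMono_perm_eq_one hmono) (e x)).symm

theorem exists_equiv_fin_lt_iff {α : Type*} [Fintype α] {n : ℕ} (hn : Fintype.card α = n)
    (r : α → α → Prop) [IsStrictTotalOrder α r] : ∃ e : α ≃ Fin n, ∀ x y, e x < e y ↔ r x y := by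
  classical
  let _ : LinearOrder α := linearOrderOfSTO r
  exact ⟨(Fintype.orderIsoFinOfCardEq α hn).symm.toEquiv, fun _ _ =>
    (Fintype.orderIsoFinOfCardEq α hn).symm.lt_iff_lt⟩

variable {n B : ℕ}

theorem signedLex_conj_iff (σ τ : Equiv.Perm (Fin n)) (f : Fin n → Fin B) (x y : Fin n) :
    SignedLex (τ * σ * τ⁻¹) (fun i => (f i : ℕ)) (· < ·) (τ x) (τ y) ↔
      SignedLex σ (fun x => (f (τ x) : ℕ)) (fun x y => τ x < τ y) x y := by
  simp only [SignedLex, Equiv.Perm.mul_apply, Equiv.Perm.inv_def, Equiv.symm_apply_apply]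

theorem enriched_conj_iff (σ τ : Equiv.Perm (Fin n)) (f : Fin n → Fin B) :
    Enriched (τ * σ * τ⁻¹) f ↔
      SignedOrder σ (fun x => (f (τ x) : ℕ)) fun x y => τ x < τ y := by
  constructor
  · refine fun hf => ⟨(RelEmbedding.preimage τ.toEmbedding (· < ·)).isStrictTotalOrder,
      fun x y => ?_⟩
    rw [← signedLex_conj_iff]
    refine ⟨hf _ _, fun h => not_le.1 fun hle => ?_⟩
    rcases hle.eq_or_lt with heq | hlt
    · exact irrefl_of (SignedLex (τ * σ * τ⁻¹) (fun i => (f i : ℕ)) (· < ·)) _ (heq ▸ h)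
    · exact asymm_of (SignedLex (τ * σ * τ⁻¹) (fun i => (f i : ℕ)) (· < ·)) h (hf _ _ hlt)
  · intro h i j hij
    obtain ⟨x, rfl⟩ := τ.surjective i
    obtain ⟨y, rfl⟩ := τ.surjective j
    exact (signedLex_conj_iff σ τ f x y).2 ((h.lex x y).1 hij)

theorem sum_enrichedCount_conj (σ : Equiv.Perm (Fin n)) (B : ℕ) :
    ∑ τ : Equiv.Perm (Fin n), enrichedCount (τ * σ * τ⁻¹) B = (signedConfigs σ B).card := by
  simp only [enrichedCount]
  rw [← Nat.card_sigma, ← Nat.card_eq_finsetCard]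
  refine Nat.card_eq_of_bijective (fun q => ⟨(fun x => q.2.1 (q.1 x), fun x y => q.1 x < q.1 y),
    mem_signedConfigs.2 ((enriched_conj_iff σ q.1 q.2.1).1 q.2.2)⟩) ⟨?_, ?_⟩
  · rintro ⟨τ, f, hf⟩ ⟨τ', f', hf'⟩ h
    obtain ⟨hletters, horder⟩ := Prod.mk.inj (Subtype.mk.inj h)
    obtain rfl : τ = τ' := eq_of_lt_iff_lt fun x y => iff_of_eq (congrFun₂ horder x y)
    obtain rfl : f = f' := τ.surjective.injective_comp_right hletters
    rfl
  · rintro ⟨⟨g, r⟩, h⟩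
    rw [mem_signedConfigs] at h
    have := h.toIsStrictTotalOrder
    obtain ⟨τ, hτ⟩ := exists_equiv_fin_lt_iff (Fintype.card_fin n) r
    obtain rfl : (fun x y => τ x < τ y) = r := funext₂ fun x y => propext (hτ x y)
    have hg : (fun x => (g ∘ τ.symm) (τ x)) = g := funext fun x => by
      rw [Function.comp_apply, Equiv.symm_apply_apply]
    exact ⟨⟨τ, g ∘ τ.symm, (enriched_conj_iff σ τ _).2 (by simpa using h)⟩,
      Subtype.ext (Prod.ext hg rfl)⟩

theorem card_signedConfigs_one {α : Type*} [Fintype α] (B : ℕ) :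
    (signedConfigs (1 : Equiv.Perm α) B).card =
      (Fintype.card α).factorial * enrichedCount (1 : Equiv.Perm (Fin (Fintype.card α))) B := by
  have h := sum_enrichedCount_conj (1 : Equiv.Perm (Fin (Fintype.card α))) B
  simp only [mul_one, mul_inv_cancel, Finset.sum_const, Finset.card_univ, Fintype.card_perm,
    Fintype.card_fin, smul_eq_mul] at h
  rw [h]
  exact le_antisymm (card_signedConfigs_le_of_equiv (Fintype.equivFin α) (fun _ => rfl) B)
    (card_signedConfigs_le_of_equiv (Fintype.equivFin α).symm (fun _ => rfl) B)

end Conjugates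

section UpperBound

theorem cycle_factor_le {B N C i : ℕ} (hB : 0 < B) (hi : 2 ≤ i) (hC : C ≤ N) :
    (B : ℝ) ^ i + B ^ (i / 2) + 2 * C ≤ (B * (1 + 1 / B + 2 * N / B ^ 2)) ^ i := by
  have hB1 : (1 : ℝ) ≤ B := by exact_mod_cast hB
  have hCN : (C : ℝ) ≤ N := by exact_mod_cast hC
  obtain ⟨k, rfl⟩ : ∃ k, i = k + 2 := ⟨i - 2, by omega⟩
  set D : ℝ := 1 + 1 / B + 2 * N / B ^ 2 with hD
  have hD1 : 1 ≤ D := by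
    rw [hD, add_assoc]
    exact le_add_of_nonneg_right (by positivity)
  calc (B : ℝ) ^ (k + 2) + B ^ ((k + 2) / 2) + 2 * C
      ≤ B ^ (k + 2) + B ^ (k + 1) + 2 * N * B ^ k := by
        have hpow : (B : ℝ) ^ ((k + 2) / 2) ≤ B ^ (k + 1) := pow_le_pow_right₀ hB1 (by omega)
        have hlin : (2 : ℝ) * C ≤ 2 * N * B ^ k := by
          refine le_trans ?_ (le_mul_of_one_le_right (by positivity) (one_le_pow₀ hB1))
          gcongr
        linarith
    _ = B ^ (k + 2) * D := by
        rw [hD]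
        field_simp
        ring
    _ ≤ B ^ (k + 2) * D ^ (k + 2) := by
        gcongr
        exact le_self_pow₀ hD1 (by omega)
    _ = _ := by rw [mul_pow]

theorem two_le_minimalPeriod {α : Type*} [Finite α] {σ : Equiv.Perm α} {x : α} (hx : σ x ≠ x) :
    2 ≤ Function.minimalPeriod σ x := by
  have hpos : 0 < Function.minimalPeriod σ x :=
    Function.minimalPeriod_pos_of_mem_periodicPts
      (Function.Injective.mem_periodicPts σ.injective x)
  have hne : Function.minimalPeriod σ x ≠ 1 := fun h =>
    hx (Function.minimalPeriod_eq_one_iff_isFixedPt.1 h)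
  omega

theorem card_signedConfigs_le {α : Type*} [Fintype α] {σ : Equiv.Perm α} {B N m : ℕ} (hB : 0 < B)
    (hN : Fintype.card α ≤ N) (hm : Nat.card {x // σ x = x} = m) :
    ((signedConfigs σ B).card : ℝ) ≤
      (m.factorial * enrichedCount (1 : Equiv.Perm (Fin m)) B) *
        (B * (1 + 1 / B + 2 * N / B ^ 2)) ^ (Fintype.card α - m) := by
  classical
  induction hM : Fintype.card α using Nat.strong_induction_on generalizing α with
  | _ M ih =>
  subst hM
  by_cases hfix : ∀ x, σ x = x
  · obtain rfl : σ = 1 := Equiv.ext hfix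
    obtain rfl : Fintype.card α = m := by
      rw [← hm, ← Nat.card_eq_fintype_card]
      exact (Nat.card_congr (Equiv.subtypeUnivEquiv fun _ => rfl)).symm
    rw [card_signedConfigs_one, Nat.sub_self, pow_zero, mul_one, Nat.cast_mul]
  · push Not at hfix
    obtain ⟨x₀, hx₀⟩ := hfix
    have hi := two_le_minimalPeriod hx₀
    have hcard := card_not_sameCycle_add_minimalPeriod (σ := σ) (x₀ := x₀)
    rw [Nat.card_eq_fintype_card, Nat.card_eq_fintype_card] at hcard
    have hoff := (card_fixed_offCyclePerm hx₀).trans hm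
    have hmle : m ≤ Fintype.card {x // ¬ σ.SameCycle x₀ x} := by
      rw [← hoff, Nat.card_eq_fintype_card]
      exact Fintype.card_subtype_le _
    have hstep := (Nat.cast_le (α := ℝ)).2 (card_signedConfigs_le_offCyclePerm_mul σ B x₀)
    push_cast at hstep
    have hih := ih _ (by omega) (by omega) hoff rfl
    have hfac := cycle_factor_le hB hi
      (show Fintype.card {x // ¬ σ.SameCycle x₀ x} ≤ N by omega)
    refine (hstep.trans (mul_le_mul hih hfac (by positivity) (by positivity))).trans_eq ?_
    rw [mul_assoc, ← pow_add]
    congr 2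
    omega

end UpperBound

section UntiedWords

variable {γ : Type*} [Fintype γ]

theorem card_mul_pow_le_of_eqOn_compl {F : Type*} [Fintype F] {S : Finset (γ → F)}
    {T : Finset γ}
    (hS : ∀ g ∈ S, ∀ g' ∈ S, (∀ z ∉ T, g z = g' z) → g = g') :
    S.card * Fintype.card F ^ T.card ≤ Fintype.card F ^ Fintype.card γ := by
  classical
  have hcard : Fintype.card {z // z ∉ T} + T.card = Fintype.card γ := by
    rw [Fintype.card_subtype_compl, Fintype.card_coe]
    exact Nat.sub_add_cancel (Finset.card_le_univ T)
  rw [← hcard, pow_add]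
  gcongr
  rw [← Fintype.card_fun, ← Finset.card_univ]
  exact Finset.card_le_card_of_injOn (fun g z => g z.1)
    (fun _ _ => Finset.mem_coe.2 (Finset.mem_univ _))
    fun g hg g' hg' h => hS g hg g' hg' fun z hz => congrFun h ⟨z, hz⟩

open Classical in
/-- The words for which the first two letters read from `x` and from `y` agree. -/
noncomputable def twoLetterTies (σ : Equiv.Perm γ) (B : ℕ) (x y : γ) : Finset (γ → Fin B) :=
  Finset.univ.filter fun g => g x = g y ∧ g (σ x) = g (σ y)

open Classical in
/-- The words that have no ties for `σ`. -/
noncomputable def untiedWords (σ : Equiv.Perm γ) (B : ℕ) : Finset (γ → Fin B) :=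
  Finset.univ.filter fun g => ∀ x y, x ≠ y → ¬ Tied σ (fun x => (g x : ℕ)) x y

variable {σ : Equiv.Perm γ} {B : ℕ} {x y : γ}

theorem mem_twoLetterTies {g : γ → Fin B} :
    g ∈ twoLetterTies σ B x y ↔ g x = g y ∧ g (σ x) = g (σ y) := by
  simp only [twoLetterTies, Finset.mem_filter, Finset.mem_univ, true_and]

theorem mem_untiedWords {g : γ → Fin B} :
    g ∈ untiedWords σ B ↔ ∀ x y, x ≠ y → ¬ Tied σ (fun x => (g x : ℕ)) x y := by
  simp only [untiedWords, Finset.mem_filter, Finset.mem_univ, true_and]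

theorem twoLetterTies_comm : twoLetterTies σ B x y = twoLetterTies σ B y x := by
  ext g
  rw [mem_twoLetterTies, mem_twoLetterTies, eq_comm, eq_comm (a := g (σ x))]

theorem card_twoLetterTies_mul_le (hxy : x ≠ y) :
    (twoLetterTies σ B x y).card * B ≤ B ^ Fintype.card γ := by
  classical
  have h := card_mul_pow_le_of_eqOn_compl (S := twoLetterTies σ B x y) (T := {y})
    fun g hg g' hg' h => by
      rw [mem_twoLetterTies] at hg hg'
      funext z
      by_cases hz : z = y
      · rw [hz, ← hg.1, ← hg'.1, h x (by simpa using hxy)]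
      · exact h z (by simpa using hz)
  simpa using h

theorem card_twoLetterTies_mul_sq_le (hxy : x ≠ y) (hx : x ≠ σ y) (hy : y ≠ σ y) :
    (twoLetterTies σ B x y).card * B ^ 2 ≤ B ^ Fintype.card γ := by
  classical
  have h := card_mul_pow_le_of_eqOn_compl (S := twoLetterTies σ B x y) (T := {y, σ y})
    fun g hg g' hg' h => by
      rw [mem_twoLetterTies] at hg hg'
      simp only [Finset.mem_insert, Finset.mem_singleton, not_or, and_imp] at h
      have hgy : g y = g' y := by rw [← hg.1, ← hg'.1, h x hxy hx]
      have hgσx : g (σ x) = g' (σ x) := by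
        by_cases hσx : σ x = y
        · rw [hσx, hgy]
        · exact h _ hσx (σ.injective.ne hxy)
      funext z
      by_cases hzy : z = y
      · rw [hzy, hgy]
      by_cases hzσ : z = σ y
      · rw [hzσ, ← hg.2, ← hg'.2, hgσx]
      · exact h z hzy hzσ
  simpa [Finset.card_pair hy] using h

open Classical in
theorem card_twoLetterTies_le (hσ : ∀ x, σ x ≠ x) (hB : 0 < B) (hxy : x ≠ y) :
    ((twoLetterTies σ B x y).card : ℝ) ≤ (if y = σ x then (B : ℝ) ^ Fintype.card γ / B else 0) +
      (B : ℝ) ^ Fintype.card γ / B ^ 2 := by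
  have hB0 : (0 : ℝ) < B := by exact_mod_cast hB
  by_cases hswap : y = σ x ∧ x = σ y
  · rw [if_pos hswap.1]
    refine le_add_of_le_of_nonneg ((le_div_iff₀ hB0).2 ?_) (by positivity)
    exact_mod_cast card_twoLetterTies_mul_le hxy
  · refine le_add_of_nonneg_of_le (by positivity) ((le_div_iff₀ (by positivity)).2 ?_)
    rw [not_and_or] at hswap
    rcases hswap with hy | hx
    · rw [twoLetterTies_comm]
      exact_mod_cast card_twoLetterTies_mul_sq_le hxy.symm hy (hσ x).symm
    · exact_mod_cast card_twoLetterTies_mul_sq_le hxy hx (hσ y).symm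

open Classical in
theorem pow_card_le_card_untiedWords_add (σ : Equiv.Perm γ) (B : ℕ) :
    B ^ Fintype.card γ ≤ (untiedWords σ B).card +
      ∑ q ∈ Finset.univ.offDiag, (twoLetterTies σ B q.1 q.2).card := by
  have hcover : Finset.univ ⊆ untiedWords σ B ∪
      Finset.univ.offDiag.biUnion fun q => twoLetterTies σ B q.1 q.2 := by
    intro g _
    rw [Finset.mem_union, or_iff_not_imp_left, mem_untiedWords]
    intro h
    push Not at h
    obtain ⟨x, y, hxy, ht⟩ := h
    exact Finset.mem_biUnion.2 ⟨(x, y), by simpa using hxy,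
      mem_twoLetterTies.2 ⟨Fin.ext (ht 0), Fin.ext (by simpa using ht 1)⟩⟩
  have h := (Finset.card_le_card hcover).trans (Finset.card_union_le _ _)
  rw [Finset.card_univ, Fintype.card_fun, Fintype.card_fin] at h
  exact h.trans (Nat.add_le_add_left Finset.card_biUnion_le _)

theorem le_card_untiedWords (hσ : ∀ x, σ x ≠ x) (hB : 0 < B) :
    (B : ℝ) ^ Fintype.card γ * (1 - Fintype.card γ / B - (Fintype.card γ : ℝ) ^ 2 / B ^ 2) ≤
      (untiedWords σ B).card := by
  classical
  set k := Fintype.card γ with hk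
  have hcover : (B : ℝ) ^ k ≤ (untiedWords σ B).card +
      ∑ q ∈ Finset.univ.offDiag, ((twoLetterTies σ B q.1 q.2).card : ℝ) := by
    exact_mod_cast pow_card_le_card_untiedWords_add σ B
  have hsum : ∑ q ∈ Finset.univ.offDiag, ((twoLetterTies σ B q.1 q.2).card : ℝ) ≤
      k * ((B : ℝ) ^ k / B) + k ^ 2 * ((B : ℝ) ^ k / B ^ 2) := by
    calc _ ≤ ∑ q ∈ Finset.univ.offDiag,
            ((if q.2 = σ q.1 then (B : ℝ) ^ k / B else 0) + (B : ℝ) ^ k / B ^ 2) :=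
          Finset.sum_le_sum fun q hq =>
            card_twoLetterTies_le hσ hB (Finset.mem_offDiag.1 hq).2.2
      _ ≤ ∑ q : γ × γ, ((if q.2 = σ q.1 then (B : ℝ) ^ k / B else 0) + (B : ℝ) ^ k / B ^ 2) :=
          Finset.sum_le_sum_of_subset_of_nonneg (Finset.subset_univ _)
            fun _ _ _ => by positivity
      _ = _ := by
          simp only [Fintype.sum_prod_type, Finset.sum_add_distrib, Finset.sum_ite_eq',
            Finset.mem_univ, if_true, Finset.sum_const, Finset.card_univ, Fintype.card_prod,
            nsmul_eq_mul, ← hk]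
          push_cast
          ring
  calc _ = (B : ℝ) ^ k - (k * ((B : ℝ) ^ k / B) + k ^ 2 * ((B : ℝ) ^ k / B ^ 2)) := by ring
    _ ≤ _ := by linarith

end UntiedWords

section Extension

variable {α : Type*} {σ : Equiv.Perm α} {g : α → ℕ}

theorem exists_isStrictTotalOrder_extension [Finite α] (p : α → Prop)
    (r₁ : {x // p x} → {x // p x} → Prop) [IsStrictTotalOrder _ r₁] :
    ∃ r : α → α → Prop, IsStrictTotalOrder α r ∧ ∀ x y : {x // p x}, r x y ↔ r₁ x y := by
  classical
  have : IsWellOrder _ r₁ := { wf := Finite.wellFounded_of_trans_of_irrefl r₁ }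
  refine ⟨fun x y => Sum.Lex r₁ WellOrderingRel ((Equiv.sumCompl p).symm x)
    ((Equiv.sumCompl p).symm y), (RelEmbedding.preimage (Equiv.sumCompl p).symm.toEmbedding
      (Sum.Lex r₁ WellOrderingRel)).isStrictTotalOrder, fun x y => ?_⟩
  simp only [Equiv.sumCompl_symm_apply_of_pos x.2, Equiv.sumCompl_symm_apply_of_pos y.2,
    Sum.lex_inl_inl]

theorem isStrictTotalOrder_iterate_signedLex (r : α → α → Prop) [IsStrictTotalOrder α r] (k : ℕ) :
    IsStrictTotalOrder α ((SignedLex σ g)^[k] r) := by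
  induction k with
  | zero => assumption
  | succ k _ =>
    rw [Function.iterate_succ_apply']
    infer_instance

theorem iterate_signedLex_iff (r r' : α → α → Prop) {j k : ℕ} {x y : α} (hjk : j < k)
    (hg : g ((σ ^ j) x) ≠ g ((σ ^ j) y)) :
    (SignedLex σ g)^[k] r x y ↔ (SignedLex σ g)^[k] r' x y := by
    induction j generalizing k x y with
  | zero =>
    obtain ⟨k, rfl⟩ := Nat.exists_eq_add_one_of_ne_zero hjk.ne'
    simp only [Function.iterate_succ_apply', SignedLex, show g x ≠ g y from hg, false_and]
  | succ j ih =>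
    obtain ⟨k, rfl⟩ := Nat.exists_eq_add_one_of_ne_zero (Nat.ne_zero_of_lt hjk)
    rw [pow_succ, Equiv.Perm.mul_apply, Equiv.Perm.mul_apply] at hg
    have h₁ := ih (Nat.lt_of_succ_lt_succ hjk) hg
    have h₂ := ih (Nat.lt_of_succ_lt_succ hjk) hg.symm
    rw [Function.iterate_succ_apply', Function.iterate_succ_apply', SignedLex, SignedLex, h₁, h₂]

theorem iterate_signedLex_iff_self {r : α → α → Prop} {x y : α} (hx : σ x = x) (hy : σ y = y)
    (hg : g x = g y) (ho : Odd (g x)) (k : ℕ) : (SignedLex σ g)^[k] r x y ↔ r x y := by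
  induction k with
  | zero => rfl
  | succ k ih =>
    rw [Function.iterate_succ_apply', SignedLex, hx, hy, ← hg]
    simp only [lt_irrefl, ho, ih, true_and, not_true_eq_false, false_and, or_false, false_or]

theorem signedOrder_iterate_signedLex [Finite α] (r : α → α → Prop) [IsStrictTotalOrder α r]
    (htied : ∀ x y, x ≠ y → Tied σ g x y → σ x = x ∧ σ y = y ∧ Odd (g x)) :
    SignedOrder σ g ((SignedLex σ g)^[orderOf σ] r) := by
  have hstrict := isStrictTotalOrder_iterate_signedLex (σ := σ) (g := g) r (orderOf σ)
  refine ⟨hstrict, fun x y => ?_⟩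
  by_cases hxy : x = y
  · subst hxy
    exact iff_of_false (irrefl_of _ x) (irrefl_of _ x)
  rw [← Function.iterate_succ_apply' (SignedLex σ g)]
  by_cases ht : Tied σ g x y
  · obtain ⟨hx, hy, ho⟩ := htied x y hxy ht
    rw [iterate_signedLex_iff_self hx hy (ht 0) ho, iterate_signedLex_iff_self hx hy (ht 0) ho]
  · obtain ⟨j, hj⟩ := not_forall.1 ht
    rw [Function.iterate_succ_apply]
    refine iterate_signedLex_iff _ _ (Nat.mod_lt j (orderOf_pos σ)) ?_
    rwa [pow_mod_orderOf]

theorem SignedOrder.odd_of_fixed {r : α → α → Prop} (h : SignedOrder σ g r) {x y : α}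
    (hxy : x ≠ y) (hx : σ x = x) (hy : σ y = y) (hg : g x = g y) : Odd (g x) := by
  by_contra ho
  have hsymm := h.iff_of_not_odd hg ho
  rw [hx, hy, ← h.not_iff hxy] at hsymm
  exact iff_not_self hsymm

theorem Tied.fixed_of_fixed {x y : α} (ht : Tied σ g x y) (hx : σ x = x)
    (hmoved : ∀ x y, σ x ≠ x → σ y ≠ y → x ≠ y → ¬ Tied σ g x y) : σ y = y := by
  by_contra hy
  have hxj : ∀ j, (σ ^ j) x = x := fun j => Equiv.Perm.pow_apply_eq_self_of_apply_eq_self hx j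
  refine hmoved y (σ y) hy (fun h => hy (σ.injective h)) (Ne.symm hy) fun j => ?_
  rw [← Equiv.Perm.mul_apply, ← pow_succ, ← ht j, ← ht (j + 1), hxj, hxj]

theorem exists_signedOrder_extension [Finite α] {r₁ : {x // σ x = x} → {x // σ x = x} → Prop}
    (h₁ : SignedOrder (1 : Equiv.Perm {x // σ x = x}) (fun x => g x) r₁)
    (hmoved : ∀ x y, σ x ≠ x → σ y ≠ y → x ≠ y → ¬ Tied σ g x y) :
    ∃ r, SignedOrder σ g r ∧ ∀ x y : {x // σ x = x}, r x y ↔ r₁ x y := by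
  have := h₁.toIsStrictTotalOrder
  obtain ⟨r₀, _, hr₀⟩ := exists_isStrictTotalOrder_extension (fun x => σ x = x) r₁
  have hodd : ∀ x y : {x // σ x = x}, x ≠ y → g x = g y → Odd (g x) := fun x y hxy =>
    h₁.odd_of_fixed hxy rfl rfl
  have hsigned := signedOrder_iterate_signedLex (σ := σ) (g := g) r₀ fun x y hxy ht => by
    by_cases hx : σ x = x
    · have hy := ht.fixed_of_fixed hx hmoved
      exact ⟨hx, hy, hodd ⟨x, hx⟩ ⟨y, hy⟩ (fun h => hxy (congrArg Subtype.val h)) (ht 0)⟩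
    · by_cases hy : σ y = y
      · exact absurd (Tied.fixed_of_fixed (fun j => (ht j).symm) hy hmoved) hx
      · exact absurd ht (hmoved x y hx hy hxy)
  refine ⟨_, hsigned, fun x y => ?_⟩
  by_cases hxy : x = y
  · subst hxy
    exact iff_of_false (hsigned.irrefl _) (h₁.irrefl _)
  by_cases hg : g x = g y
  · rw [iterate_signedLex_iff_self x.2 y.2 hg (hodd x y hxy hg), hr₀]
  · rw [hsigned.iff_of_ne hg, h₁.iff_of_ne hg]

end Extension

section LowerBound

/-- The permutation induced by `σ` on the points that it moves. -/
def movedPerm {α : Type*} (σ : Equiv.Perm α) : Equiv.Perm {x // σ x ≠ x} :=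
  σ.subtypePerm fun x => by rw [ne_eq, σ.injective.eq_iff]

theorem movedPerm_pow_apply {α : Type*} (σ : Equiv.Perm α) (j : ℕ) (x : {x // σ x ≠ x}) :
    ((movedPerm σ ^ j) x : α) = (σ ^ j) x := by
  rw [movedPerm, Equiv.Perm.subtypePerm_pow]
  rfl

variable {α : Type*} [Fintype α] (σ : Equiv.Perm α)

open Classical in
theorem card_fixed_mul_card_untiedWords_le (B : ℕ) :
    (signedConfigs (1 : Equiv.Perm {x // σ x = x}) B).card * (untiedWords (movedPerm σ) B).card ≤
      (signedConfigs σ B).card := by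
  rw [← Finset.card_product]
  refine Finset.card_le_card_of_surjOn
    (fun c => (comapConfig Subtype.val c, fun x => c.1 x.1)) ?_
  rintro ⟨⟨g₁, r₁⟩, g₂⟩ h
  obtain ⟨h₁, h₂⟩ := Finset.mem_product.1 h
  rw [mem_signedConfigs] at h₁
  rw [mem_untiedWords] at h₂
  set g : α → Fin B := fun x => if h : σ x = x then g₁ ⟨x, h⟩ else g₂ ⟨x, h⟩
  have hg₁ : (fun x => g x.1) = g₁ := funext fun x => dif_pos x.2
  have hg₂ : (fun x => g x.1) = g₂ := funext fun x => dif_neg x.2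
  rw [← hg₁] at h₁
  rw [← hg₂] at h₂
  obtain ⟨r, hr, hrr₁⟩ := exists_signedOrder_extension (g := fun x => (g x : ℕ)) h₁
    fun x y hx hy hxy ht =>
      h₂ ⟨x, hx⟩ ⟨y, hy⟩ (fun h => hxy (congrArg Subtype.val h)) fun j => by
        simpa only [movedPerm_pow_apply] using ht j
  exact ⟨(g, r), Finset.mem_coe.2 (mem_signedConfigs.2 hr),
    Prod.ext (Prod.ext hg₁ (funext₂ fun x y => propext (hrr₁ x y))) hg₂⟩

theorem le_card_signedConfigs {B m : ℕ} (hB : 0 < B) (hm : Nat.card {x // σ x = x} = m) :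
    (m.factorial * enrichedCount (1 : Equiv.Perm (Fin m)) B) * ((B : ℝ) ^ (Fintype.card α - m) *
      (1 - Fintype.card α / B - (Fintype.card α : ℝ) ^ 2 / B ^ 2)) ≤
        (signedConfigs σ B).card := by
  classical
  have hprod := (Nat.cast_le (α := ℝ)).2 (card_fixed_mul_card_untiedWords_le σ B)
  rw [Nat.card_eq_fintype_card] at hm
  rw [card_signedConfigs_one, hm] at hprod
  push_cast at hprod
  have huntied := le_card_untiedWords (σ := movedPerm σ)
    (fun x h => x.2 (congrArg Subtype.val h)) hB
  have hk : Fintype.card {x // σ x ≠ x} = Fintype.card α - m := by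
    rw [← hm]
    exact Fintype.card_subtype_compl (fun x => σ x = x)
  rw [hk] at huntied
  refine le_trans (mul_le_mul_of_nonneg_left (le_trans ?_ huntied) (by positivity)) hprod
  have hle : ((Fintype.card α - m : ℕ) : ℝ) ≤ Fintype.card α := by exact_mod_cast Nat.sub_le _ m
  gcongr

end LowerBound

section ClassAverage

variable {n : ℕ}

theorem mem_cycleClass {lam : n.Partition} {σ : Equiv.Perm (Fin n)} :
    σ ∈ cycleClass lam ↔ σ.partition.parts = lam.parts := by
  simp only [cycleClass, Finset.mem_filter, Finset.mem_univ, true_and]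

theorem conj_mem_cycleClass_iff (lam : n.Partition) (τ σ : Equiv.Perm (Fin n)) :
    τ * σ * τ⁻¹ ∈ cycleClass lam ↔ σ ∈ cycleClass lam := by
  have h : (τ * σ * τ⁻¹).partition = σ.partition :=
    Equiv.Perm.partition_eq_of_isConj.1 (isConj_iff.2 ⟨τ⁻¹, by group⟩)
  rw [mem_cycleClass, mem_cycleClass, h]

theorem card_fixed_of_mem_cycleClass {lam : n.Partition} {σ : Equiv.Perm (Fin n)}
    (hσ : σ ∈ cycleClass lam) : Nat.card {x // σ x = x} = lam.parts.count 1 := by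
  classical
  have hone : σ.cycleType.count 1 = 0 := Multiset.count_eq_zero.2 fun h => by
    have := Equiv.Perm.two_le_of_mem_cycleType h
    omega
  rw [← mem_cycleClass.1 hσ, Equiv.Perm.parts_partition, Multiset.count_add,
    Multiset.count_replicate_self, hone, zero_add, Nat.card_eq_fintype_card,
    Fintype.card_subtype, ← Finset.card_compl]
  congr 1
  ext x
  simp

theorem cycleClass_nonempty (lam : n.Partition) : (cycleClass lam).Nonempty := by
  classical
  set M := lam.parts.filter (fun x => 2 ≤ x)
  have hsplit : M + Multiset.replicate (lam.parts.count 1) 1 = lam.parts := by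
    conv_rhs => rw [← Multiset.filter_add_not (fun x => 2 ≤ x) lam.parts]
    congr 1
    rw [← Multiset.filter_eq']
    refine Multiset.filter_congr fun x hx => ?_
    have := lam.parts_pos hx
    omega
  have hsum : M.sum + lam.parts.count 1 = n := by
    have := congrArg Multiset.sum hsplit
    rwa [Multiset.sum_add, Multiset.sum_replicate, lam.parts_sum, smul_eq_mul, mul_one] at this
  obtain ⟨σ, hσ⟩ := (Equiv.Perm.exists_with_cycleType_iff (Fin n) (m := M)).2
    ⟨by rw [Fintype.card_fin]; omega, fun a ha => (Multiset.mem_filter.1 ha).2⟩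
  refine ⟨σ, mem_cycleClass.2 ?_⟩
  rw [Equiv.Perm.parts_partition, ← Equiv.Perm.sum_cycleType, hσ, Fintype.card_fin]
  conv_rhs => rw [← hsplit]
  congr 2
  omega

theorem factorial_mul_sum_enrichedCount (lam : n.Partition) (B : ℕ) :
    n.factorial * ∑ π ∈ cycleClass lam, enrichedCount π B =
      ∑ σ ∈ cycleClass lam, (signedConfigs σ B).card := by
  have h : ∀ τ : Equiv.Perm (Fin n), ∑ σ ∈ cycleClass lam, enrichedCount (τ * σ * τ⁻¹) B =
      ∑ π ∈ cycleClass lam, enrichedCount π B := fun τ =>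
    Finset.sum_equiv (MulAut.conj τ).toEquiv
      (fun σ => (conj_mem_cycleClass_iff lam τ σ).symm) (fun σ _ => rfl)
  simp only [← sum_enrichedCount_conj]
  rw [Finset.sum_comm, Finset.sum_congr rfl fun τ _ => h τ, Finset.sum_const, Finset.card_univ,
    Fintype.card_perm, Fintype.card_fin, smul_eq_mul]

/-- The mean of `enrichedCount π (2 * a)` for `π` uniform on a conjugacy class. The number of
letters is even so that the generating function in `a` depends on `π` through its peaks only. -/
noncomputable def meanCount (lam : n.Partition) (a : ℕ) : ℝ :=
  uniformExp (cycleClass lam) fun π => (enrichedCount π (2 * a) : ℝ)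

theorem meanCount_mono (hn : 0 < n) (lam : n.Partition) : Monotone (meanCount lam) := by
  intro a b h
  unfold meanCount uniformExp
  gcongr ?_ / _
  exact Finset.sum_le_sum fun π _ => Nat.cast_le.2 (enrichedCount_mono hn π (by omega))

theorem meanCount_nonneg (lam : n.Partition) (a : ℕ) : 0 ≤ meanCount lam a := by
  unfold meanCount uniformExp
  positivity

theorem hasSum_meanCount (hn : 0 < n) (lam : n.Partition) {t : ℝ} (ht0 : 0 < t) (ht1 : t < 1) :
    HasSum (fun a => meanCount lam a * t ^ a)
      ((4 * t / (1 + t) ^ 2) / 2 * ((1 + t) / (1 - t)) ^ (n + 1) *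
        uniformExp (cycleClass lam) fun π => (4 * t / (1 + t) ^ 2) ^ peaks π) := by
  have h := (hasSum_sum (s := cycleClass lam)
    fun π _ => hasSum_enrichedCount hn π ht0 ht1).div_const ((cycleClass lam).card : ℝ)
  rw [← Finset.mul_sum, mul_div_assoc] at h
  refine h.congr_fun fun a => ?_
  rw [meanCount, uniformExp, div_mul_eq_mul_div, Finset.sum_mul]

theorem factorial_mul_meanCount (lam : n.Partition) (a : ℕ) :
    n.factorial * meanCount lam a =
      uniformExp (cycleClass lam) fun σ => ((signedConfigs σ (2 * a)).card : ℝ) := by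
  rw [meanCount, uniformExp, uniformExp, ← mul_div_assoc]
  congr 1
  exact_mod_cast factorial_mul_sum_enrichedCount lam (2 * a)

theorem le_uniformExp {α : Type*} {A : Finset α} {f : α → ℝ} {c : ℝ} (hA : A.Nonempty)
    (h : ∀ x ∈ A, c ≤ f x) : c ≤ uniformExp A f := by
  rw [uniformExp, le_div_iff₀ (Nat.cast_pos.2 hA.card_pos), mul_comm, ← nsmul_eq_mul]
  exact Finset.card_nsmul_le_sum A f c h

theorem uniformExp_le {α : Type*} {A : Finset α} {f : α → ℝ} {c : ℝ} (hA : A.Nonempty)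
    (h : ∀ x ∈ A, f x ≤ c) : uniformExp A f ≤ c := by
  rw [uniformExp, div_le_iff₀ (Nat.cast_pos.2 hA.card_pos), mul_comm, ← nsmul_eq_mul]
  exact Finset.sum_le_card_nsmul A f c h

variable {lam : n.Partition} {a m : ℕ}

theorem le_factorial_mul_meanCount (ha : 0 < a) (hm : lam.parts.count 1 = m) :
    (m.factorial * enrichedCount (1 : Equiv.Perm (Fin m)) (2 * a)) *
      (((2 * a : ℕ) : ℝ) ^ (n - m) * (1 - n / (2 * a : ℕ) - (n : ℝ) ^ 2 / (2 * a : ℕ) ^ 2)) ≤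
      n.factorial * meanCount lam a := by
  rw [factorial_mul_meanCount]
  refine le_uniformExp (cycleClass_nonempty lam) fun σ hσ => ?_
  simpa only [Fintype.card_fin] using
    le_card_signedConfigs σ (by omega : 0 < 2 * a) ((card_fixed_of_mem_cycleClass hσ).trans hm)

theorem factorial_mul_meanCount_le (ha : 0 < a) (hm : lam.parts.count 1 = m) :
    n.factorial * meanCount lam a ≤
      (m.factorial * enrichedCount (1 : Equiv.Perm (Fin m)) (2 * a)) *
        (((2 * a : ℕ) : ℝ) * (1 + 1 / (2 * a : ℕ) + 2 * n / (2 * a : ℕ) ^ 2)) ^ (n - m) := by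
  rw [factorial_mul_meanCount]
  refine uniformExp_le (cycleClass_nonempty lam) fun σ hσ => ?_
  simpa only [Fintype.card_fin] using card_signedConfigs_le (by omega : 0 < 2 * a)
    (Fintype.card_fin n).le ((card_fixed_of_mem_cycleClass hσ).trans hm)

end ClassAverage

section FixedPoints

theorem chainCount_congr {asc asc' : ℕ → Prop} {k : ℕ} (h : ∀ i < k, asc i ↔ asc' i) (l : ℕ) :
    chainCount asc k l = chainCount asc' k l := by
  induction k generalizing l with
  | zero => rfl
  | succ k ih =>
    simp only [chainCount, ih fun i hi => h i (by omega)]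
    congr 2
    exact propext (iff_congr Iff.rfl (h k (Nat.lt_succ_self k)))

theorem enrichedCount_one_zero (B : ℕ) : enrichedCount (1 : Equiv.Perm (Fin 0)) B = 1 := by
  have : Unique {f : Fin 0 → Fin B // Enriched (1 : Equiv.Perm (Fin 0)) f} :=
    { default := ⟨Fin.elim0, fun i => i.elim0⟩
      uniq := fun f => Subtype.ext (Subsingleton.elim _ _) }
  exact Nat.card_unique

theorem enrichedCount_one_succ (k B : ℕ) : enrichedCount (1 : Equiv.Perm (Fin (k + 1))) B =
    ∑ l ∈ Finset.range B, chainCount (fun _ => True) k l := by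
  rw [enrichedCount_succ]
  refine Finset.sum_congr rfl fun l _ => chainCount_congr (fun i hi => ?_) l
  exact iff_true_intro ⟨by omega, by simp⟩

theorem enrichedCount_one_one (B : ℕ) : enrichedCount (1 : Equiv.Perm (Fin 1)) B = B := by
  simp [enrichedCount_one_succ, chainCount]

theorem enrichedCount_one_add_two (m a : ℕ) :
    enrichedCount (1 : Equiv.Perm (Fin (m + 1))) (2 * (a + 1)) =
      enrichedCount (1 : Equiv.Perm (Fin (m + 1))) (2 * a) +
        (enrichedCount (1 : Equiv.Perm (Fin m)) (2 * (a + 1)) +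
          enrichedCount (1 : Equiv.Perm (Fin m)) (2 * a)) := by
  cases m with
  | zero =>
    simp only [enrichedCount_one_one, enrichedCount_one_zero]
    ring
  | succ k =>
    have heven : ¬ Odd (2 * a) := by simp
    have hodd : Odd (2 * a + 1) := by simp
    simp only [enrichedCount_one_succ, Nat.mul_succ, Finset.sum_range_succ, chainCount, heven,
      hodd, iff_true, if_true, if_false]
    ring

theorem add_two_mul_enrichedCount_one (m a : ℕ) :
    (m + 2) * enrichedCount (1 : Equiv.Perm (Fin (m + 2))) (2 * a) =
      2 * a * enrichedCount (1 : Equiv.Perm (Fin (m + 1))) (2 * a) +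
        m * enrichedCount (1 : Equiv.Perm (Fin m)) (2 * a) := by
  induction m generalizing a with
  | zero =>
    induction a with
    | zero => simp [enrichedCount_one_succ]
    | succ a ih =>
      rw [enrichedCount_one_add_two]
      simp only [enrichedCount_one_one, zero_mul, add_zero, zero_add] at ih ⊢
      nlinarith
  | succ m ihm =>
    induction a with
    | zero => cases m <;> simp [enrichedCount_one_succ]
    | succ a ih =>
      have e1 := enrichedCount_one_add_two (m + 2) a
      have e2 := enrichedCount_one_add_two (m + 1) a
      have e3 := enrichedCount_one_add_two m a
      have e4 := ihm a
      have e5 := ihm (a + 1)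
      zify at *
      linear_combination (m + 3 : ℤ) * e1 + ih + e4 + e5 - (2 * a + 1 : ℤ) * e2 - (m : ℤ) * e3

/-- `m! / b ^ (m / 2)` times the number of enriched words of length `m` on `√b` letters for the
identity (see `factorial_mul_enrichedCount_one`), given by its three-term recursion. -/
noncomputable def fixedFactor (b : ℝ) : ℕ → ℝ
  | 0 => 1
  | 1 => 1
  | k + 2 => fixedFactor b (k + 1) + (k + 1) * k / b * fixedFactor b k

theorem factorial_mul_enrichedCount_one (m : ℕ) {a : ℕ} (ha : 0 < a) :
    (m.factorial * enrichedCount (1 : Equiv.Perm (Fin m)) (2 * a) : ℝ) =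
      (2 * a) ^ m * fixedFactor (4 * (a : ℝ) ^ 2) m := by
  have ha' : (a : ℝ) ≠ 0 := by positivity
  induction m using Nat.strong_induction_on with
  | _ m ih =>
  match m with
  | 0 => simp [enrichedCount_one_zero, fixedFactor]
  | 1 => simp [enrichedCount_one_one, fixedFactor]
  | m + 2 =>
    have h1 := ih m (by omega)
    have h2 := ih (m + 1) (by omega)
    have h3 := congrArg (Nat.cast (R := ℝ)) (add_two_mul_enrichedCount_one m a)
    rw [fixedFactor, mul_add]
    rw [Nat.factorial_succ, Nat.factorial_succ] at *
    push_cast at *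
    have e1 : (2 * (a : ℝ)) ^ (m + 2) * fixedFactor (4 * (a : ℝ) ^ 2) (m + 1) =
        2 * a * (((m : ℝ) + 1) * m.factorial *
          enrichedCount (1 : Equiv.Perm (Fin (m + 1))) (2 * a)) := by rw [h2]; ring
    have e2 : (2 * (a : ℝ)) ^ (m + 2) * (((m : ℝ) + 1) * m / (4 * (a : ℝ) ^ 2) *
        fixedFactor (4 * (a : ℝ) ^ 2) m) = ((m : ℝ) + 1) * m *
          (m.factorial * enrichedCount (1 : Equiv.Perm (Fin m)) (2 * a)) := by
      rw [h1]; field_simp; ring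
    rw [e1, e2]
    linear_combination ((m : ℝ) + 1) * m.factorial * h3

end FixedPoints

section FixedFactor

theorem abs_log_one_add_sub_le {v : ℝ} (hv : |v| ≤ 1 / 2) :
    |Real.log (1 + v) - (v - v ^ 2 / 2)| ≤ 2 * |v| ^ 3 := by
  have h := Real.abs_log_sub_add_sum_range_le (x := -v) (by rw [abs_neg]; linarith) 2
  simp only [Finset.sum_range_succ, Finset.range_zero, Finset.sum_empty, abs_neg] at h
  have h2 : |v| ^ (2 + 1) / (1 - |v|) ≤ 2 * |v| ^ 3 := by
    rw [div_le_iff₀ (by linarith), mul_right_comm]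
    exact le_mul_of_one_le_left (by positivity) (by linarith)
  refine le_trans (le_of_eq ?_) (h.trans h2)
  congr 1
  push_cast
  ring_nf

theorem div_one_add_mem_Icc {x e z u : ℝ} (hz : 0 ≤ z) (hz' : z ∈ Set.Icc (x - e) x)
    (hu : u ∈ Set.Icc 0 x) : z / (1 + u) ∈ Set.Icc (x - e - x ^ 2) x := by
  have hu1 : 0 < 1 + u := by linarith [hu.1]
  have hv0 : 0 ≤ z / (1 + u) := by positivity
  have hv : z / (1 + u) * (1 + u) = z := div_mul_cancel₀ z hu1.ne'
  have huv : 0 ≤ z / (1 + u) * u := mul_nonneg hv0 hu.1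
  have hvx : z / (1 + u) ≤ x := by linarith [hz'.2]
  have : z / (1 + u) * u ≤ x * x := mul_le_mul hvx hu.2 hu.1 (hz.trans hz'.2)
  exact ⟨by linarith [hz'.1], hvx⟩

theorem abs_div_one_add_sub_le {x e z u : ℝ} (hx : x ≤ 1 / 2) (he : 0 ≤ e) (hz : 0 ≤ z)
    (hz' : z ∈ Set.Icc (x - e) x) (hu0 : 0 ≤ u) (hu : u ∈ Set.Icc (x - 3 * e - x ^ 2) x) :
    |z / (1 + u) - (x - x ^ 2)| ≤ 3 * e + 2 * x ^ 3 := by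
  have hx0 : 0 ≤ x := hz.trans hz'.2
  obtain ⟨hvl, hvx⟩ := div_one_add_mem_Icc hz hz' ⟨hu0, hu.2⟩
  set v := z / (1 + u)
  have hv0 : 0 ≤ v := by positivity
  have hv : v = z - u * v := by
    have : v * (1 + u) = z := div_mul_cancel₀ z (by positivity)
    linarith
  have hupper : u * v ≤ x * x := mul_le_mul hu.2 hvx hv0 hx0
  have hlower : x ^ 2 - (4 * e * x + 2 * x ^ 3) ≤ u * v := by
    have e1 : (x - u) * v ≤ (3 * e + x ^ 2) * x :=
      mul_le_mul (by linarith [hu.1]) hvx hv0 (by positivity)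
    have e2 : x * (x - v) ≤ x * (e + x ^ 2) := mul_le_mul_of_nonneg_left (by linarith) hx0
    linarith
  have hex : e * x ≤ e * (1 / 2) := mul_le_mul_of_nonneg_left hx he
  have : 0 ≤ x ^ 3 := by positivity
  rw [abs_le]
  constructor <;> linarith [hz'.1, hz'.2]

theorem abs_log_one_add_div_sub_le {x e z u : ℝ} (hx : x ≤ 1 / 2) (he : 0 ≤ e) (hz : 0 ≤ z)
    (hz' : z ∈ Set.Icc (x - e) x) (hu0 : 0 ≤ u) (hu : u ∈ Set.Icc (x - 3 * e - x ^ 2) x) :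
    |Real.log (1 + z / (1 + u)) - (x - 3 / 2 * x ^ 2)| ≤ 4 * e + 5 * x ^ 3 := by
  have hx0 : 0 ≤ x := hz.trans hz'.2
  obtain ⟨hvl, hvx⟩ := div_one_add_mem_Icc hz hz' ⟨hu0, hu.2⟩
  have hlin := abs_div_one_add_sub_le hx he hz hz' hu0 hu
  set v := z / (1 + u)
  have hv0 : 0 ≤ v := by positivity
  have hsq : (x - v) * (x + v) ≤ (e + x ^ 2) * (2 * x) :=
    mul_le_mul (by linarith) (by linarith) (by linarith) (by positivity)
  have hsq' : v ^ 2 ≤ x ^ 2 := pow_le_pow_left₀ hv0 hvx 2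
  have hlog := abs_log_one_add_sub_le (v := v) (by rw [abs_of_nonneg hv0]; linarith)
  rw [abs_of_nonneg hv0] at hlog
  have hcube : v ^ 3 ≤ x ^ 3 := pow_le_pow_left₀ hv0 hvx 3
  have hex : e * x ≤ e * (1 / 2) := mul_le_mul_of_nonneg_left hx he
  rw [abs_le] at hlin hlog ⊢
  constructor <;> linarith

variable {b : ℝ} {n m : ℕ}

theorem one_le_fixedFactor_and_le_succ (hb : 0 < b) (k : ℕ) :
    1 ≤ fixedFactor b k ∧ fixedFactor b k ≤ fixedFactor b (k + 1) := by
  induction k with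
  | zero => exact ⟨le_rfl, le_rfl⟩
  | succ k ih =>
    refine ⟨ih.1.trans ih.2, ?_⟩
    rw [fixedFactor]
    have := zero_le_one.trans ih.1
    exact le_add_of_nonneg_right (by positivity)

theorem fixedFactor_pos (hb : 0 < b) (k : ℕ) : 0 < fixedFactor b k :=
  one_pos.trans_le (one_le_fixedFactor_and_le_succ hb k).1

/-- The ratio of consecutive values of `fixedFactor`, a continued fraction in `1 / b`. -/
noncomputable def fixedRatio (b : ℝ) (k : ℕ) : ℝ :=
  fixedFactor b (k + 1) / fixedFactor b k

theorem one_le_fixedRatio (hb : 0 < b) (k : ℕ) : 1 ≤ fixedRatio b k :=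
  (one_le_div (fixedFactor_pos hb k)).2 (one_le_fixedFactor_and_le_succ hb k).2

theorem fixedRatio_eq (hb : 0 < b) (k : ℕ) :
    fixedRatio b k = 1 + k * (k - 1) / b / fixedRatio b (k - 1) := by
  cases k with
  | zero => simp [fixedRatio, fixedFactor]
  | succ k =>
    have := (fixedFactor_pos hb (k + 1)).ne'
    simp only [fixedRatio, fixedFactor, Nat.add_sub_cancel]
    push_cast
    field_simp
    ring

theorem fixedRatio_mem_Icc (hb : 0 < b) (k : ℕ) :
    fixedRatio b k ∈ Set.Icc 1 (1 + (k : ℝ) ^ 2 / b) := by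
  refine ⟨one_le_fixedRatio hb k, ?_⟩
  rw [fixedRatio_eq hb, add_le_add_iff_left]
  refine div_le_of_le_mul₀ (zero_le_one.trans (one_le_fixedRatio hb _)) (by positivity) ?_
  have hk : (k : ℝ) * (k - 1) / b ≤ (k : ℝ) ^ 2 / b := by
    gcongr
    nlinarith [k.cast_nonneg (α := ℝ)]
  exact hk.trans (le_mul_of_one_le_right (by positivity) (one_le_fixedRatio hb _))

theorem cast_mul_cast_sub_one_nonneg (k : ℕ) : 0 ≤ (k : ℝ) * (k - 1) := by
  cases k with
  | zero => simp
  | succ k => push_cast; rw [add_sub_cancel_right]; positivity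

theorem fixedRatio_sub_one_mem_Icc (hb : 0 < b) {k : ℕ} (hk : k ≤ n) :
    fixedRatio b (k - 1) - 1 ∈
      Set.Icc ((k : ℝ) ^ 2 / b - 3 * (n / b) - ((k : ℝ) ^ 2 / b) ^ 2) ((k : ℝ) ^ 2 / b) := by
  have hkn : (k : ℝ) ≤ n := Nat.cast_le.2 hk
  rw [fixedRatio_eq hb, add_sub_cancel_left]
  have hz := cast_mul_cast_sub_one_nonneg (k - 1)
  have hz' : ((k - 1 : ℕ) : ℝ) * ((k - 1 : ℕ) - 1) ∈
      Set.Icc ((k : ℝ) ^ 2 - 3 * n) ((k : ℝ) ^ 2) := by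
    rcases k with _ | k
    · simp
    · push_cast [Nat.add_sub_cancel] at hkn hz ⊢
      constructor <;> nlinarith [k.cast_nonneg (α := ℝ)]
  have hpred : ((k - 1 - 1 : ℕ) : ℝ) ≤ k := Nat.cast_le.2 (by omega)
  have hρ := fixedRatio_mem_Icc hb (k - 1 - 1)
  have hρle : ((k - 1 - 1 : ℕ) : ℝ) ^ 2 / b ≤ (k : ℝ) ^ 2 / b := by gcongr
  have := div_one_add_mem_Icc (x := (k : ℝ) ^ 2 / b) (e := 3 * (n / b))
    (u := fixedRatio b (k - 1 - 1) - 1) (div_nonneg hz hb.le)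
    ⟨by rw [← mul_div_assoc, ← sub_div]; gcongr; exact hz'.1, by gcongr; exact hz'.2⟩
    ⟨by linarith [hρ.1], by linarith [hρ.2]⟩
  rwa [add_sub_cancel] at this

theorem abs_log_fixedRatio_sub_le (hb : 0 < b) {k : ℕ} (hk : k ≤ n)
    (hnb : (n : ℝ) ^ 2 / b ≤ 1 / 2) :
    |Real.log (fixedRatio b k) - ((k : ℝ) ^ 2 / b - 3 / 2 * ((k : ℝ) ^ 2 / b) ^ 2)| ≤
      4 * (n / b) + 5 * ((n : ℝ) ^ 2 / b) ^ 3 := by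
  have hkn : (k : ℝ) ≤ n := Nat.cast_le.2 hk
  have hxZ : (k : ℝ) ^ 2 / b ≤ (n : ℝ) ^ 2 / b := by gcongr
  have hz : (k : ℝ) * (k - 1) / b ∈ Set.Icc ((k : ℝ) ^ 2 / b - n / b) ((k : ℝ) ^ 2 / b) := by
    rw [← sub_div]
    constructor <;> gcongr <;> nlinarith [k.cast_nonneg (α := ℝ)]
  have := abs_log_one_add_div_sub_le (hxZ.trans hnb) (by positivity)
    (div_nonneg (cast_mul_cast_sub_one_nonneg k) hb.le) hz
    (by linarith [one_le_fixedRatio hb (k - 1)]) (fixedRatio_sub_one_mem_Icc hb hk)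
  rw [add_sub_cancel, ← fixedRatio_eq hb] at this
  refine this.trans ?_
  gcongr

theorem abs_sub_sub_pow_three_pow_five_le (hb : 0 < b) {k : ℕ} (hk : k + 1 ≤ n)
    (hnb : (n : ℝ) ^ 2 / b ≤ 1 / 2) :
    |((k : ℝ) + 1) ^ 3 / (3 * b) - 3 * ((k : ℝ) + 1) ^ 5 / (10 * b ^ 2) -
        ((k : ℝ) ^ 3 / (3 * b) - 3 * (k : ℝ) ^ 5 / (10 * b ^ 2)) -
        ((k : ℝ) ^ 2 / b - 3 / 2 * ((k : ℝ) ^ 2 / b) ^ 2)| ≤ 15 * (n / b) := by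
  have hkn : (k : ℝ) + 1 ≤ n := by exact_mod_cast hk
  have hk0 : (0 : ℝ) ≤ k := k.cast_nonneg
  have hn1 : (1 : ℝ) ≤ n := by linarith
  have hexpand : ((k : ℝ) + 1) ^ 3 / (3 * b) - 3 * ((k : ℝ) + 1) ^ 5 / (10 * b ^ 2) -
      ((k : ℝ) ^ 3 / (3 * b) - 3 * (k : ℝ) ^ 5 / (10 * b ^ 2)) -
      ((k : ℝ) ^ 2 / b - 3 / 2 * ((k : ℝ) ^ 2 / b) ^ 2) =
      (k + 1 / 3) / b - 3 / 10 * ((10 * (k : ℝ) ^ 3 + 10 * k ^ 2 + 5 * k + 1) / b ^ 2) := by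
    field_simp
    ring
  have hlin : ((k : ℝ) + 1 / 3) / b ≤ n / b := by gcongr; linarith
  have hcube : (10 * (k : ℝ) ^ 3 + 10 * k ^ 2 + 5 * k + 1) / b ^ 2 ≤ 26 * (n / b) * (1 / 2) :=
    calc (10 * (k : ℝ) ^ 3 + 10 * k ^ 2 + 5 * k + 1) / b ^ 2
        ≤ (10 * (n : ℝ) ^ 3 + 10 * n ^ 3 + 5 * n ^ 3 + n ^ 3) / b ^ 2 := by
          have h2 : (k : ℝ) ^ 2 ≤ n ^ 3 :=
            (pow_le_pow_left₀ hk0 (by linarith) 2).trans (pow_le_pow_right₀ hn1 (by norm_num))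
          have h1 : (k : ℝ) ≤ n ^ 3 := (by linarith : (k : ℝ) ≤ n).trans
            (le_self_pow₀ hn1 (by norm_num))
          gcongr
          · linarith
          · exact one_le_pow₀ hn1
      _ = 26 * (n / b) * ((n : ℝ) ^ 2 / b) := by field_simp; ring
      _ ≤ 26 * (n / b) * (1 / 2) := by gcongr
  have hlin0 : 0 ≤ ((k : ℝ) + 1 / 3) / b := by positivity
  have hcube0 : 0 ≤ (10 * (k : ℝ) ^ 3 + 10 * k ^ 2 + 5 * k + 1) / b ^ 2 := by positivity
  have : 0 ≤ (n : ℝ) / b := by positivity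
  rw [hexpand, abs_le]
  constructor <;> linarith

theorem abs_log_fixedFactor_sub_le_mul (hb : 0 < b) (hm : m ≤ n)
    (hnb : (n : ℝ) ^ 2 / b ≤ 1 / 2) :
    |Real.log (fixedFactor b m) - ((m : ℝ) ^ 3 / (3 * b) - 3 * (m : ℝ) ^ 5 / (10 * b ^ 2))| ≤
      m * (20 * (n / b + ((n : ℝ) ^ 2 / b) ^ 3)) := by
  induction m with
  | zero => simp [fixedFactor]
  | succ k ih =>
    have hprev := ih (by omega)
    have hstep := abs_log_fixedRatio_sub_le hb (Nat.le_of_succ_le hm) hnb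
    have hpoly := abs_sub_sub_pow_three_pow_five_le hb hm hnb
    rw [fixedRatio, Real.log_div (fixedFactor_pos hb _).ne' (fixedFactor_pos hb _).ne'] at hstep
    push_cast
    have h3 : (0 : ℝ) ≤ ((n : ℝ) ^ 2 / b) ^ 3 := by positivity
    have hnb0 : 0 ≤ (n : ℝ) / b := by positivity
    rw [abs_le] at *
    constructor <;> linarith

theorem abs_log_fixedFactor_sub_le (hb : 0 < b) (hm : m ≤ n) (hnb : (n : ℝ) ^ 2 / b ≤ 1 / 2) :
    |Real.log (fixedFactor b m) - ((m : ℝ) ^ 3 / (3 * b) - 3 * (m : ℝ) ^ 5 / (10 * b ^ 2))| ≤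
      20 * ((n : ℝ) ^ 2 / b + n * ((n : ℝ) ^ 2 / b) ^ 3) := by
  refine (abs_log_fixedFactor_sub_le_mul hb hm hnb).trans ?_
  calc (m : ℝ) * (20 * (n / b + ((n : ℝ) ^ 2 / b) ^ 3)) ≤
      n * (20 * (n / b + ((n : ℝ) ^ 2 / b) ^ 3)) := by gcongr
    _ = _ := by ring

end FixedFactor

section PowerSums

open Complex

/-- The power sum `∑ a, a ^ N * exp (-θ * a)`, the comparison sum of the Laplace method. -/
noncomputable def powerSum (N : ℕ) (θ : ℝ) : ℝ := ∑' a : ℕ, (a : ℝ) ^ N * Real.exp (-θ) ^ a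

theorem hasSum_powerSum (N : ℕ) {θ : ℝ} (hθ : 0 < θ) :
    HasSum (fun a : ℕ => (a : ℝ) ^ N * Real.exp (-θ) ^ a) (powerSum N θ) := by
  refine (summable_pow_mul_geometric_of_norm_lt_one N ?_).hasSum
  rw [Real.norm_of_nonneg (Real.exp_pos _).le]
  exact Real.exp_lt_one_iff.2 (neg_lt_zero.2 hθ)

theorem norm_pow_mul_one_div_add_pow_le {y : ℝ} (hy0 : 0 < y) (hy1 : y ≤ 1) {N : ℕ} (hN : 1 ≤ N)
    {n : ℤ} (hn : n ≠ 0) :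
    ‖(y * I) ^ (N + 1) * (1 / (y * I + n) ^ (N + 1))‖ ≤ y ^ 2 * (1 / (n : ℝ) ^ 2) := by
  have hn1 : (1 : ℝ) ≤ |(n : ℝ)| := by exact_mod_cast Int.one_le_abs hn
  have hre : |(n : ℝ)| ≤ ‖(y * I : ℂ) + n‖ := by simpa using abs_re_le_norm ((y * I : ℂ) + n)
  have hnorm : ‖(y * I : ℂ)‖ = y := by simp [abs_of_pos hy0]
  rw [norm_mul, norm_div, norm_one, norm_pow, norm_pow, hnorm]
  have hnum : y ^ (N + 1) ≤ y ^ 2 := pow_le_pow_of_le_one hy0.le hy1 (by omega)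
  have hden : (n : ℝ) ^ 2 ≤ ‖(y * I : ℂ) + n‖ ^ (N + 1) := by
    rw [← sq_abs]
    calc |(n : ℝ)| ^ 2 ≤ |(n : ℝ)| ^ (N + 1) := pow_le_pow_right₀ hn1 (by omega)
      _ ≤ _ := by gcongr
  have : (0 : ℝ) < (n : ℝ) ^ 2 := by positivity
  gcongr

-- This is the Lipschitz formula `∑ a ^ N q ^ a = N! (-2πi) ^ (-N - 1) ∑ (z + n) ^ (-N - 1)` at
-- `z = iy`, where `q = exp (-2πy)`.
theorem powerSum_mul_pow_div_factorial {y : ℝ} (hy : 0 < y) {N : ℕ} (hN : 1 ≤ N) :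
    ((powerSum N (2 * Real.pi * y) * (2 * Real.pi * y) ^ (N + 1) / N.factorial : ℝ) : ℂ) =
      ∑' n : ℤ, (y * I) ^ (N + 1) * (1 / (y * I + n) ^ (N + 1)) := by
  have h := EisensteinSeries.qExpansion_identity hN ⟨y * I, by simpa using hy⟩
  have hexp : cexp (2 * Real.pi * I * (y * I)) = (Real.exp (-(2 * Real.pi * y)) : ℝ) := by
    push_cast
    congr 1
    linear_combination (2 * Real.pi * y : ℂ) * I_sq
  have hmul : (y * I : ℂ) * (-2 * Real.pi * I) = 2 * Real.pi * y := by
    linear_combination (-2 * Real.pi * y : ℂ) * I_sq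
  simp only [hexp] at h
  rw [powerSum, tsum_mul_left, h, ← mul_assoc, ← mul_div_assoc, ← mul_pow, hmul]
  push_cast
  ring

theorem exists_abs_powerSum_mul_pow_div_factorial_sub_one_le : ∃ C : ℝ, 0 < C ∧
    ∀ (N : ℕ) (θ : ℝ), 1 ≤ N → 0 < θ → θ ≤ 1 →
      |powerSum N θ * θ ^ (N + 1) / N.factorial - 1| ≤ C * θ ^ 2 := by
  have hs2 : Summable fun n : ℤ => 1 / (n : ℝ) ^ 2 := Real.summable_one_div_int_pow.2 one_lt_two
  have hC : 0 ≤ ∑' n : ℤ, 1 / (n : ℝ) ^ 2 := tsum_nonneg fun n => by positivity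
  refine ⟨(∑' n : ℤ, 1 / (n : ℝ) ^ 2) + 1, by linarith, fun N θ hN hθ hθ1 => ?_⟩
  obtain ⟨y, rfl⟩ : ∃ y, θ = 2 * Real.pi * y := ⟨θ / (2 * Real.pi), by field_simp⟩
  have hy0 : 0 < y := pos_of_mul_pos_right hθ (by positivity)
  have hyθ : y ≤ 2 * Real.pi * y := le_mul_of_one_le_left hy0.le (by linarith [Real.pi_gt_three])
  have hterm := fun {n : ℤ} => norm_pow_mul_one_div_add_pow_le hy0 (hyθ.trans hθ1) hN (n := n)
  have hsumm : Summable fun n : ℤ => (y * I : ℂ) ^ (N + 1) * (1 / (y * I + n) ^ (N + 1)) := by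
    refine Summable.of_norm_bounded_eventually (hs2.mul_left (y ^ 2)) ?_
    rw [Filter.eventually_cofinite]
    refine (Set.finite_singleton (0 : ℤ)).subset fun n hn => ?_
    by_contra h0
    exact hn (hterm h0)
  have hzero : (y * I : ℂ) ^ (N + 1) * (1 / (y * I + (0 : ℤ)) ^ (N + 1)) = 1 := by
    rw [Int.cast_zero, add_zero]
    exact mul_one_div_cancel (pow_ne_zero _ (by simp [hy0.ne']))
  rw [← Real.norm_eq_abs, ← Complex.norm_real, Complex.ofReal_sub,
    powerSum_mul_pow_div_factorial hy0 hN, hsumm.tsum_eq_add_tsum_ite 0, hzero,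
    Complex.ofReal_one, add_sub_cancel_left]
  calc _ ≤ ∑' n : ℤ, y ^ 2 * (1 / (n : ℝ) ^ 2) := by
        refine tsum_of_norm_bounded (hs2.mul_left _).hasSum fun n => ?_
        split_ifs with h0
        · simp [h0]
        · exact hterm h0
    _ = (∑' n : ℤ, 1 / (n : ℝ) ^ 2) * y ^ 2 := by rw [tsum_mul_left, mul_comm]
    _ ≤ ((∑' n : ℤ, 1 / (n : ℝ) ^ 2) + 1) * (2 * Real.pi * y) ^ 2 := by
        gcongr
        linarith

theorem exists_powerSum_mul_pow_le : ∃ C : ℝ, 0 < C ∧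
    ∀ (N : ℕ) (θ : ℝ), 1 ≤ N → 0 < θ → θ ≤ 1 → powerSum N θ * θ ^ (N + 1) ≤ C * N.factorial := by
  obtain ⟨C, hC0, hC⟩ := exists_abs_powerSum_mul_pow_div_factorial_sub_one_le
  refine ⟨1 + C, by positivity, fun N θ hN hθ hθ1 => ?_⟩
  rw [← div_le_iff₀ (by positivity)]
  have := (abs_le.1 (hC N θ hN hθ hθ1)).2
  have : C * θ ^ 2 ≤ C := mul_le_of_le_one_right hC0.le (pow_le_one₀ hθ.le hθ1)
  linarith

end PowerSums

section Tilt

theorem abs_exp_sub_one_le_mul {x M : ℝ} (hM : 1 ≤ M) (hx : Real.exp x ≤ M) :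
    |Real.exp x - 1| ≤ M * |x| := by
  have hlower := Real.add_one_le_exp x
  have hupper : Real.exp x - 1 ≤ x * Real.exp x := by
    have hinv : Real.exp x * Real.exp (-x) = 1 := by
      rw [← Real.exp_add, add_neg_cancel, Real.exp_zero]
    nlinarith [Real.exp_pos x, Real.add_one_le_exp (-x)]
  rcases le_total 0 x with h | h
  · rw [abs_of_nonneg h, abs_of_nonneg (by linarith)]
    nlinarith
  · rw [abs_of_nonpos h, abs_of_nonpos (by linarith [Real.exp_le_one_iff.2 h])]
    nlinarith

theorem abs_exp_sub_one_sub_le_mul {x M : ℝ} (hM : 1 ≤ M) (hx : Real.exp x ≤ M) :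
    |Real.exp x - 1 - x| ≤ M * x ^ 2 := by
  have hinv : Real.exp x * Real.exp (-x) = 1 := by
    rw [← Real.exp_add, add_neg_cancel, Real.exp_zero]
  rw [abs_of_nonneg (by linarith [Real.add_one_le_exp x])]
  calc Real.exp x - 1 - x ≤ x * (Real.exp x - 1) := by
        nlinarith [Real.exp_pos x, Real.add_one_le_exp (-x)]
    _ ≤ |x| * |Real.exp x - 1| := by rw [← abs_mul]; exact le_abs_self _
    _ ≤ |x| * (M * |x|) := by gcongr; exact abs_exp_sub_one_le_mul hM hx
    _ = M * x ^ 2 := by rw [← sq_abs x]; ring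

/-- The logarithm of the ratio between `a ^ n * exp (c * (x / a) ^ 2 - d * (x / a) ^ 4)` and
`exp (c - d) * x ^ j * a ^ (n - j)` at `a = x * exp l`. It is small near the peak of the Laplace
sum, so that a pure power may replace the first weight there. -/
noncomputable def tiltExponent (c d j l : ℝ) : ℝ :=
  c * (Real.exp (-2 * l) - 1) - d * (Real.exp (-4 * l) - 1) + j * l

/-- The size constraints on the coefficients of `tiltExponent`: `c` is of order at most `Q`, `d` is
bounded, and `j` nearly cancels the linear term of the exponent. -/
structure TiltBounds (K Q c d j : ℝ) : Prop where
  one_le_const : 1 ≤ K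
  one_le_scale : 1 ≤ Q
  c_nonneg : 0 ≤ c
  c_le : c ≤ K * Q
  d_nonneg : 0 ≤ d
  d_le : d ≤ K
  abs_sub_le : |j - 2 * c| ≤ 1

theorem exp_neg_two_mul_le {l : ℝ} (hl : Real.exp (-l) ≤ 8) : Real.exp (-2 * l) ≤ 64 := by
  calc Real.exp (-2 * l) = Real.exp (-l) ^ 2 := by
        rw [← Real.exp_nat_mul]; congr 1; push_cast; ring
    _ ≤ 8 ^ 2 := by gcongr
    _ = 64 := by norm_num

namespace TiltBounds

variable {K Q c d j l : ℝ}

theorem abs_tiltExponent_le (h : TiltBounds K Q c d j) (hl : Real.exp (-l) ≤ 8) :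
    |tiltExponent c d j l| ≤ c * |Real.exp (-2 * l) - 1 - -2 * l| + 16385 * K * |l| := by
  have hquartic : |d * (Real.exp (-4 * l) - 1)| ≤ K * (4096 * |-4 * l|) := by
    have hle : Real.exp (-4 * l) ≤ 4096 := by
      calc Real.exp (-4 * l) = Real.exp (-l) ^ 4 := by
            rw [← Real.exp_nat_mul]; congr 1; push_cast; ring
        _ ≤ 8 ^ 4 := by gcongr
        _ = 4096 := by norm_num
    rw [abs_mul, abs_of_nonneg h.d_nonneg]
    exact mul_le_mul h.d_le (abs_exp_sub_one_le_mul (by norm_num) hle) (abs_nonneg _)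
      (zero_le_one.trans h.one_le_const)
  have hlinear : |(j - 2 * c) * l| ≤ K * |l| := by
    rw [abs_mul]
    exact mul_le_mul_of_nonneg_right (h.abs_sub_le.trans h.one_le_const) (abs_nonneg l)
  have habs : |-4 * l| = 4 * |l| := by rw [abs_mul, abs_of_nonpos (by norm_num), neg_neg]
  calc |tiltExponent c d j l|
      = |c * (Real.exp (-2 * l) - 1 - -2 * l) - d * (Real.exp (-4 * l) - 1) +
          (j - 2 * c) * l| := by rw [tiltExponent]; ring_nf
    _ ≤ |c * (Real.exp (-2 * l) - 1 - -2 * l)| + |d * (Real.exp (-4 * l) - 1)| +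
          |(j - 2 * c) * l| := (abs_add_le _ _).trans (by gcongr; exact abs_sub _ _)
    _ ≤ c * |Real.exp (-2 * l) - 1 - -2 * l| + K * (4096 * |-4 * l|) + K * |l| := by
        rw [abs_mul c, abs_of_nonneg h.c_nonneg]
        gcongr
    _ = _ := by rw [habs]; ring

theorem abs_tiltExponent_le_mul (h : TiltBounds K Q c d j) (hl : Real.exp (-l) ≤ 8) :
    |tiltExponent c d j l| ≤ 16515 * K * (Q * |l|) := by
  have hK := zero_le_one.trans h.one_le_const
  have habs : |-2 * l| = 2 * |l| := by rw [abs_mul, abs_of_nonpos (by norm_num), neg_neg]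
  have hexp : |Real.exp (-2 * l) - 1 - -2 * l| ≤ 130 * |l| := by
    have := abs_exp_sub_one_le_mul (by norm_num) (exp_neg_two_mul_le hl)
    have := abs_sub (Real.exp (-2 * l) - 1) (-2 * l)
    linarith
  calc |tiltExponent c d j l| ≤ c * |Real.exp (-2 * l) - 1 - -2 * l| + 16385 * K * |l| :=
        h.abs_tiltExponent_le hl
    _ ≤ K * Q * (130 * |l|) + 16385 * K * (Q * |l|) := by
        gcongr
        · exact mul_nonneg hK (zero_le_one.trans h.one_le_scale)
        · exact h.c_le
        · exact le_mul_of_one_le_left (abs_nonneg l) h.one_le_scale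
    _ = 16515 * K * (Q * |l|) := by ring

theorem abs_tiltExponent_le_exp (h : TiltBounds K Q c d j) (hl : Real.exp (-l) ≤ 8) :
    |tiltExponent c d j l| ≤ 2 * (16515 * K) / Q * Real.exp (2 * (Q * |l|)) := by
  have hK := zero_le_one.trans h.one_le_const
  have hQ : 0 < Q := zero_lt_one.trans_le h.one_le_scale
  have hy : 0 ≤ Q * |l| := by positivity
  have hpoly : (Q * |l|) ^ 2 + Q * |l| ≤ 2 * Real.exp (2 * (Q * |l|)) := by
    have := Real.quadratic_le_exp_of_nonneg (mul_nonneg zero_le_two hy)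
    nlinarith
  calc |tiltExponent c d j l| ≤ c * |Real.exp (-2 * l) - 1 - -2 * l| + 16385 * K * |l| :=
        h.abs_tiltExponent_le hl
    _ ≤ K * Q * (64 * (-2 * l) ^ 2) + 16385 * K * |l| := by
        gcongr
        · exact h.c_le
        · exact abs_exp_sub_one_sub_le_mul (by norm_num) (exp_neg_two_mul_le hl)
    _ = K / Q * (256 * (Q * |l|) ^ 2 + 16385 * (Q * |l|)) := by
        rw [mul_pow Q, sq_abs]; field_simp; ring
    _ ≤ K / Q * (16515 * ((Q * |l|) ^ 2 + Q * |l|)) := by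
        gcongr
        nlinarith
    _ ≤ K / Q * (16515 * (2 * Real.exp (2 * (Q * |l|)))) := by gcongr
    _ = _ := by ring

end TiltBounds

theorem exists_abs_exp_tiltExponent_add_sub_one_le {K : ℝ} (hK : 1 ≤ K) : ∃ A : ℝ, 1 ≤ A ∧
    ∀ {Q c d j l η δ : ℝ}, TiltBounds K Q c d j → Real.exp (-l) ≤ 8 → η ≤ 1 → |δ| ≤ η →
      |Real.exp (tiltExponent c d j l + δ) - 1| ≤
        A * (1 / Q + η) * Real.exp (A * Q * |l|) := by
  have : 1 ≤ 16515 * K := by linarith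
  set B : ℝ := 16515 * K
  refine ⟨6 * B, by linarith, fun {Q c d j l η δ} h hl hη hδ => ?_⟩
  set r := tiltExponent c d j l
  have hQ : 0 < Q := zero_lt_one.trans_le h.one_le_scale
  have hη0 : 0 ≤ η := (abs_nonneg δ).trans hδ
  have hsmall : |r + δ| ≤ 2 * B * (1 / Q + η) * Real.exp (2 * (Q * |l|)) := by
    have hone : 1 ≤ 2 * B * Real.exp (2 * (Q * |l|)) :=
      one_le_mul_of_one_le_of_one_le (by linarith) (Real.one_le_exp (by positivity))
    calc |r + δ| ≤ 2 * B / Q * Real.exp (2 * (Q * |l|)) + η * (2 * B * Real.exp (2 * (Q * |l|))) :=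
          (abs_add_le r δ).trans (add_le_add (h.abs_tiltExponent_le_exp hl)
            (hδ.trans (le_mul_of_one_le_right hη0 hone)))
      _ = _ := by ring
  have hexp : Real.exp |r + δ| ≤ 3 * Real.exp (B * (Q * |l|)) := by
    calc Real.exp |r + δ| ≤ Real.exp (1 + B * (Q * |l|)) := by
          rw [Real.exp_le_exp]
          linarith [abs_add_le r δ, h.abs_tiltExponent_le_mul hl]
      _ ≤ 3 * Real.exp (B * (Q * |l|)) := by
          rw [Real.exp_add]
          gcongr
          exact Real.exp_one_lt_three.le
  calc |Real.exp (r + δ) - 1| ≤ Real.exp |r + δ| * |r + δ| :=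
        abs_exp_sub_one_le_mul (Real.one_le_exp (abs_nonneg _)) (Real.exp_le_exp.2 (le_abs_self _))
    _ ≤ 3 * Real.exp (B * (Q * |l|)) * (2 * B * (1 / Q + η) * Real.exp (2 * (Q * |l|))) := by
        gcongr
    _ = 6 * B * (1 / Q + η) * Real.exp ((B + 2) * Q * |l|) := by
        rw [mul_assoc (B + 2), add_mul, Real.exp_add]; ring
    _ ≤ 6 * B * (1 / Q + η) * Real.exp (6 * B * Q * |l|) := by
        gcongr
        linarith

theorem exp_mul_abs_log_le_pow_add_inv_pow {ρ s : ℝ} {V : ℕ} (hρ : 0 < ρ) (hs : s ≤ V) :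
    Real.exp (s * |Real.log ρ|) ≤ ρ ^ V + ρ⁻¹ ^ V := by
  have hpow : ∀ {σ : ℝ}, 0 < σ → Real.exp (V * Real.log σ) = σ ^ V := fun hσ => by
    rw [Real.exp_nat_mul, Real.exp_log hσ]
  calc Real.exp (s * |Real.log ρ|) ≤ Real.exp (V * |Real.log ρ|) := by gcongr
    _ ≤ ρ ^ V + ρ⁻¹ ^ V := by
      rcases abs_choice (Real.log ρ) with h | h <;> rw [h]
      · rw [hpow hρ]
        exact le_add_of_nonneg_right (by positivity)
      · rw [← Real.log_inv, hpow (inv_pos.2 hρ)]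
        exact le_add_of_nonneg_left (by positivity)

end Tilt

section TiltedPowerSums

theorem factorial_add_le {N n : ℕ} (V : ℕ) (hN : N ≤ n) (hn : 0 < n) :
    ((N + V).factorial : ℝ) ≤ N.factorial * (n : ℝ) ^ V * Real.exp (V ^ 2 / n) := by
  have : (0 : ℝ) < n := by exact_mod_cast hn
  have hbase : ((N + V : ℕ) : ℝ) ≤ n * Real.exp (V / n) := by
    calc ((N + V : ℕ) : ℝ) ≤ n + V := by exact_mod_cast Nat.add_le_add_right hN V
      _ = n * (V / n + 1) := by field_simp; ring
      _ ≤ n * Real.exp (V / n) := by gcongr; exact Real.add_one_le_exp _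
  calc ((N + V).factorial : ℝ) ≤ N.factorial * ((N + V : ℕ) : ℝ) ^ V := by
        rw [← Nat.factorial_mul_ascFactorial N V]
        exact_mod_cast Nat.mul_le_mul_left _ (Nat.ascFactorial_le_pow_add N V)
    _ ≤ N.factorial * (n * Real.exp (V / n)) ^ V := by gcongr
    _ = _ := by rw [mul_pow, ← Real.exp_nat_mul, mul_assoc]; congr 3; ring

theorem pow_mul_factorial_le {k : ℕ} (r V : ℕ) (hk : 0 < k) :
    ((k + r : ℕ) : ℝ) ^ V * k.factorial ≤ (k + V).factorial * Real.exp (V * r / k) := by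
  have : (0 : ℝ) < k := by exact_mod_cast hk
  have hbase : ((k + r : ℕ) : ℝ) ≤ k * Real.exp (r / k) := by
    calc ((k + r : ℕ) : ℝ) = k * (r / k + 1) := by push_cast; field_simp; ring
      _ ≤ k * Real.exp (r / k) := by gcongr; exact Real.add_one_le_exp _
  calc ((k + r : ℕ) : ℝ) ^ V * k.factorial ≤ (k * Real.exp (r / k)) ^ V * k.factorial := by gcongr
    _ = k.factorial * (k : ℝ) ^ V * Real.exp (V * r / k) := by
        rw [mul_pow, ← Real.exp_nat_mul, mul_div_assoc]; ring
    _ ≤ (k + V).factorial * Real.exp (V * r / k) := by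
        gcongr
        exact_mod_cast (Nat.mul_le_mul_left _ (Nat.pow_le_pow_left k.le_succ V)).trans
          Nat.factorial_mul_pow_le_factorial

theorem exists_tilted_powerSum_le (L : ℝ) : ∃ G : ℝ, 0 < G ∧ ∀ {k V J n : ℕ} {θ : ℝ},
    n = k + V + J → 0 < k → V * (J + V) ≤ L * k → 0 < θ → θ ≤ 1 →
      ((θ / n) ^ V * powerSum (k + V + V) θ + (n / θ) ^ V * powerSum k θ) * θ ^ (k + V + 1) ≤
        G * (k + V).factorial := by
  obtain ⟨C, hC0, hC⟩ := exists_powerSum_mul_pow_le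
  refine ⟨2 * (C * Real.exp L), by positivity, ?_⟩
  rintro k V J _ θ rfl hk hV hθ hθ1
  have hk' : (0 : ℝ) < k := by exact_mod_cast hk
  set n := k + V + J with hn
  have hn0 : 0 < n := by omega
  have hn' : (0 : ℝ) < n := by exact_mod_cast hn0
  have hup : (θ / n) ^ V * powerSum (k + V + V) θ * θ ^ (k + V + 1) ≤
      C * Real.exp L * (k + V).factorial := by
    have hexp : Real.exp ((V : ℝ) ^ 2 / n) ≤ Real.exp L := by
      have hL : 0 ≤ L := nonneg_of_mul_nonneg_left (le_trans (by positivity) hV) hk'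
      rw [Real.exp_le_exp, div_le_iff₀ hn']
      calc (V : ℝ) ^ 2 ≤ V * (J + V) := by
            rw [sq]; gcongr; exact le_add_of_nonneg_left (Nat.cast_nonneg J)
        _ ≤ L * k := hV
        _ ≤ L * n := by gcongr; exact_mod_cast (by omega : k ≤ n)
    calc (θ / n) ^ V * powerSum (k + V + V) θ * θ ^ (k + V + 1)
        = powerSum (k + V + V) θ * θ ^ (k + V + V + 1) / n ^ V := by rw [div_pow]; ring
      _ ≤ C * ((k + V).factorial * (n : ℝ) ^ V * Real.exp L) / n ^ V := by
          refine div_le_div_of_nonneg_right ((hC (k + V + V) θ (by omega) hθ hθ1).trans ?_)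
            (by positivity)
          refine mul_le_mul_of_nonneg_left ?_ hC0.le
          exact (factorial_add_le V (by omega) hn0).trans (by gcongr)
      _ = _ := by field_simp
  have hdown : (n / θ) ^ V * powerSum k θ * θ ^ (k + V + 1) ≤
      C * Real.exp L * (k + V).factorial := by
    calc (n / θ) ^ V * powerSum k θ * θ ^ (k + V + 1)
        = (n : ℝ) ^ V * (powerSum k θ * θ ^ (k + 1)) := by
          rw [div_pow]; field_simp; ring
      _ ≤ (n : ℝ) ^ V * (C * k.factorial) := by
          exact mul_le_mul_of_nonneg_left (hC k θ hk hθ hθ1) (by positivity)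
      _ = C * (((k + (J + V) : ℕ) : ℝ) ^ V * k.factorial) := by
          rw [hn, add_assoc, add_comm J]; ring
      _ ≤ C * ((k + V).factorial * Real.exp L) := by
          refine mul_le_mul_of_nonneg_left ?_ hC0.le
          refine (pow_mul_factorial_le (J + V) V hk).trans ?_
          gcongr
          rw [div_le_iff₀ hk']
          exact_mod_cast hV
      _ = _ := by ring
  linarith

end TiltedPowerSums

section Laplace

/-- The hypotheses of the Laplace method: `h` is a nonnegative increasing weight which, up to a
factor `exp δ` with `|δ| ≤ η`, equals `a ^ n * exp (c * (x / a) ^ 2 - d * (x / a) ^ 4)` for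
`a ≥ x / 8`. The peak of `h a * exp (-θ * a)` is near `a = x`, where `x = n / θ`. -/
structure LaplaceProfile (n : ℕ) (x c d η : ℝ) (h : ℕ → ℝ) : Prop where
  monotone : Monotone h
  nonneg : ∀ a, 0 ≤ h a
  eq_mul_exp : ∀ a : ℕ, x / 8 ≤ a → ∃ δ, |δ| ≤ η ∧
    h a = (a : ℝ) ^ n * Real.exp (c * (x / a) ^ 2 - d * (x / a) ^ 4 + δ)

namespace LaplaceProfile

variable {k V J : ℕ} {x c d η K Q t : ℝ} {h : ℕ → ℝ}

theorem eq_mul_exp_tiltExponent (hh : LaplaceProfile (k + J) x c d η h) (hx : 0 < x) {a : ℕ}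
    (ha : x / 8 ≤ a) : ∃ δ, |δ| ≤ η ∧
      h a = Real.exp (c - d) * x ^ J * (a : ℝ) ^ k *
        Real.exp (tiltExponent c d J (Real.log (a / x)) + δ) := by
  obtain ⟨δ, hδ, h_eq⟩ := hh.eq_mul_exp a ha
  have ha0 : (0 : ℝ) < a := (by positivity : 0 < x / 8).trans_le ha
  have hexp : ∀ m : ℕ, Real.exp (-m * Real.log (a / x)) = (x / a) ^ m := fun m => by
    rw [neg_mul, ← mul_neg, ← Real.log_inv, inv_div, Real.exp_nat_mul,
      Real.exp_log (by positivity)]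
  have htilt : tiltExponent c d J (Real.log (a / x)) =
      c * (x / a) ^ 2 - d * (x / a) ^ 4 - (c - d) + J * Real.log (a / x) := by
    have h2 := hexp 2
    have h4 := hexp 4
    push_cast at h2 h4
    rw [tiltExponent, h2, h4]
    ring
  refine ⟨δ, hδ, ?_⟩
  rw [h_eq, htilt]
  set E := c * (x / a) ^ 2 - d * (x / a) ^ 4
  have hsplit : Real.exp (E - (c - d) + J * Real.log (a / x) + δ) =
      Real.exp (E + δ) / Real.exp (c - d) * (a / x) ^ J := by
    rw [← Real.exp_sub, ← Real.exp_log (by positivity : 0 < a / x), ← Real.exp_nat_mul,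
      ← Real.exp_add, Real.log_exp]
    ring_nf
  rw [hsplit, pow_add, div_pow]
  field_simp

variable (hh : LaplaceProfile (k + V + J) x c d η h) (hx : 0 < x) {W s : ℝ}

include hh hx

theorem abs_sub_le_of_div_le (hs : s ≤ V) (hW : ∀ l δ, Real.exp (-l) ≤ 8 → |δ| ≤ η →
    |Real.exp (tiltExponent c d J l + δ) - 1| ≤ W * Real.exp (s * |l|)) (hW0 : 0 ≤ W)
    {a : ℕ} (ha : x / 8 ≤ a) :
    |h a - Real.exp (c - d) * x ^ J * (a : ℝ) ^ (k + V)| ≤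
      Real.exp (c - d) * x ^ J * (a : ℝ) ^ (k + V) * (W * ((a / x) ^ V + (a / x)⁻¹ ^ V)) := by
  obtain ⟨δ, hδ, h_eq⟩ := hh.eq_mul_exp_tiltExponent hx ha
  have ha0 : (0 : ℝ) < a := (by positivity : 0 < x / 8).trans_le ha
  have hρ : 0 < a / x := by positivity
  have hexp : Real.exp (-Real.log (a / x)) ≤ 8 := by
    rw [Real.exp_neg, Real.exp_log hρ, inv_div, div_le_iff₀ ha0]
    linarith
  rw [h_eq, ← mul_sub_one, abs_mul, abs_of_nonneg (by positivity)]
  gcongr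
  refine (hW _ δ hexp hδ).trans ?_
  gcongr
  exact exp_mul_abs_log_le_pow_add_inv_pow hρ hs

theorem abs_sub_le_of_lt (hW : 1 ≤ W * 2 ^ V) {a : ℕ} (ha0 : 0 < a) (ha : a < x / 8) :
    |h a - Real.exp (c - d) * x ^ J * (a : ℝ) ^ (k + V)| ≤
      Real.exp (c - d) * x ^ J * (a : ℝ) ^ (k + V) * (W * ((a / x) ^ V + (a / x)⁻¹ ^ V)) +
        h ⌈x / 8⌉₊ := by
  have ha0' : (0 : ℝ) < a := by exact_mod_cast ha0
  have hW0 : 0 < W := pos_of_mul_pos_left (zero_lt_one.trans_le hW) (by positivity)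
  have htwo : 2 ≤ (a / x)⁻¹ := by
    rw [inv_div, le_div_iff₀ ha0']
    linarith
  have hone : 1 ≤ W * ((a / x) ^ V + (a / x)⁻¹ ^ V) := by
    refine hW.trans ?_
    gcongr
    exact (pow_le_pow_left₀ zero_le_two htwo V).trans (le_add_of_nonneg_left (by positivity))
  have hpow : 0 ≤ Real.exp (c - d) * x ^ J * (a : ℝ) ^ (k + V) := by positivity
  have hmono : h a ≤ h ⌈x / 8⌉₊ := hh.monotone (Nat.lt_ceil.2 ha).le
  have := le_mul_of_one_le_right hpow hone
  rw [abs_le]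
  constructor <;> linarith [hh.nonneg a]

theorem abs_mul_sub_le (hk : 0 < k) (hs : s ≤ V) (hW0 : 1 ≤ W * 2 ^ V)
    (hW : ∀ l δ, Real.exp (-l) ≤ 8 → |δ| ≤ η →
      |Real.exp (tiltExponent c d J l + δ) - 1| ≤ W * Real.exp (s * |l|))
    (ht0 : 0 ≤ t) (ht1 : t ≤ 1) (a : ℕ) :
    |h a * t ^ a - Real.exp (c - d) * x ^ J * ((a : ℝ) ^ (k + V) * t ^ a)| ≤
      Real.exp (c - d) * x ^ J * W * (x⁻¹ ^ V * ((a : ℝ) ^ (k + V + V) * t ^ a) +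
        x ^ V * ((a : ℝ) ^ k * t ^ a)) + if a < ⌈x / 8⌉₊ then h ⌈x / 8⌉₊ else 0 := by
  set F := Real.exp (c - d) * x ^ J
  suffices hmain : |h a - F * (a : ℝ) ^ (k + V)| ≤
      F * W * (x⁻¹ ^ V * (a : ℝ) ^ (k + V + V) + x ^ V * (a : ℝ) ^ k) +
        if a < ⌈x / 8⌉₊ then h ⌈x / 8⌉₊ else 0 by
    have hta : t ^ a ≤ 1 := pow_le_one₀ ht0 ht1
    have hite : 0 ≤ if a < ⌈x / 8⌉₊ then h ⌈x / 8⌉₊ else 0 := by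
      split_ifs
      exacts [hh.nonneg _, le_rfl]
    calc |h a * t ^ a - F * ((a : ℝ) ^ (k + V) * t ^ a)|
        = |h a - F * (a : ℝ) ^ (k + V)| * t ^ a := by
          rw [← abs_of_nonneg (pow_nonneg ht0 a), ← abs_mul, abs_of_nonneg (pow_nonneg ht0 a)]
          ring_nf
      _ ≤ _ := mul_le_mul_of_nonneg_right hmain (pow_nonneg ht0 a)
      _ ≤ _ := by
        rw [add_mul]
        exact add_le_add (by ring_nf; rfl) (mul_le_of_le_one_right hite hta)
  rcases Nat.eq_zero_or_pos a with rfl | ha0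
  · have hceil : 0 < ⌈x / 8⌉₊ := Nat.ceil_pos.2 (by positivity)
    simpa [hk.ne', hceil, abs_of_nonneg (hh.nonneg 0)] using hh.monotone (Nat.zero_le _)
  have hweight : F * W * (x⁻¹ ^ V * (a : ℝ) ^ (k + V + V) + x ^ V * (a : ℝ) ^ k) =
      F * (a : ℝ) ^ (k + V) * (W * ((a / x) ^ V + (a / x)⁻¹ ^ V)) := by
    have : (a : ℝ) ≠ 0 := by exact_mod_cast ha0.ne'
    simp only [inv_div, div_pow, inv_pow, pow_add]
    field_simp
  rw [hweight]
  rcases le_or_gt (x / 8) a with ha | ha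
  · rw [if_neg (not_lt.2 (Nat.ceil_le.2 ha)), add_zero]
    exact hh.abs_sub_le_of_div_le hx hs hW
      (pos_of_mul_pos_left (zero_lt_one.trans_le hW0) (by positivity)).le ha
  · rw [if_pos (Nat.lt_ceil.2 ha)]
    exact hh.abs_sub_le_of_lt hx hW0 ha0 ha

end LaplaceProfile

end Laplace

section LaplaceSum

theorem factorial_add_le_pow_mul_factorial (m J : ℕ) :
    (m + J).factorial ≤ (m + J) ^ J * m.factorial := by
  have h := Nat.factorial_mul_descFactorial (Nat.le_add_left J m)
  rw [Nat.add_sub_cancel] at h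
  rw [← h, mul_comm]
  exact Nat.mul_le_mul_right _ (Nat.descFactorial_le_pow _ J)

theorem pow_div_exp_one_pow_le_factorial (n : ℕ) :
    (n : ℝ) ^ n / Real.exp 1 ^ n ≤ n.factorial := by
  rw [div_le_iff₀ (by positivity), ← Real.exp_nat_mul, mul_one, mul_comm,
    ← div_le_iff₀ (by positivity)]
  exact Real.pow_div_factorial_le_exp n (Nat.cast_nonneg n) n

theorem exp_one_div_seven_le : Real.exp 1 / 7 ≤ Real.exp (-(1 / 2)) := by
  have hcube : Real.exp (3 / 2) ^ 2 ≤ 7 ^ 2 := by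
    calc Real.exp (3 / 2) ^ 2 = Real.exp 1 ^ 3 := by
          rw [← Real.exp_nat_mul, ← Real.exp_nat_mul]; norm_num
      _ ≤ 3 ^ 3 := by gcongr; exact Real.exp_one_lt_three.le
      _ ≤ 7 ^ 2 := by norm_num
  rw [div_le_iff₀ (by norm_num), ← div_le_iff₀' (Real.exp_pos _), ← Real.exp_sub,
    show (1 : ℝ) - -(1 / 2) = 3 / 2 by norm_num]
  exact (pow_le_pow_iff_left₀ (Real.exp_pos _).le (by norm_num) two_ne_zero).1 hcube

theorem exists_sqrt_mul_mul_pow_mul_exp_le (K : ℝ) : ∃ C : ℝ, 0 < C ∧ ∀ n : ℕ,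
    √(n : ℝ) * (n * (Real.exp 1 / 7) ^ n * Real.exp (K * √(n : ℝ))) ≤ C := by
  refine ⟨6 * Real.exp ((K + 1) ^ 2 / 2), by positivity, fun n => ?_⟩
  set Q := √(n : ℝ)
  have hQ0 : 0 ≤ Q := Real.sqrt_nonneg _
  have hQ2 : Q ^ 2 = n := Real.sq_sqrt (Nat.cast_nonneg n)
  have hpow : (Real.exp 1 / 7) ^ n ≤ Real.exp (-(Q ^ 2 / 2)) := by
    calc (Real.exp 1 / 7) ^ n ≤ Real.exp (-(1 / 2)) ^ n := by gcongr; exact exp_one_div_seven_le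
      _ = Real.exp (-(Q ^ 2 / 2)) := by rw [← Real.exp_nat_mul, hQ2]; ring_nf
  have hcube : Q ^ 3 ≤ 6 * Real.exp Q := by
    have := Real.pow_div_factorial_le_exp Q hQ0 3
    rw [div_le_iff₀ (by positivity), mul_comm] at this
    exact_mod_cast this
  calc Q * (n * (Real.exp 1 / 7) ^ n * Real.exp (K * Q))
      = Q ^ 3 * ((Real.exp 1 / 7) ^ n * Real.exp (K * Q)) := by rw [← hQ2]; ring
    _ ≤ 6 * Real.exp Q * (Real.exp (-(Q ^ 2 / 2)) * Real.exp (K * Q)) := by gcongr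
    _ = 6 * Real.exp (Q + (-(Q ^ 2 / 2) + K * Q)) := by rw [Real.exp_add Q, Real.exp_add]; ring
    _ ≤ 6 * Real.exp ((K + 1) ^ 2 / 2) := by
        gcongr
        nlinarith [sq_nonneg (Q - (K + 1))]

namespace LaplaceProfile

variable {n : ℕ} {x c d η : ℝ} {h : ℕ → ℝ}

theorem ceil_mul_le (hh : LaplaceProfile n x c d η h) (hx : 56 ≤ x) (hc : 0 ≤ c) (hd : 0 ≤ d) :
    ⌈x / 8⌉₊ * h ⌈x / 8⌉₊ ≤ x * ((x / 7) ^ n * Real.exp (64 * c + η)) := by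
  obtain ⟨δ, hδ, h_eq⟩ := hh.eq_mul_exp ⌈x / 8⌉₊ (Nat.le_ceil _)
  have hlower := Nat.le_ceil (x / 8)
  have hupper : (⌈x / 8⌉₊ : ℝ) ≤ x / 7 := by
    have := Nat.ceil_lt_add_one (by positivity : 0 ≤ x / 8)
    linarith
  set a : ℝ := (⌈x / 8⌉₊ : ℝ)
  have ha : 0 < a := by linarith
  have hexp : c * (x / a) ^ 2 - d * (x / a) ^ 4 + δ ≤ 64 * c + η := by
    have hratio : x / a ≤ 8 := by rw [div_le_iff₀ ha]; linarith
    have : c * (x / a) ^ 2 ≤ c * 8 ^ 2 := by gcongr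
    have : 0 ≤ d * (x / a) ^ 4 := by positivity
    linarith [(abs_le.1 hδ).2]
  rw [h_eq]
  gcongr
  linarith

theorem hasSum_sub_le {k V J : ℕ} {θ W s S : ℝ} (hh : LaplaceProfile (k + V + J) x c d η h)
    (hx : 0 < x) (hθ : 0 < θ) (hk : 0 < k) (hs : s ≤ V) (hW0 : 1 ≤ W * 2 ^ V)
    (hW : ∀ l δ, Real.exp (-l) ≤ 8 → |δ| ≤ η →
      |Real.exp (tiltExponent c d J l + δ) - 1| ≤ W * Real.exp (s * |l|))
    (hS : HasSum (fun a => h a * Real.exp (-θ) ^ a) S) :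
    |S - Real.exp (c - d) * x ^ J * powerSum (k + V) θ| ≤
      Real.exp (c - d) * x ^ J * W *
        (x⁻¹ ^ V * powerSum (k + V + V) θ + x ^ V * powerSum k θ) +
      ⌈x / 8⌉₊ * h ⌈x / 8⌉₊ := by
  have hceil : HasSum (fun a => if a < ⌈x / 8⌉₊ then h ⌈x / 8⌉₊ else 0)
      (⌈x / 8⌉₊ * h ⌈x / 8⌉₊) := by
    have := hasSum_sum_of_ne_finset_zero (L := SummationFilter.unconditional ℕ)
      (f := fun a => if a < ⌈x / 8⌉₊ then h ⌈x / 8⌉₊ else 0) (s := Finset.range ⌈x / 8⌉₊)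
      fun a ha => if_neg (by simpa using ha)
    rwa [Finset.sum_congr rfl fun a ha => if_pos (Finset.mem_range.1 ha), Finset.sum_const,
      Finset.card_range, nsmul_eq_mul] at this
  rw [← Real.norm_eq_abs, ← (hS.sub ((hasSum_powerSum (k + V) hθ).mul_left _)).tsum_eq]
  exact tsum_of_norm_bounded ((((((hasSum_powerSum _ hθ).mul_left _).add
    ((hasSum_powerSum _ hθ).mul_left _)).mul_left _)).add hceil) (hh.abs_mul_sub_le hx hk hs hW0 hW
      (Real.exp_pos _).le (Real.exp_le_one_iff.2 (neg_nonpos.2 hθ.le)))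

end LaplaceProfile

theorem LaplaceProfile.abs_mul_pow_div_sub_one_le {k V J : ℕ} {θ c d η W s S G ε₁ ε₂ : ℝ}
    {h : ℕ → ℝ} (hh : LaplaceProfile (k + V + J) ((k + V + J : ℕ) / θ) c d η h) (hθ : 0 < θ)
    (hk : 0 < k) (hs : s ≤ V) (hW0 : 1 ≤ W * 2 ^ V)
    (hW : ∀ l δ, Real.exp (-l) ≤ 8 → |δ| ≤ η →
      |Real.exp (tiltExponent c d J l + δ) - 1| ≤ W * Real.exp (s * |l|))
    (hS : HasSum (fun a => h a * Real.exp (-θ) ^ a) S)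
    (hG : ((θ / (k + V + J : ℕ)) ^ V * powerSum (k + V + V) θ +
      ((k + V + J : ℕ) / θ) ^ V * powerSum k θ) * θ ^ (k + V + 1) ≤ G * (k + V).factorial)
    (hsmall : ⌈(k + V + J : ℕ) / θ / 8⌉₊ * h ⌈(k + V + J : ℕ) / θ / 8⌉₊ * θ ^ (k + V + J + 1) ≤
      ε₁ * (Real.exp (c - d) * (k + V + J : ℕ) ^ J * (k + V).factorial))
    (hpeak : |powerSum (k + V) θ * θ ^ (k + V + 1) / (k + V).factorial - 1| ≤ ε₂) :
    |S * θ ^ (k + V + J + 1) / (Real.exp (c - d) * (k + V + J : ℕ) ^ J * (k + V).factorial) - 1| ≤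
      W * G + ε₁ + ε₂ := by
  set n := k + V + J
  have hn0 : (0 : ℝ) < n := by exact_mod_cast (by omega : 0 < n)
  have hW' : 0 < W := pos_of_mul_pos_left (zero_lt_one.trans_le hW0) (by positivity)
  set M := Real.exp (c - d) * (n : ℝ) ^ J * (k + V).factorial with hM
  have hM0 : 0 < M := by positivity
  set F := Real.exp (c - d) * (n / θ) ^ J with hF
  have hscale : ∀ z : ℝ, F * z * θ ^ (n + 1) =
      M * (z * θ ^ (k + V + 1) / (k + V).factorial) := fun z => by
    rw [show n + 1 = J + (k + V + 1) by omega, pow_add, hF, hM, div_pow]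
    field_simp
  have hdiff := hh.hasSum_sub_le (by positivity) hθ hk hs hW0 hW hS
  rw [inv_div] at hdiff
  set T := (θ / n) ^ V * powerSum (k + V + V) θ + (n / θ) ^ V * powerSum k θ
  have hsplit : S * θ ^ (n + 1) - M = (S - F * powerSum (k + V) θ) * θ ^ (n + 1) +
      M * (powerSum (k + V) θ * θ ^ (k + V + 1) / (k + V).factorial - 1) := by
    rw [mul_sub_one, ← hscale]
    ring
  rw [div_sub_one hM0.ne', abs_div, abs_of_pos hM0, div_le_iff₀ hM0, hsplit]
  refine (abs_add_le _ _).trans ?_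
  rw [abs_mul, abs_mul M, abs_of_pos hM0, abs_of_pos (pow_pos hθ _)]
  calc |S - F * powerSum (k + V) θ| * θ ^ (n + 1) +
        M * |powerSum (k + V) θ * θ ^ (k + V + 1) / (k + V).factorial - 1|
      ≤ (F * W * T + ⌈n / θ / 8⌉₊ * h ⌈n / θ / 8⌉₊) * θ ^ (n + 1) + M * ε₂ := by gcongr
    _ = W * (M * (T * θ ^ (k + V + 1) / (k + V).factorial)) +
        ⌈n / θ / 8⌉₊ * h ⌈n / θ / 8⌉₊ * θ ^ (n + 1) + M * ε₂ := by rw [← hscale]; ring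
    _ ≤ W * (M * G) + ε₁ * M + M * ε₂ := by
        gcongr
        rwa [div_le_iff₀ (by positivity)]
    _ = (W * G + ε₁ + ε₂) * M := by ring

theorem exists_ceil_mul_mul_pow_le (K : ℝ) : ∃ C : ℝ, 0 < C ∧
    ∀ {m J n : ℕ} {θ c d η : ℝ} {h : ℕ → ℝ}, n = m + J → 56 ≤ n → 0 < θ → θ ≤ 1 →
      TiltBounds K √(n : ℝ) c d J → η ≤ 1 → LaplaceProfile n (n / θ) c d η h →
      ⌈n / θ / 8⌉₊ * h ⌈n / θ / 8⌉₊ * θ ^ (n + 1) ≤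
        C / √(n : ℝ) * (Real.exp (c - d) * (n : ℝ) ^ J * m.factorial) := by
  obtain ⟨C, hC0, hC⟩ := exists_sqrt_mul_mul_pow_mul_exp_le (64 * K)
  refine ⟨C * Real.exp (1 + K), by positivity, ?_⟩
  intro m J n θ c d η h hn hn56 hθ hθ1 hb hη hh
  have hn56' : (56 : ℝ) ≤ n := by exact_mod_cast hn56
  set Q := √(n : ℝ)
  have hQ0 : 0 < Q := Real.sqrt_pos.2 (by linarith)
  have hnx : (n : ℝ) ≤ n / θ := le_div_self (Nat.cast_nonneg n) hθ hθ1
  have hmass : Real.exp (-K) * ((n : ℝ) ^ n / Real.exp 1 ^ n) ≤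
      Real.exp (c - d) * ((n : ℝ) ^ J * m.factorial) := by
    have hfac : (n.factorial : ℝ) ≤ (n : ℝ) ^ J * m.factorial := by
      rw [hn]
      exact_mod_cast factorial_add_le_pow_mul_factorial m J
    gcongr
    · linarith [hb.c_nonneg, hb.d_le]
    · exact (pow_div_exp_one_pow_le_factorial n).trans hfac
  calc ⌈n / θ / 8⌉₊ * h ⌈n / θ / 8⌉₊ * θ ^ (n + 1)
      ≤ n / θ * ((n / θ / 7) ^ n * Real.exp (64 * c + η)) * θ ^ (n + 1) := by
        exact mul_le_mul_of_nonneg_right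
          (hh.ceil_mul_le (hn56'.trans hnx) hb.c_nonneg hb.d_nonneg) (by positivity)
    _ = n * (n / 7) ^ n * Real.exp (64 * c + η) := by
        rw [div_right_comm, div_pow _ θ, pow_succ]
        field_simp
    _ ≤ n * (n / 7) ^ n * Real.exp (64 * K * Q + 1) := by
        have : 64 * c + η ≤ 64 * K * Q + 1 := by linarith [hb.c_le]
        gcongr
    _ = Q * (n * (Real.exp 1 / 7) ^ n * Real.exp (64 * K * Q)) * Real.exp (1 + K) / Q *
          (Real.exp (-K) * ((n : ℝ) ^ n / Real.exp 1 ^ n)) := by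
        rw [Real.exp_add, Real.exp_add, Real.exp_neg, div_pow, div_pow]
        field_simp
    _ ≤ C * Real.exp (1 + K) / Q * (Real.exp (c - d) * ((n : ℝ) ^ J * m.factorial)) := by
        gcongr
        exact hC n
    _ = _ := by rw [mul_assoc (Real.exp (c - d))]

theorem exists_tilt_order {K A : ℝ} (hK : 0 ≤ K) (hA : 0 ≤ A) : ∃ (L : ℝ) (n₀ : ℕ),
    ∀ {n : ℕ} {c d : ℝ} {J : ℕ}, n₀ ≤ n → TiltBounds K √(n : ℝ) c d J →
      ∃ k V : ℕ, n = k + V + J ∧ 0 < k ∧ J + V ≤ k ∧ A * √(n : ℝ) ≤ V ∧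
        V * (J + V) ≤ L * k := by
  have : 1 ≤ A + 3 * K + 1 := by linarith
  set B := A + 3 * K + 1
  refine ⟨2 * B ^ 2, ⌈(2 * B) ^ 2⌉₊ + 1, fun {n c d J} hn hb => ?_⟩
  have hn0 : (0 : ℝ) < n := by exact_mod_cast (by omega : 0 < n)
  set Q := √(n : ℝ)
  have hQ2 : Q ^ 2 = n := Real.sq_sqrt hn0.le
  have hBQ : 2 * B ≤ Q :=
    Real.le_sqrt_of_sq_le ((Nat.le_ceil _).trans (by exact_mod_cast (by omega)))
  have hVlt := Nat.ceil_lt_add_one (by positivity : 0 ≤ A * Q)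
  have hAV : A * Q ≤ ⌈A * Q⌉₊ := Nat.le_ceil _
  set V := ⌈A * Q⌉₊
  have hJV : (J : ℝ) + V ≤ B * Q := by
    have := (abs_le.1 hb.abs_sub_le).2
    nlinarith [hb.c_le, hb.one_le_const, hb.one_le_scale]
  have h2JV : 2 * (J + V) ≤ n := by
    have : 2 * ((J : ℝ) + V) ≤ n := by rw [← hQ2]; nlinarith
    exact_mod_cast this
  have hk : (n : ℝ) / 2 ≤ (n - V - J : ℕ) := by
    rw [Nat.sub_sub, Nat.cast_sub (by omega)]
    push_cast
    have : 2 * ((J : ℝ) + V) ≤ n := by exact_mod_cast h2JV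
    linarith
  refine ⟨n - V - J, V, by omega, by omega, by omega, hAV, ?_⟩
  calc (V : ℝ) * (J + V) ≤ (B * Q) * (B * Q) := by
        gcongr
        linarith [Nat.cast_nonneg (α := ℝ) J]
    _ = 2 * B ^ 2 * (n / 2) := by rw [← hQ2]; ring
    _ ≤ _ := by gcongr

theorem exists_laplace_bound {K : ℝ} (hK : 1 ≤ K) : ∃ (C : ℝ) (n₀ : ℕ), 0 < C ∧
    ∀ {n J : ℕ} {θ c d η S : ℝ} {h : ℕ → ℝ}, n₀ ≤ n → 0 < θ → θ ≤ 1 →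
      TiltBounds K √(n : ℝ) c d J → 0 ≤ η → η ≤ 1 → LaplaceProfile n (n / θ) c d η h →
      HasSum (fun a => h a * Real.exp (-θ) ^ a) S →
      2 * J ≤ n ∧
        |S * θ ^ (n + 1) / (Real.exp (c - d) * (n : ℝ) ^ J * (n - J).factorial) - 1| ≤
          C * (1 / √(n : ℝ) + η + θ ^ 2) := by
  obtain ⟨A, hA1, hA⟩ := exists_abs_exp_tiltExponent_add_sub_one_le hK
  obtain ⟨L, n₀, hL⟩ := exists_tilt_order (zero_le_one.trans hK) (zero_le_one.trans hA1)
  obtain ⟨CP, hCP0, hCP⟩ := exists_abs_powerSum_mul_pow_div_factorial_sub_one_le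
  obtain ⟨CC, hCC0, hCC⟩ := exists_ceil_mul_mul_pow_le K
  obtain ⟨G, hG0, hG⟩ := exists_tilted_powerSum_le L
  refine ⟨A * G + CC + CP, n₀ + 56, by positivity, ?_⟩
  intro n J θ c d η S h hn hθ hθ1 hb hη0 hη hh hS
  obtain ⟨k, V, hkVJ, hk, hJV, hAV, hVk⟩ := hL (by omega) hb
  have hn0 : (0 : ℝ) < n := by exact_mod_cast (by omega : 0 < n)
  set Q := √(n : ℝ)
  have hQ0 : 0 < Q := Real.sqrt_pos.2 hn0
  set W := A * (1 / Q + η) with hW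
  have hW0 : 1 ≤ W * 2 ^ V := by
    have hQV : Q ≤ 2 ^ V := by
      calc Q ≤ A * Q := le_mul_of_one_le_left hQ0.le hA1
        _ ≤ V := hAV
        _ ≤ 2 ^ V := by exact_mod_cast Nat.lt_two_pow_self.le
    calc 1 = 1 * (1 / Q + 0) * Q := by field_simp; ring
      _ ≤ A * (1 / Q + η) * 2 ^ V := by gcongr
  subst hkVJ
  refine ⟨by omega, ?_⟩
  rw [Nat.add_sub_cancel]
  calc _ ≤ W * G + CC / Q + CP * θ ^ 2 :=
        hh.abs_mul_pow_div_sub_one_le hθ hk hAV hW0 (fun _ _ hl hδ => hA hb hl hη hδ) hS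
          (hG rfl hk hVk hθ hθ1) (hCC rfl (by omega) hθ hθ1 hb hη hh)
          (hCP (k + V) θ (by omega) hθ hθ1)
    _ = A * G * (1 / Q + η) + CC * (1 / Q) + CP * θ ^ 2 := by rw [hW]; ring
    _ ≤ A * G * (1 / Q + η + θ ^ 2) + CC * (1 / Q + η + θ ^ 2) + CP * (1 / Q + η + θ ^ 2) := by
        have : 0 ≤ 1 / Q := by positivity
        refine add_le_add (add_le_add (mul_le_mul_of_nonneg_left ?_ (by positivity))
          (mul_le_mul_of_nonneg_left ?_ hCC0.le)) (mul_le_mul_of_nonneg_left ?_ hCP0.le) <;>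
          linarith [sq_nonneg θ]
    _ = _ := by ring

end LaplaceSum

section Expansions

theorem artanh_div_self_sub_mem_Icc {w : ℝ} (hw : 0 < w) (hw2 : w ^ 2 ≤ 1 / 2) :
    Real.artanh w / w - (1 + w ^ 2 / 3 + (w ^ 2) ^ 2 / 5) ∈ Set.Icc 0 (2 * (w ^ 2) ^ 3) := by
  have hw1 : w < 1 := by nlinarith
  have hlow := Real.sum_range_le_log_div hw.le hw1 3
  have hupp := Real.log_div_le_sum_range_add hw.le hw1 3
  rw [← Real.artanh_eq_half_log ⟨by linarith, hw1.le⟩] at hlow hupp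
  simp only [Finset.sum_range_succ, Finset.sum_range_zero] at hlow hupp
  norm_num at hlow hupp
  have htail : w ^ 7 / (1 - w ^ 2) ≤ 2 * w ^ 7 := by
    rw [div_le_iff₀ (by linarith), mul_right_comm]
    exact le_mul_of_one_le_left (by positivity) (by linarith)
  constructor
  · rw [sub_nonneg, le_div_iff₀ hw]
    linarith
  · rw [sub_le_iff_le_add, div_le_iff₀ hw]
    linarith

variable {g r : ℝ}

theorem sub_one_mem_Icc_of_expansion (hg2 : g ≤ 1 / 2)
    (hr : r - (1 + g / 3 + g ^ 2 / 5) ∈ Set.Icc 0 (2 * g ^ 3)) :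
    r - 1 ∈ Set.Icc (g / 3) (g / 3 + 6 / 5 * g ^ 2) := by
  have hcube : g ^ 3 ≤ g ^ 2 / 2 := by nlinarith [sq_nonneg g]
  constructor <;> linarith [hr.1, hr.2, sq_nonneg g]

theorem abs_log_sub_le_of_expansion (hg : 0 ≤ g) (hg2 : g ≤ 1 / 2)
    (hr : r - (1 + g / 3 + g ^ 2 / 5) ∈ Set.Icc 0 (2 * g ^ 3)) :
    |Real.log r - (g / 3 + 13 / 90 * g ^ 2)| ≤ 5 * g ^ 3 := by
  obtain ⟨hv, hv'⟩ := sub_one_mem_Icc_of_expansion hg2 hr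
  set v := r - 1 with hvr
  have hgg : g ^ 2 ≤ g / 2 := by nlinarith
  have hv0 : 0 ≤ v := by linarith
  have hvg : v ≤ g := by linarith
  have hlog := abs_log_one_add_sub_le (v := v) (by rw [abs_of_nonneg hv0]; linarith)
  rw [abs_of_nonneg hv0, hvr, add_sub_cancel, ← hvr] at hlog
  have hcube : v ^ 3 ≤ g ^ 3 := pow_le_pow_left₀ hv0 hvg 3
  have hsq : 0 ≤ v ^ 2 - (g / 3) ^ 2 := sub_nonneg.2 (pow_le_pow_left₀ (by positivity) hv 2)
  have hsq' : v ^ 2 - (g / 3) ^ 2 ≤ 6 / 5 * g ^ 2 * (4 / 3 * g) := by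
    rw [sq_sub_sq, mul_comm]
    exact mul_le_mul (by linarith) (by linarith) (by positivity) (by positivity)
  rw [abs_le] at hlog ⊢
  constructor <;> linarith [hr.1, hr.2, hlog.1, hlog.2]

theorem abs_mul_sq_sub_le_of_expansion (hg : 0 ≤ g) (hg2 : g ≤ 1 / 2)
    (hr : r - (1 + g / 3 + g ^ 2 / 5) ∈ Set.Icc 0 (2 * g ^ 3)) :
    |4 * g * r ^ 2 - (4 * g + 8 / 3 * g ^ 2)| ≤ 14 * g ^ 3 := by
  obtain ⟨hv, hv'⟩ := sub_one_mem_Icc_of_expansion hg2 hr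
  have hgg : g ^ 2 ≤ g / 2 := by nlinarith
  have hsq : (r - 1) ^ 2 ≤ g ^ 2 := pow_le_pow_left₀ (by linarith) (by linarith) 2
  rw [show 4 * g * r ^ 2 - (4 * g + 8 / 3 * g ^ 2) =
    4 * g * (2 * (r - 1 - g / 3) + (r - 1) ^ 2) by ring, abs_of_nonneg (by
      have : 0 ≤ r - 1 - g / 3 := sub_nonneg.2 hv
      positivity)]
  calc 4 * g * (2 * (r - 1 - g / 3) + (r - 1) ^ 2) ≤ 4 * g * (7 / 2 * g ^ 2) := by
        gcongr
        linarith
    _ = 14 * g ^ 3 := by ring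

variable {ε : ℝ}

theorem abs_one_sub_exp_neg_sub_le (hε : 0 ≤ ε) (hε1 : ε ≤ 1) :
    |1 - Real.exp (-ε) - (ε - ε ^ 2 / 2)| ≤ ε ^ 3 / 2 := by
  have h := Real.exp_bound (x := -ε) (by rwa [abs_neg, abs_of_nonneg hε])
    (by norm_num : 0 < 3)
  simp only [Finset.sum_range_succ, Finset.sum_range_zero, abs_neg, abs_of_nonneg hε,
    Nat.factorial] at h
  norm_num at h
  have hcube : 0 ≤ ε ^ 3 := by positivity
  rw [abs_le] at h ⊢
  constructor <;> linarith [h.1, h.2]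

theorem abs_sq_sub_sq_le_of_expansion (hε : 0 ≤ ε) (hε1 : ε ≤ 1) (hg : 0 ≤ g) (hgε : g ≤ ε)
    (h : |g - (ε - ε ^ 2 / 2)| ≤ ε ^ 3 / 2) : |g ^ 2 - ε ^ 2| ≤ 2 * ε ^ 3 := by
  have hcube : ε ^ 3 ≤ ε ^ 2 := pow_le_pow_of_le_one hε hε1 (by norm_num)
  rw [sq_sub_sq, abs_mul, abs_of_nonneg (by positivity : 0 ≤ g + ε)]
  calc (g + ε) * |g - ε| ≤ (2 * ε) * ε ^ 2 := by
        gcongr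
        · linarith
        · rw [abs_le] at h ⊢
          constructor <;> linarith [h.1, sq_nonneg ε]
    _ = 2 * ε ^ 3 := by ring

variable {w : ℝ}

theorem abs_log_artanh_div_self_sub_le (hε : 0 ≤ ε) (hε2 : ε ≤ 1 / 2) (hw : 0 < w)
    (hwε : w ^ 2 = 1 - Real.exp (-ε)) :
    |Real.log (Real.artanh w / w) - (ε / 3 - ε ^ 2 / 45)| ≤ 6 * ε ^ 3 := by
  have hexp := abs_one_sub_exp_neg_sub_le hε (by linarith)
  have hwle : w ^ 2 ≤ ε := by linarith [Real.add_one_le_exp (-ε)]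
  have hlog := abs_log_sub_le_of_expansion (sq_nonneg w) (by linarith)
    (artanh_div_self_sub_mem_Icc hw (by linarith))
  rw [← hwε] at hexp
  have hsq := abs_sq_sub_sq_le_of_expansion hε (by linarith) (sq_nonneg w) hwle hexp
  have hcube : (w ^ 2) ^ 3 ≤ ε ^ 3 := by gcongr
  have : 0 ≤ ε ^ 3 := by positivity
  rw [abs_le] at hexp hsq hlog ⊢
  constructor <;> linarith [hexp.1, hexp.2, hsq.1, hsq.2, hlog.1, hlog.2]

theorem abs_two_mul_artanh_sq_sub_le (hε : 0 ≤ ε) (hε2 : ε ≤ 1 / 2) (hw : 0 < w)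
    (hwε : w ^ 2 = 1 - Real.exp (-ε)) :
    |(2 * Real.artanh w) ^ 2 - (4 * ε + 2 / 3 * ε ^ 2)| ≤ 22 * ε ^ 3 := by
  have hexp := abs_one_sub_exp_neg_sub_le hε (by linarith)
  have hwle : w ^ 2 ≤ ε := by linarith [Real.add_one_le_exp (-ε)]
  have hθ := abs_mul_sq_sub_le_of_expansion (sq_nonneg w) (by linarith)
    (artanh_div_self_sub_mem_Icc hw (by linarith))
  rw [show 4 * w ^ 2 * (Real.artanh w / w) ^ 2 = (2 * Real.artanh w) ^ 2 by field_simp; ring] at hθ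
  rw [← hwε] at hexp
  have hsq := abs_sq_sub_sq_le_of_expansion hε (by linarith) (sq_nonneg w) hwle hexp
  have hcube : (w ^ 2) ^ 3 ≤ ε ^ 3 := by gcongr
  have : 0 ≤ ε ^ 3 := by positivity
  rw [abs_le] at hexp hsq hθ ⊢
  constructor <;> linarith [hexp.1, hexp.2, hsq.1, hsq.2, hθ.1, hθ.2]

theorem abs_neg_log_one_sub_sub_le {u : ℝ} (hu0 : 0 ≤ u) (hu : u ≤ 1 / 2) :
    |-Real.log (1 - u) - u| ≤ 2 * u ^ 2 := by
  have h := Real.abs_log_sub_add_sum_range_le (x := u) (by rw [abs_of_nonneg hu0]; linarith) 1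
  simp only [Finset.sum_range_succ, Finset.sum_range_zero, abs_of_nonneg hu0] at h
  norm_num at h
  rw [← neg_add', abs_neg, add_comm]
  refine h.trans ?_
  rw [div_le_iff₀ (by linarith), mul_right_comm]
  exact le_mul_of_one_le_left (sq_nonneg u) (by linarith)

theorem pow_mul_factorial_succ_eq_div {n J : ℕ} (h : J + 1 ≤ n) :
    (n : ℝ) ^ (J + 1) * (n - (J + 1)).factorial / n.factorial =
      (n : ℝ) ^ J * (n - J).factorial / n.factorial / (1 - J / n) := by
  have hn : (n : ℝ) ≠ 0 := by norm_cast; omega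
  obtain ⟨k, rfl⟩ := Nat.exists_eq_add_of_le h
  have hk : ((J + 1 + k : ℕ) : ℝ) - J = k + 1 := by push_cast; ring
  rw [one_sub_div hn, hk, Nat.add_sub_cancel_left, show J + 1 + k - J = k + 1 by omega,
    Nat.factorial_succ, pow_succ]
  push_cast at hn ⊢
  field_simp

theorem abs_log_pow_mul_factorial_sub_le {n J : ℕ} (h : 2 * J ≤ n) (hn : 0 < n) :
    |Real.log ((n : ℝ) ^ J * (n - J).factorial / n.factorial) - (J : ℝ) ^ 2 / (2 * n)| ≤
      J / (2 * n) + (J : ℝ) ^ 3 / n ^ 2 := by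
  have hn' : (0 : ℝ) < n := by exact_mod_cast hn
  induction J with
  | zero => simp [Nat.factorial_ne_zero]
  | succ J ih =>
    have ih := ih (by omega)
    have hJn : (J : ℝ) / n ≤ 1 / 2 := by
      have : 2 * (J : ℝ) ≤ n := by exact_mod_cast (by omega : 2 * J ≤ n)
      rw [div_le_iff₀ hn']
      linarith
    have hstep := abs_neg_log_one_sub_sub_le (by positivity) hJn
    rw [pow_mul_factorial_succ_eq_div (by omega), Real.log_div (by positivity) (by linarith)]
    push_cast
    have hmain : ((J : ℝ) + 1) ^ 2 / (2 * n) = J ^ 2 / (2 * n) + J / n + 1 / (2 * n) := by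
      field_simp; ring
    have herr : ((J : ℝ) + 1) / (2 * n) + (J + 1) ^ 3 / n ^ 2 = J / (2 * n) + J ^ 3 / n ^ 2 +
        1 / (2 * n) + 3 * (J / n) ^ 2 + (3 * J + 1) / n ^ 2 := by
      field_simp; ring
    have : (0 : ℝ) ≤ (3 * J + 1) / n ^ 2 := by positivity
    have : (0 : ℝ) ≤ 1 / (2 * n) := by positivity
    have : (0 : ℝ) ≤ (J / n : ℝ) ^ 2 := by positivity
    rw [hmain, herr]
    rw [abs_le] at *
    constructor <;> linarith [ih.1, ih.2, hstep.1, hstep.2]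

end Expansions

section MeanCountProfile

variable {n : ℕ} {lam : n.Partition} {a m : ℕ}

theorem count_one_le (lam : n.Partition) : lam.parts.count 1 ≤ n := by
  have h := Multiset.card_nsmul_le_sum fun x (hx : x ∈ lam.parts) => lam.parts_pos hx
  rw [lam.parts_sum, smul_eq_mul] at h
  exact (Multiset.count_le_card _ _).trans (by simpa using h)

theorem fixedDensity_mem_Icc (lam : n.Partition) : fixedDensity lam ∈ Set.Icc 0 1 :=
  ⟨by unfold fixedDensity; positivity,
    div_le_one_of_le₀ (by exact_mod_cast count_one_le lam) n.cast_nonneg⟩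

theorem pow_one_add_le_exp {x : ℝ} (hx : 0 ≤ x) {k n : ℕ} (hk : k ≤ n) :
    (1 + x) ^ k ≤ Real.exp (n * x) := by
  calc (1 + x) ^ k ≤ (1 + x) ^ n := pow_le_pow_right₀ (by linarith) hk
    _ ≤ Real.exp x ^ n := by
      gcongr
      linarith [Real.add_one_le_exp x]
    _ = Real.exp (n * x) := (Real.exp_nat_mul x n).symm

theorem two_mul_pow_mul_le_factorial_mul_meanCount (ha : 0 < a)
    (hm : lam.parts.count 1 = m) :
    (2 * (a : ℝ)) ^ n *
        (fixedFactor (4 * (a : ℝ) ^ 2) m * (1 - n / (2 * a) - (n / (2 * a)) ^ 2)) ≤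
      n.factorial * meanCount lam a := by
  have h := le_factorial_mul_meanCount ha hm
  rw [factorial_mul_enrichedCount_one m ha] at h
  refine le_trans (le_of_eq ?_) h
  rw [← Nat.add_sub_of_le (hm ▸ count_one_le lam : m ≤ n), pow_add]
  push_cast
  rw [Nat.add_sub_cancel_left]
  ring

theorem factorial_mul_meanCount_le_two_mul_pow_mul (ha : 0 < a)
    (hm : lam.parts.count 1 = m) :
    n.factorial * meanCount lam a ≤ (2 * (a : ℝ)) ^ n *
      (fixedFactor (4 * (a : ℝ) ^ 2) m * Real.exp (n / (2 * a) + 2 * (n / (2 * a)) ^ 2)) := by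
  have : (0 : ℝ) < a := by exact_mod_cast ha
  have hf := fixedFactor_pos (by positivity : 0 < 4 * (a : ℝ) ^ 2) m
  have h := factorial_mul_meanCount_le ha hm
  rw [factorial_mul_enrichedCount_one m ha] at h
  push_cast at h
  rw [mul_pow (2 * (a : ℝ))] at h
  have hexp : (1 + 1 / (2 * (a : ℝ)) + 2 * n / (2 * a) ^ 2) ^ (n - m) ≤
      Real.exp (n / (2 * a) + 2 * (n / (2 * a)) ^ 2) := by
    rw [add_assoc]
    refine (pow_one_add_le_exp (by positivity) (Nat.sub_le n m)).trans_eq ?_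
    congr 1
    field_simp
  calc _ ≤ _ := h
    _ = (2 * (a : ℝ)) ^ (m + (n - m)) * (fixedFactor (4 * (a : ℝ) ^ 2) m *
        (1 + 1 / (2 * (a : ℝ)) + 2 * n / (2 * a) ^ 2) ^ (n - m)) := by ring
    _ ≤ _ := by
      rw [Nat.add_sub_of_le (hm ▸ count_one_le lam)]
      gcongr

/-- The mean count `meanCount lam a`, normalized to be asymptotic to `a ^ n` as `a → ∞`. -/
noncomputable def normalizedMeanCount (lam : n.Partition) (a : ℕ) : ℝ :=
  n.factorial * meanCount lam a / 2 ^ n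

theorem normalizedMeanCount_monotone (hn : 0 < n) (lam : n.Partition) :
    Monotone (normalizedMeanCount lam) := fun a b hab => by
  have := meanCount_mono hn lam hab
  unfold normalizedMeanCount
  gcongr

theorem normalizedMeanCount_nonneg (lam : n.Partition) (a : ℕ) :
    0 ≤ normalizedMeanCount lam a :=
  div_nonneg (mul_nonneg (Nat.cast_nonneg _) (meanCount_nonneg lam a)) (by positivity)

theorem normalizedMeanCount_div_pow_mem_Icc (ha : 0 < a) (hm : lam.parts.count 1 = m) :
    normalizedMeanCount lam a / (a : ℝ) ^ n ∈ Set.Icc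
      (fixedFactor (4 * (a : ℝ) ^ 2) m * (1 - n / (2 * a) - (n / (2 * a)) ^ 2))
      (fixedFactor (4 * (a : ℝ) ^ 2) m * Real.exp (n / (2 * a) + 2 * (n / (2 * a)) ^ 2)) := by
  have : (0 : ℝ) < a := by exact_mod_cast ha
  unfold normalizedMeanCount
  rw [div_div, ← mul_pow]
  constructor
  · rw [le_div_iff₀' (by positivity)]
    exact two_mul_pow_mul_le_factorial_mul_meanCount ha hm
  · rw [div_le_iff₀' (by positivity)]
    exact factorial_mul_meanCount_le_two_mul_pow_mul ha hm

theorem abs_log_sub_log_le {F R u : ℝ} (hF : 0 < F) (hu0 : 0 ≤ u) (hu : u ≤ 1 / 4)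
    (hR : R ∈ Set.Icc (F * (1 - u - u ^ 2)) (F * Real.exp (u + 2 * u ^ 2))) :
    0 < R ∧ |Real.log R - Real.log F| ≤ 5 / 2 * u := by
  have hpos : 0 < 1 - u - u ^ 2 := by nlinarith
  have hR0 : 0 < R := lt_of_lt_of_le (mul_pos hF hpos) hR.1
  refine ⟨hR0, abs_sub_le_iff.2 ⟨?_, ?_⟩⟩
  · have h := Real.log_le_log hR0 hR.2
    rw [Real.log_mul hF.ne' (Real.exp_pos _).ne', Real.log_exp] at h
    nlinarith
  · have h := Real.log_le_log (mul_pos hF hpos) hR.1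
    rw [Real.log_mul hF.ne' hpos.ne'] at h
    have hinv : (1 - u - u ^ 2)⁻¹ ≤ 1 + 5 / 2 * u := by
      rw [inv_le_iff_one_le_mul₀ hpos]
      nlinarith [mul_nonneg hu0 (sub_nonneg.2 hu), mul_nonneg (sq_nonneg u) (sub_nonneg.2 hu)]
    linarith [Real.one_sub_inv_le_log_of_pos hpos]

/-- The coefficient of the quadratic term in the `LaplaceProfile` of the normalized mean count, for
a proportion `α` of fixed points. -/
noncomputable def quadraticTilt (α N θ : ℝ) : ℝ := α ^ 3 * N * θ ^ 2 / 12

/-- The coefficient of the quartic term in the `LaplaceProfile` of the normalized mean count, for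
a proportion `α` of fixed points. -/
noncomputable def quarticTilt (α N θ : ℝ) : ℝ := 3 * α ^ 5 * N * θ ^ 4 / 160

theorem tilt_eq_fixedFactor_exponent (hn : 0 < n) {θ : ℝ} (hθ : θ ≠ 0)
    (hm : lam.parts.count 1 = m) :
    quadraticTilt (fixedDensity lam) n θ * (n / θ / a) ^ 2 -
        quarticTilt (fixedDensity lam) n θ * (n / θ / a) ^ 4 =
      (m : ℝ) ^ 3 / (3 * (4 * (a : ℝ) ^ 2)) - 3 * (m : ℝ) ^ 5 / (10 * (4 * (a : ℝ) ^ 2) ^ 2) := by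
  have hn' : (n : ℝ) ≠ 0 := by exact_mod_cast hn.ne'
  rw [quadraticTilt, quarticTilt, fixedDensity, hm]
  field_simp
  ring

theorem fixedFactor_error_le {K θ u : ℝ} (hu0 : 0 ≤ u) (hu : u ≤ 4 * θ) (hθ : θ ≤ 1 / 16)
    (hθK : n * θ ^ 4 ≤ K) :
    20 * (u ^ 2 + n * (u ^ 2) ^ 3) ≤ (20 + 5120 * K) * θ := by
  have hK : 0 ≤ K := hθK.trans' (by positivity)
  have hsq : u ^ 2 ≤ 16 * θ ^ 2 := (pow_le_pow_left₀ hu0 hu 2).trans_eq (by ring)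
  have hθ2 : θ ^ 2 ≤ 1 / 16 * θ := by nlinarith
  have hsix : n * (u ^ 2) ^ 3 ≤ 256 * K * θ := by
    calc n * (u ^ 2) ^ 3 ≤ n * (16 * θ ^ 2) ^ 3 := by gcongr
      _ = 4096 * (n * θ ^ 4) * θ ^ 2 := by ring
      _ ≤ 4096 * K * (1 / 16 * θ) := by gcongr
      _ = 256 * K * θ := by ring
  linarith

theorem exists_normalizedMeanCount_eq (hn : 0 < n) (lam : n.Partition) {K θ : ℝ} (hK : 1 ≤ K)
    (hθ0 : 0 < θ) (hθ : θ ≤ 1 / 16) (hθK : n * θ ^ 4 ≤ K) (ha : n / θ / 8 ≤ a) :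
    ∃ δ, |δ| ≤ 5150 * K * θ ∧ normalizedMeanCount lam a = (a : ℝ) ^ n * Real.exp
      (quadraticTilt (fixedDensity lam) n θ * (n / θ / a) ^ 2 -
        quarticTilt (fixedDensity lam) n θ * (n / θ / a) ^ 4 + δ) := by
  have ha' : (0 : ℝ) < a := lt_of_lt_of_le (by positivity) ha
  obtain ⟨m, hm⟩ : ∃ m, lam.parts.count 1 = m := ⟨_, rfl⟩
  have hu : (n : ℝ) / (2 * a) ≤ 4 * θ := by
    rw [div_le_iff₀ (by positivity)]
    rw [div_div, div_le_iff₀ (by positivity)] at ha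
    linarith
  have hu0 : (0 : ℝ) ≤ n / (2 * a) := by positivity
  have hF := fixedFactor_pos (by positivity : 0 < 4 * (a : ℝ) ^ 2) m
  obtain ⟨hR0, hR⟩ := abs_log_sub_log_le hF hu0 (by linarith)
    (normalizedMeanCount_div_pow_mem_Icc (by exact_mod_cast ha') hm)
  have hsq : (n : ℝ) ^ 2 / (4 * (a : ℝ) ^ 2) = (n / (2 * a)) ^ 2 := by ring
  have hlogF := abs_log_fixedFactor_sub_le (b := 4 * (a : ℝ) ^ 2) (by positivity)
    (hm ▸ count_one_le lam : m ≤ n) (by rw [hsq]; nlinarith)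
  rw [hsq] at hlogF
  have herr := fixedFactor_error_le hu0 hu hθ hθK
  rw [tilt_eq_fixedFactor_exponent hn hθ0.ne' hm]
  refine ⟨Real.log (normalizedMeanCount lam a / (a : ℝ) ^ n) -
    ((m : ℝ) ^ 3 / (3 * (4 * (a : ℝ) ^ 2)) - 3 * (m : ℝ) ^ 5 / (10 * (4 * (a : ℝ) ^ 2) ^ 2)),
    ?_, ?_⟩
  · have : θ ≤ K * θ := le_mul_of_one_le_left hθ0.le hK
    refine (abs_sub_le _ _ _).trans ((add_le_add hR hlogF).trans ?_)
    linarith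
  · rw [add_sub_cancel, Real.exp_log hR0, mul_div_cancel₀ _ (by positivity)]

theorem laplaceProfile_normalizedMeanCount (hn : 0 < n) (lam : n.Partition) {K θ : ℝ} (hK : 1 ≤ K)
    (hθ0 : 0 < θ) (hθ : θ ≤ 1 / 16) (hθK : n * θ ^ 4 ≤ K) :
    LaplaceProfile n (n / θ) (quadraticTilt (fixedDensity lam) n θ)
      (quarticTilt (fixedDensity lam) n θ) (5150 * K * θ) (normalizedMeanCount lam) where
  monotone := normalizedMeanCount_monotone hn lam
  nonneg := normalizedMeanCount_nonneg lam
  eq_mul_exp _ ha := exists_normalizedMeanCount_eq hn lam hK hθ0 hθ hθK ha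

end MeanCountProfile

section LogTransform

/-- The main term of the logarithm of the Laplace transform, at `s`, of the number of peaks divided
by `Q = √n`, for a proportion `α` of fixed points. -/
noncomputable def logLaplaceMain (s Q α : ℝ) : ℝ :=
  -((1 - α ^ 3) / 3 * s * Q) +
    (1 / 45 + α ^ 3 / 18 - 3 * α ^ 5 / 10 + 2 * α ^ 6 / 9) * s ^ 2

variable {ε θ : ℝ}

theorem abs_pow_four_sub_le (hε : 0 ≤ ε) (hε2 : ε ≤ 1 / 2)
    (hθ : |θ ^ 2 - (4 * ε + 2 / 3 * ε ^ 2)| ≤ 22 * ε ^ 3) :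
    |θ ^ 4 - 16 * ε ^ 2| ≤ 168 * ε ^ 3 := by
  have hεε : ε ^ 2 ≤ ε / 2 := by nlinarith
  have hcube : ε ^ 3 ≤ ε ^ 2 / 2 := by nlinarith [sq_nonneg ε]
  have hsub : |θ ^ 2 - 4 * ε| ≤ 12 * ε ^ 2 := by
    rw [abs_le] at hθ ⊢
    constructor <;> linarith [hθ.1, hθ.2, sq_nonneg ε]
  have hadd : θ ^ 2 + 4 * ε ≤ 14 * ε := by linarith [(abs_le.1 hsub).2]
  rw [show θ ^ 4 - 16 * ε ^ 2 = (θ ^ 2 + 4 * ε) * (θ ^ 2 - 4 * ε) by ring, abs_mul,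
    abs_of_nonneg (by positivity : 0 ≤ θ ^ 2 + 4 * ε)]
  calc (θ ^ 2 + 4 * ε) * |θ ^ 2 - 4 * ε| ≤ 14 * ε * (12 * ε ^ 2) := by gcongr
    _ = 168 * ε ^ 3 := by ring

theorem abs_pow_mul_le {α b x X : ℝ} (hα : α ∈ Set.Icc (0 : ℝ) 1) (hb : 0 ≤ b) (hx : |x| ≤ X)
    (k : ℕ) : |α ^ k * b * x| ≤ b * X := by
  rw [abs_mul, abs_of_nonneg (mul_nonneg (pow_nonneg hα.1 k) hb)]
  exact mul_le_mul (mul_le_of_le_one_left hb (pow_le_one₀ hα.1 hα.2)) hx (abs_nonneg x) hb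

variable {α Q s : ℝ}

theorem abs_log_prefactor_sub_le {ρ : ℝ} (hε : 0 ≤ ε) (hε2 : ε ≤ 1 / 2) (hQ : 1 ≤ Q)
    (hρ : |ρ - (ε / 3 - ε ^ 2 / 45)| ≤ 6 * ε ^ 3) :
    |ε - (Q ^ 2 + 1) * ρ - (-(Q ^ 2 * ε) / 3 + (Q * ε) ^ 2 / 45)| ≤ ε + 12 * (Q ^ 2 * ε ^ 3) := by
  have hε3 : ε ^ 3 ≤ Q ^ 2 * ε ^ 3 := le_mul_of_one_le_left (by positivity) (one_le_pow₀ hQ)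
  have hmul : |(Q ^ 2 + 1) * (ρ - (ε / 3 - ε ^ 2 / 45))| ≤ (Q ^ 2 + 1) * (6 * ε ^ 3) := by
    rw [abs_mul, abs_of_pos (by positivity : 0 < Q ^ 2 + 1)]
    gcongr
  have hlow : |2 / 3 * ε + ε ^ 2 / 45| ≤ ε := by
    rw [abs_of_nonneg (by positivity)]
    nlinarith
  calc _ = |2 / 3 * ε + ε ^ 2 / 45 - (Q ^ 2 + 1) * (ρ - (ε / 3 - ε ^ 2 / 45))| := by
        congr 1; ring
    _ ≤ ε + (Q ^ 2 + 1) * (6 * ε ^ 3) := (abs_sub _ _).trans (add_le_add hlow hmul)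
    _ ≤ ε + 12 * (Q ^ 2 * ε ^ 3) := by linarith

theorem abs_quadraticTilt_sub_le (hα : α ∈ Set.Icc (0 : ℝ) 1) (hε : 0 ≤ ε)
    (hθ : |θ ^ 2 - (4 * ε + 2 / 3 * ε ^ 2)| ≤ 22 * ε ^ 3) :
    |quadraticTilt α (Q ^ 2) θ - α ^ 3 * (Q ^ 2 * ε / 3 + (Q * ε) ^ 2 / 18)| ≤
      2 * (Q ^ 2 * ε ^ 3) := by
  have h := abs_pow_mul_le hα (by positivity : 0 ≤ Q ^ 2 / 12) hθ 3
  have : 0 ≤ Q ^ 2 * ε ^ 3 := by positivity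
  calc _ = |α ^ 3 * (Q ^ 2 / 12) * (θ ^ 2 - (4 * ε + 2 / 3 * ε ^ 2))| := by
        rw [quadraticTilt]; congr 1; ring
    _ ≤ _ := by linarith

theorem abs_quarticTilt_sub_le (hα : α ∈ Set.Icc (0 : ℝ) 1) (hε : 0 ≤ ε)
    (hθ : |θ ^ 4 - 16 * ε ^ 2| ≤ 168 * ε ^ 3) :
    |quarticTilt α (Q ^ 2) θ - 3 * α ^ 5 / 10 * (Q * ε) ^ 2| ≤ 4 * (Q ^ 2 * ε ^ 3) := by
  have h := abs_pow_mul_le hα (by positivity : 0 ≤ 3 * Q ^ 2 / 160) hθ 5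
  have : 0 ≤ Q ^ 2 * ε ^ 3 := by positivity
  calc _ = |α ^ 5 * (3 * Q ^ 2 / 160) * (θ ^ 4 - 16 * ε ^ 2)| := by
        rw [quarticTilt]; congr 1; ring
    _ ≤ _ := by linarith

theorem abs_quadraticTilt_sq_sub_le (hα : α ∈ Set.Icc (0 : ℝ) 1) (hε : 0 ≤ ε) (hQ : Q ≠ 0)
    (hθ : |θ ^ 4 - 16 * ε ^ 2| ≤ 168 * ε ^ 3) :
    |2 * quadraticTilt α (Q ^ 2) θ ^ 2 / Q ^ 2 - 2 * α ^ 6 / 9 * (Q * ε) ^ 2| ≤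
      3 * (Q ^ 2 * ε ^ 3) := by
  have h := abs_pow_mul_le hα (by positivity : 0 ≤ Q ^ 2 / 72) hθ 6
  have : 0 ≤ Q ^ 2 * ε ^ 3 := by positivity
  calc _ = |α ^ 6 * (Q ^ 2 / 72) * (θ ^ 4 - 16 * ε ^ 2)| := by
        rw [quadraticTilt]; congr 1; field_simp; ring
    _ ≤ _ := by linarith

theorem abs_sub_two_mul_sq_div_le {K c d j D : ℝ} (h : TiltBounds K Q c d j) (hj : 0 ≤ j)
    (hD : |D - j ^ 2 / (2 * Q ^ 2)| ≤ j / (2 * Q ^ 2) + j ^ 3 / (Q ^ 2) ^ 2) :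
    |D - 2 * c ^ 2 / Q ^ 2| ≤ (4 * K + 27 * K ^ 3) * (1 / Q) := by
  have hQ : 0 < Q := one_pos.trans_le h.one_le_scale
  have hK : 0 ≤ K := zero_le_one.trans h.one_le_const
  have hKQ : 1 ≤ K * Q := one_le_mul_of_one_le_of_one_le h.one_le_const h.one_le_scale
  have hjQ : j ≤ 3 * K * Q := by linarith [(abs_le.1 h.abs_sub_le).2, h.c_le]
  have hpow : j / (2 * Q ^ 2) + j ^ 3 / (Q ^ 2) ^ 2 ≤ (3 / 2 * K + 27 * K ^ 3) * (1 / Q) := by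
    calc _ ≤ 3 * K * Q / (2 * Q ^ 2) + (3 * K * Q) ^ 3 / (Q ^ 2) ^ 2 := by gcongr
      _ = _ := by field_simp; ring
  have hsq : |j ^ 2 / (2 * Q ^ 2) - 2 * c ^ 2 / Q ^ 2| ≤ 5 / 2 * K * (1 / Q) := by
    have hadd : |j + 2 * c| ≤ 5 * K * Q := by
      rw [abs_of_nonneg (by linarith [h.c_nonneg])]
      linarith [h.c_le]
    rw [show j ^ 2 / (2 * Q ^ 2) - 2 * c ^ 2 / Q ^ 2 = (j + 2 * c) * (j - 2 * c) / (2 * Q ^ 2) by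
      field_simp; ring, abs_div, abs_mul, abs_of_pos (by positivity : 0 < 2 * Q ^ 2)]
    calc _ ≤ 5 * K * Q * 1 / (2 * Q ^ 2) := by
          gcongr
          exact h.abs_sub_le
      _ = _ := by field_simp
  calc _ ≤ _ := abs_sub_le _ (j ^ 2 / (2 * Q ^ 2)) _
    _ ≤ (3 / 2 * K + 27 * K ^ 3) * (1 / Q) + 5 / 2 * K * (1 / Q) :=
      add_le_add (hD.trans hpow) hsq
    _ = (4 * K + 27 * K ^ 3) * (1 / Q) := by ring

theorem abs_exponent_sub_logLaplaceMain_le {ρ j D K : ℝ} (hs : 0 ≤ s) (hs2 : s / Q ≤ 1 / 2)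
    (hα : α ∈ Set.Icc (0 : ℝ) 1) (hρ : |ρ - (s / Q / 3 - (s / Q) ^ 2 / 45)| ≤ 6 * (s / Q) ^ 3)
    (hθ : |θ ^ 2 - (4 * (s / Q) + 2 / 3 * (s / Q) ^ 2)| ≤ 22 * (s / Q) ^ 3) (hj : 0 ≤ j)
    (h : TiltBounds K Q (quadraticTilt α (Q ^ 2) θ) (quarticTilt α (Q ^ 2) θ) j)
    (hD : |D - j ^ 2 / (2 * Q ^ 2)| ≤ j / (2 * Q ^ 2) + j ^ 3 / (Q ^ 2) ^ 2) :
    |s / Q - (Q ^ 2 + 1) * ρ + quadraticTilt α (Q ^ 2) θ - quarticTilt α (Q ^ 2) θ + D -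
      logLaplaceMain s Q α| ≤ (s + 21 * s ^ 3 + 4 * K + 27 * K ^ 3) * (1 / Q) := by
  have hQ : 0 < Q := one_pos.trans_le h.one_le_scale
  have hε : 0 ≤ s / Q := by positivity
  have hθ4 := abs_pow_four_sub_le hε hs2 hθ
  have hpre := abs_log_prefactor_sub_le hε hs2 h.one_le_scale hρ
  have hquad := abs_quadraticTilt_sub_le (Q := Q) hα hε hθ
  have hquart := abs_quarticTilt_sub_le (Q := Q) hα hε hθ4
  have hsq := abs_quadraticTilt_sq_sub_le hα hε hQ.ne' hθ4
  have hfact := abs_sub_two_mul_sq_div_le h hj hD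
  have hcube : Q ^ 2 * (s / Q) ^ 3 = s ^ 3 * (1 / Q) := by field_simp
  have hlin : Q ^ 2 * (s / Q) = s * Q := by field_simp
  rw [hcube] at hpre hquad hquart hsq
  rw [hlin, mul_div_cancel₀ _ hQ.ne'] at hpre hquad
  rw [mul_div_cancel₀ _ hQ.ne'] at hquart hsq
  have hmain : logLaplaceMain s Q α = (-(s * Q) / 3 + s ^ 2 / 45) +
      α ^ 3 * (s * Q / 3 + s ^ 2 / 18) - 3 * α ^ 5 / 10 * s ^ 2 + 2 * α ^ 6 / 9 * s ^ 2 := by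
    rw [logLaplaceMain]; ring
  have hdiv : s / Q = s * (1 / Q) := div_eq_mul_one_div s Q
  rw [hmain]
  rw [abs_le] at *
  constructor <;>
    linarith [hpre.1, hpre.2, hquad.1, hquad.2, hquart.1, hquart.2, hsq.1, hsq.2, hfact.1,
      hfact.2, hdiv]

end LogTransform

section Transform

variable {n : ℕ} {w ε : ℝ}

/-- The Laplace transform, at `s`, of the number of peaks divided by `√n`, for a uniformly random
permutation of cycle type `lam`. -/
noncomputable def peakLaplace (lam : n.Partition) (s : ℝ) : ℝ :=
  uniformExp (cycleClass lam) fun π => Real.exp (-(s * (peaks π : ℝ) / √(n : ℝ)))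

theorem peakLaplace_pos (lam : n.Partition) (s : ℝ) : 0 < peakLaplace lam s :=
  div_pos (Finset.sum_pos (fun _ _ => Real.exp_pos _) (cycleClass_nonempty lam))
    (by exact_mod_cast (cycleClass_nonempty lam).card_pos)

theorem exists_sq_eq_one_sub_exp_neg (hε : 0 < ε) :
    ∃ w : ℝ, 0 < w ∧ w < 1 ∧ w ^ 2 = 1 - Real.exp (-ε) := by
  have hpos : 0 < 1 - Real.exp (-ε) := sub_pos.2 (Real.exp_lt_one_iff.2 (neg_lt_zero.2 hε))
  have hsq := Real.sq_sqrt hpos.le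
  refine ⟨√(1 - Real.exp (-ε)), Real.sqrt_pos.2 hpos, ?_, hsq⟩
  nlinarith [Real.exp_pos (-ε)]

theorem exp_neg_two_mul_artanh (hw0 : 0 < w) (hw1 : w < 1) :
    Real.exp (-(2 * Real.artanh w)) = (1 - w) / (1 + w) := by
  have : 0 < 1 - w := sub_pos.2 hw1
  rw [Real.artanh_eq_half_log ⟨by linarith, hw1.le⟩, ← mul_assoc, mul_one_div_cancel two_ne_zero,
    one_mul, ← Real.log_inv, inv_div, Real.exp_log (by positivity)]

theorem hasSum_normalizedMeanCount (hn : 0 < n) (lam : n.Partition) {s : ℝ} (hw0 : 0 < w)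
    (hw1 : w < 1) (hw : w ^ 2 = 1 - Real.exp (-(s / √(n : ℝ)))) :
    HasSum (fun a : ℕ => normalizedMeanCount lam a * Real.exp (-(2 * Real.artanh w)) ^ a)
      (n.factorial / 2 ^ n *
        (Real.exp (-(s / √(n : ℝ))) / 2 * (1 / w) ^ (n + 1) * peakLaplace lam s)) := by
  rw [exp_neg_two_mul_artanh hw0 hw1]
  have h1w : 0 < 1 - w := sub_pos.2 hw1
  have h := hasSum_meanCount hn lam (t := (1 - w) / (1 + w)) (by positivity)
    (by rw [div_lt_one (by linarith)]; linarith)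
  have hpeak : 4 * ((1 - w) / (1 + w)) / (1 + (1 - w) / (1 + w)) ^ 2 =
      Real.exp (-(s / √(n : ℝ))) := by
    rw [show Real.exp (-(s / √(n : ℝ))) = 1 - w ^ 2 by linarith]
    field_simp
    ring
  have hratio : (1 + (1 - w) / (1 + w)) / (1 - (1 - w) / (1 + w)) = 1 / w := by
    have : 1 - (1 - w) / (1 + w) = 2 * w / (1 + w) := by field_simp; ring
    rw [this]
    field_simp
    ring
  have hpow : (fun π : Equiv.Perm (Fin n) => Real.exp (-(s / √(n : ℝ))) ^ peaks π) =
      fun π => Real.exp (-(s * (peaks π : ℝ) / √(n : ℝ))) := by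
    funext π
    rw [← Real.exp_nat_mul]
    congr 1
    ring
  rw [hpeak, hratio, hpow] at h
  refine (h.mul_left (n.factorial / 2 ^ n : ℝ)).congr_fun fun a => ?_
  rw [normalizedMeanCount]
  ring

theorem two_mul_artanh_sq_le (hε : 0 ≤ ε) (hε4 : ε ≤ 1 / 4) (hw0 : 0 < w)
    (hw : w ^ 2 = 1 - Real.exp (-ε)) : (2 * Real.artanh w) ^ 2 ≤ 6 * ε := by
  have h := (abs_le.1 (abs_two_mul_artanh_sq_sub_le hε (by linarith) hw0 hw)).2
  have hsq : ε ^ 2 ≤ 1 / 4 * ε := by nlinarith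
  have hcube : ε ^ 3 ≤ 1 / 16 * ε := by nlinarith
  linarith

theorem tiltBounds_floor {s α Q θ : ℝ} (hs : 0 < s) (hQ : 1 ≤ Q) (hα : α ∈ Set.Icc (0 : ℝ) 1)
    (hθ : θ ^ 2 ≤ 6 * (s / Q)) :
    TiltBounds (1 + s + 36 * s ^ 2) Q (quadraticTilt α (Q ^ 2) θ) (quarticTilt α (Q ^ 2) θ)
      (⌊2 * quadraticTilt α (Q ^ 2) θ⌋₊ : ℕ) := by
  have hα0 := hα.1
  have hquad : 0 ≤ quadraticTilt α (Q ^ 2) θ := by unfold quadraticTilt; positivity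
  refine ⟨by linarith [sq_nonneg s], hQ, hquad, ?_, by unfold quarticTilt; positivity, ?_, ?_⟩
  · calc quadraticTilt α (Q ^ 2) θ ≤ 1 * Q ^ 2 * (6 * (s / Q)) / 12 := by
          unfold quadraticTilt
          gcongr
          exact pow_le_one₀ hα0 hα.2
      _ = s / 2 * Q := by field_simp; norm_num
      _ ≤ _ := by gcongr; linarith [sq_nonneg s]
  · calc quarticTilt α (Q ^ 2) θ = 3 * α ^ 5 * Q ^ 2 * (θ ^ 2) ^ 2 / 160 := by
          unfold quarticTilt; ring
      _ ≤ 3 * 1 * Q ^ 2 * (6 * (s / Q)) ^ 2 / 160 := by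
          gcongr
          exact pow_le_one₀ hα0 hα.2
      _ = 27 / 40 * s ^ 2 := by field_simp; norm_num
      _ ≤ _ := by linarith [sq_nonneg s]
  · rw [abs_le]
    constructor <;> linarith [Nat.floor_le (by positivity : 0 ≤ 2 * quadraticTilt α (Q ^ 2) θ),
      Nat.lt_floor_add_one (2 * quadraticTilt α (Q ^ 2) θ)]

theorem abs_log_le_two_mul {x : ℝ} (hx : |x - 1| ≤ 1 / 2) : |Real.log x| ≤ 2 * |x - 1| := by
  have hx0 : 0 < x := by linarith [(abs_le.1 hx).1]
  rw [abs_le]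
  constructor
  · have hinv : x⁻¹ ≤ 1 + 2 * |x - 1| := by
      rw [inv_le_iff_one_le_mul₀ hx0]
      nlinarith [neg_abs_le (x - 1), abs_nonneg (x - 1)]
    linarith [Real.one_sub_inv_le_log_of_pos hx0]
  · linarith [Real.log_le_sub_one_of_pos hx0, le_abs_self (x - 1), abs_nonneg (x - 1)]

/-- The quotient of `2⁻ⁿ n!` times the generating function of the mean counts, evaluated at
`t = exp (-2 artanh w)` with `w² = 1 - exp (-ε)` and written through the peak transform `E`, by its
Laplace approximation with `J` factors taken out of the factorial. -/
noncomputable def laplaceRatio (n J : ℕ) (w ε c d E : ℝ) : ℝ :=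
  n.factorial / 2 ^ n * (Real.exp (-ε) / 2 * (1 / w) ^ (n + 1) * E) *
    (2 * Real.artanh w) ^ (n + 1) / (Real.exp (c - d) * (n : ℝ) ^ J * (n - J).factorial)

theorem laplaceRatio_eq (J : ℕ) (hw : w ≠ 0) (c d E : ℝ) :
    laplaceRatio n J w ε c d E = Real.exp (-ε) * (Real.artanh w / w) ^ (n + 1) * E /
      (Real.exp (c - d) * ((n : ℝ) ^ J * (n - J).factorial / n.factorial)) := by
  rw [laplaceRatio, div_pow, div_pow, one_pow, mul_pow, pow_succ 2 n]
  field_simp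

theorem log_eq_exponent_add_log_laplaceRatio (hn : 0 < n) (J : ℕ) {E : ℝ} (hw0 : 0 < w)
    (hw1 : w < 1) (hE : 0 < E) (c d : ℝ) :
    Real.log E = ε - (n + 1) * Real.log (Real.artanh w / w) + c - d +
      Real.log ((n : ℝ) ^ J * (n - J).factorial / n.factorial) +
      Real.log (laplaceRatio n J w ε c d E) := by
  have hr : 0 < Real.artanh w / w := div_pos (Real.artanh_pos ⟨hw0, hw1⟩) hw0
  have hY : 0 < (n : ℝ) ^ J * (n - J).factorial / n.factorial := by positivity
  rw [laplaceRatio_eq J hw0.ne']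
  generalize Real.artanh w / w = r at hr
  generalize (n : ℝ) ^ J * (n - J).factorial / n.factorial = Y at hY
  rw [Real.log_div (by positivity) (by positivity), Real.log_mul (by positivity) hE.ne',
    Real.log_mul (by positivity) (by positivity), Real.log_mul (by positivity) hY.ne',
    Real.log_exp, Real.log_exp, Real.log_pow]
  push_cast
  ring

theorem exists_le_sqrt_sqrt (R : ℝ) : ∃ n₀ : ℕ, ∀ n : ℕ, n₀ ≤ n → R ≤ √√(n : ℝ) :=
  Filter.eventually_atTop.1 <| (Real.tendsto_sqrt_atTop.comp <| Real.tendsto_sqrt_atTop.comp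
    tendsto_natCast_atTop_atTop).eventually_ge_atTop R

theorem laplace_error_le {C K R s θ : ℝ} (hC : 0 ≤ C) (hK : 0 ≤ K) (hs : 0 ≤ s) (hR : 1 ≤ R)
    (hθ : θ ≤ 3 * √s * (1 / R)) (hθ2 : θ ^ 2 ≤ 6 * (s / R ^ 2)) :
    C * (1 / R ^ 2 + 5150 * K * θ + θ ^ 2) ≤
      C * (1 + 15450 * K * √s + 6 * s) * (1 / R) := by
  have hinv : 1 / R ^ 2 ≤ 1 / R := by
    gcongr
    exact le_self_pow₀ hR two_ne_zero
  have hlin : 5150 * K * θ ≤ 5150 * K * (3 * √s * (1 / R)) := by gcongr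
  have hsq : s * (1 / R ^ 2) ≤ s * (1 / R) := by gcongr
  rw [div_eq_mul_one_div] at hθ2
  rw [mul_assoc C]
  gcongr
  linarith

theorem laplace_scale_bounds {K Q R s θ : ℝ} (hK : 1 ≤ K) (hs : 0 < s)
    (hR : 1 + 15450 * K * √s + 4 * s ≤ R) (hQ : Q = R ^ 2) (hθ : θ ^ 2 ≤ 6 * (s / Q)) :
    θ ≤ 3 * √s * (1 / R) ∧ 5150 * K * θ ≤ 1 ∧ Q ^ 2 * θ ^ 4 ≤ 36 * s ^ 2 := by
  have hR0 : 0 < R := hR.trans_lt' (by positivity)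
  have hlin : θ ≤ 3 * √s * (1 / R) := by
    refine le_of_sq_le_sq (hθ.trans ?_) (by positivity)
    rw [mul_pow, mul_pow, Real.sq_sqrt hs.le, hQ, div_pow, one_pow, ← div_eq_mul_one_div,
      ← mul_div_assoc]
    gcongr
    norm_num
  refine ⟨hlin, ?_, ?_⟩
  · calc 5150 * K * θ ≤ 5150 * K * (3 * √s * (1 / R)) := by gcongr
      _ = 15450 * K * √s / R := by ring
      _ ≤ 1 := (div_le_one hR0).2 (by linarith)
  · have hQ0 : 0 < Q := hQ ▸ by positivity
    calc Q ^ 2 * θ ^ 4 = Q ^ 2 * (θ ^ 2) ^ 2 := by ring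
      _ ≤ Q ^ 2 * (6 * (s / Q)) ^ 2 := by gcongr
      _ = 36 * s ^ 2 := by field_simp; norm_num

theorem exists_laplaceRatio_bound {s : ℝ} (hs : 0 < s) : ∃ (C : ℝ) (n₀ : ℕ), 0 < C ∧
    ∀ {n : ℕ} {w : ℝ}, n₀ ≤ n → 0 < n → ∀ lam : n.Partition, 0 < w → w < 1 →
      w ^ 2 = 1 - Real.exp (-(s / √(n : ℝ))) → s / √(n : ℝ) ≤ 1 / 4 → ∀ {c d : ℝ} {J : ℕ},
        c = quadraticTilt (fixedDensity lam) n (2 * Real.artanh w) →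
        d = quarticTilt (fixedDensity lam) n (2 * Real.artanh w) →
        TiltBounds (1 + s + 36 * s ^ 2) √(n : ℝ) c d J → 2 * J ≤ n ∧
        |laplaceRatio n J w (s / √(n : ℝ)) c d (peakLaplace lam s) - 1| ≤
          C * (1 / √√(n : ℝ)) := by
  set K := 1 + s + 36 * s ^ 2 with hK
  have hK1 : 1 ≤ K := by rw [hK]; linarith [sq_nonneg s]
  obtain ⟨C, n₁, hC, hLaplace⟩ := exists_laplace_bound hK1
  obtain ⟨n₂, hn₂⟩ := exists_le_sqrt_sqrt (1 + 15450 * K * √s + 4 * s)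
  refine ⟨C * (1 + 15450 * K * √s + 6 * s), max n₁ n₂, by positivity,
    fun {n w} hn hn0 lam hw0 hw1 hw hε c d J hc hd hTilt => ?_⟩
  have hR := hn₂ n (le_of_max_le_right hn)
  have hQ : √(n : ℝ) = √√(n : ℝ) ^ 2 := (Real.sq_sqrt (Real.sqrt_nonneg _)).symm
  have hθ := two_mul_artanh_sq_le (by positivity) hε hw0 hw
  have hθ0 : 0 < 2 * Real.artanh w := mul_pos two_pos (Real.artanh_pos ⟨hw0, hw1⟩)
  obtain ⟨hlin, hη, hquart⟩ := laplace_scale_bounds hK1 hs hR hQ hθ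
  rw [Real.sq_sqrt n.cast_nonneg] at hquart
  have hθ16 : 2 * Real.artanh w ≤ 1 / 16 := by nlinarith
  have hprofile := laplaceProfile_normalizedMeanCount hn0 lam hK1 hθ0 hθ16
    (hquart.trans (by rw [hK]; linarith))
  rw [← hc, ← hd] at hprofile
  obtain ⟨hJ, hmain⟩ := hLaplace (le_of_max_le_left hn) hθ0 (hθ16.trans (by norm_num)) hTilt
    (by positivity) hη hprofile (hasSum_normalizedMeanCount hn0 lam hw0 hw1 hw)
  refine ⟨hJ, hmain.trans ?_⟩
  have hR1 : 1 ≤ √√(n : ℝ) := hR.trans' (by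
    have : 0 ≤ 15450 * K * √s := by positivity
    linarith)
  rw [hQ] at hθ ⊢
  rw [Real.sqrt_sq (Real.sqrt_nonneg _)]
  exact laplace_error_le hC.le (zero_le_one.trans hK1) hs.le hR1 hlin hθ

theorem abs_log_peakLaplace_sub_le (hn : 0 < n) (lam : n.Partition) {s c d K : ℝ} {J : ℕ}
    (hs : 0 < s) (hε : s / √(n : ℝ) ≤ 1 / 4) (hw0 : 0 < w) (hw1 : w < 1)
    (hw : w ^ 2 = 1 - Real.exp (-(s / √(n : ℝ))))
    (hc : c = quadraticTilt (fixedDensity lam) n (2 * Real.artanh w))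
    (hd : d = quarticTilt (fixedDensity lam) n (2 * Real.artanh w))
    (hTilt : TiltBounds K √(n : ℝ) c d J) (hJ : 2 * J ≤ n)
    (hratio : |laplaceRatio n J w (s / √(n : ℝ)) c d (peakLaplace lam s) - 1| ≤ 1 / 2) :
    |Real.log (peakLaplace lam s) - logLaplaceMain s √(n : ℝ) (fixedDensity lam)| ≤
      (s + 21 * s ^ 3 + 4 * K + 27 * K ^ 3) * (1 / √(n : ℝ)) +
        2 * |laplaceRatio n J w (s / √(n : ℝ)) c d (peakLaplace lam s) - 1| := by
  have hQ : √(n : ℝ) ^ 2 = n := Real.sq_sqrt n.cast_nonneg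
  have hε0 : 0 ≤ s / √(n : ℝ) := by positivity
  have hε2 : s / √(n : ℝ) ≤ 1 / 2 := hε.trans (by norm_num)
  have hlog := abs_log_le_two_mul hratio
  have hfact := abs_log_pow_mul_factorial_sub_le hJ hn
  rw [← hQ] at hc hd hfact
  subst hc hd
  have hmain := abs_exponent_sub_logLaplaceMain_le hs.le hε2 (fixedDensity_mem_Icc lam)
    (abs_log_artanh_div_self_sub_le hε0 hε2 hw0 hw)
    (abs_two_mul_artanh_sq_sub_le hε0 hε2 hw0 hw) (Nat.cast_nonneg _) hTilt hfact
  rw [hQ] at hmain hlog ⊢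
  rw [log_eq_exponent_add_log_laplaceRatio (ε := s / √(n : ℝ)) hn J hw0 hw1 (peakLaplace_pos lam s)
    (quadraticTilt (fixedDensity lam) n (2 * Real.artanh w))
    (quarticTilt (fixedDensity lam) n (2 * Real.artanh w)), add_sub_right_comm]
  exact (abs_add_le _ _).trans (add_le_add hmain hlog)

theorem exists_log_peakLaplace_bound {s : ℝ} (hs : 0 < s) : ∃ (C : ℝ) (n₀ : ℕ), 0 < C ∧
    ∀ {n : ℕ}, n₀ ≤ n → 0 < n → ∀ lam : n.Partition,
      |Real.log (peakLaplace lam s) - logLaplaceMain s √(n : ℝ) (fixedDensity lam)| ≤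
        C * (1 / √√(n : ℝ)) := by
  obtain ⟨C, n₁, hC, hRatio⟩ := exists_laplaceRatio_bound hs
  obtain ⟨n₂, hn₂⟩ := exists_le_sqrt_sqrt (1 + 2 * C + 4 * s)
  set K := 1 + s + 36 * s ^ 2
  refine ⟨s + 21 * s ^ 3 + 4 * K + 27 * K ^ 3 + 2 * C, max n₁ n₂, by positivity,
    fun {n} hn hn0 lam => ?_⟩
  have hR := hn₂ n (le_of_max_le_right hn)
  have hR1 : 1 ≤ √√(n : ℝ) := by linarith
  have hRQ : √√(n : ℝ) ≤ √(n : ℝ) := Real.sqrt_le_self_iff.2 (.inr (Real.one_le_sqrt.1 hR1))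
  have hε : 0 < s / √(n : ℝ) := div_pos hs (by linarith)
  have hε4 : s / √(n : ℝ) ≤ 1 / 4 := by rw [div_le_iff₀ (by linarith)]; linarith
  obtain ⟨w, hw0, hw1, hw⟩ := exists_sq_eq_one_sub_exp_neg hε
  have hTilt := tiltBounds_floor hs (hR1.trans hRQ) (fixedDensity_mem_Icc lam)
    (two_mul_artanh_sq_le hε.le hε4 hw0 hw)
  rw [Real.sq_sqrt n.cast_nonneg] at hTilt
  obtain ⟨hJ, hratio⟩ := hRatio (le_of_max_le_left hn) hn0 lam hw0 hw1 hw hε4 rfl rfl hTilt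
  have hhalf : C * (1 / √√(n : ℝ)) ≤ 1 / 2 := by
    rw [mul_one_div, div_le_iff₀ (by linarith)]; linarith
  have hinv : 1 / √(n : ℝ) ≤ 1 / √√(n : ℝ) := by gcongr
  refine (abs_log_peakLaplace_sub_le hn0 lam hs hε4 hw0 hw1 hw rfl rfl hTilt hJ
    (hratio.trans hhalf)).trans ?_
  rw [add_mul _ (2 * C), mul_assoc 2]
  gcongr

end Transform

theorem exists_uniform_bound_of_forall_ge {ι : ℕ → Type*} [∀ n, Finite (ι n)]
    {f : (n : ℕ) → ι n → ℝ} {b : ℕ → ℝ} {C : ℝ} {n₀ : ℕ} (hb : ∀ n, 0 < n → 0 < b n) (hC : 0 < C)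
    (h : ∀ {n}, n₀ ≤ n → 0 < n → ∀ i, |f n i| ≤ C * b n) :
    ∃ C' : ℝ, 0 < C' ∧ ∀ n, 0 < n → ∀ i, |f n i| ≤ C' * b n := by
  have _ (n : ℕ) : Fintype (ι n) := Fintype.ofFinite _
  set T := ∑ k ∈ Finset.range n₀, ∑ i, |f k i / b k|
  have hT0 : 0 ≤ T := by positivity
  refine ⟨C + T, by positivity, fun n hn i => ?_⟩
  have hbn := hb n hn
  rcases le_or_gt n₀ n with hge | hlt
  · exact (h hge hn i).trans (by gcongr; linarith)
  · have hsum : |f n i / b n| ≤ T :=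
      (Finset.single_le_sum (f := fun i => |f n i / b n|) (fun _ _ => abs_nonneg _)
        (Finset.mem_univ i)).trans
        (Finset.single_le_sum (f := fun k => ∑ i, |f k i / b k|)
          (fun _ _ => Finset.sum_nonneg fun _ _ => abs_nonneg _) (Finset.mem_range.2 hlt))
    rw [abs_div, abs_of_pos hbn, div_le_iff₀ hbn] at hsum
    exact hsum.trans (by gcongr; linarith)

theorem one_div_sqrt_sqrt {x : ℝ} (hx : 0 ≤ x) : 1 / √√x = x ^ (-(1 / 4) : ℝ) := by
  rw [Real.rpow_neg hx, Real.sqrt_eq_rpow, Real.sqrt_eq_rpow, ← Real.rpow_mul hx, one_div]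
  norm_num

theorem theorem2 (s : ℝ) (hs : 0 < s) :
    ∃ C : ℝ, 0 < C ∧ ∀ (n : ℕ), 0 < n → ∀ lam : n.Partition, ∃ E : ℝ,
      |E| ≤ C * (n : ℝ) ^ (-(1 / 4) : ℝ) ∧
      uniformExp (cycleClass lam) (fun π => Real.exp (-(s * (peaks π : ℝ) / √(n : ℝ)))) =
        Real.exp (-((1 - fixedDensity lam ^ 3) / 3 * s * √(n : ℝ)) +
          (1 / 45 + fixedDensity lam ^ 3 / 18 - 3 * fixedDensity lam ^ 5 / 10 +
            2 * fixedDensity lam ^ 6 / 9) * s ^ 2 + E) := by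
  obtain ⟨C₀, n₀, hC₀, hlarge⟩ := exists_log_peakLaplace_bound hs
  obtain ⟨C, hC, hbound⟩ := exists_uniform_bound_of_forall_ge (C := C₀) (n₀ := n₀)
    (f := fun n (lam : n.Partition) =>
      Real.log (peakLaplace lam s) - logLaplaceMain s √(n : ℝ) (fixedDensity lam))
    (b := fun n => 1 / √√(n : ℝ)) (fun n hn => by positivity) hC₀ hlarge
  refine ⟨C, hC, fun n hn lam => ⟨Real.log (peakLaplace lam s) -
    logLaplaceMain s √(n : ℝ) (fixedDensity lam), ?_, ?_⟩⟩
  · exact one_div_sqrt_sqrt n.cast_nonneg ▸ hbound n hn lam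
  · calc peakLaplace lam s
      _ = Real.exp (Real.log (peakLaplace lam s)) := (Real.exp_log (peakLaplace_pos lam s)).symm
      _ = Real.exp (logLaplaceMain s √(n : ℝ) (fixedDensity lam) + (Real.log (peakLaplace lam s) -
          logLaplaceMain s √(n : ℝ) (fixedDensity lam))) := by rw [add_sub_cancel]
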